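/- Let $d\ge 1$ and consider $d$-dimensional Minkowski spacetime $\mathbb{R}^d$ with signature $(+,-,\dots,-)$ and time coordinate $x_0$; covectors $\xi$ are paired with vectors by $x\cdot\xi=\sum_i x_i\xi_i$. Let $\overline V{}^{\pm}=\{\xi : \xi_0^2-\sum_{i\ge1}\xi_i^2\ge 0,\ \pm\xi_0\ge 0\}$ be the closed forward/backward light cones (containing $0$), and let $V^-=\mathbb{R}^d\times\overline V{}^-\subset\mathbb{R}^d\times\mathbb{R}^d$. For $f\in\mathcal S(\mathbb{R}^d)$ and $h>0$ let $$(T_hf)(x,\xi)=2^{-d/2}(\pi h)^{-3d/4}\int_{\mathbb{R}^d} e^{-\frac{(x-y)^2}{2h}}e^{\frac{i}{h}(x-y)\cdot\xi}f(y)\,dy$$ be the semiclassical FBI transform. A family $(f_h)$ of Schwartz functions is polynomially bounded, $(f_h)\in\mathcal S_h$, if every Schwartz seminorm satisfies $p(f_h)=O(h^{-N})$ as $h\searrow0$ for some $N$ that may depend on $p$. It is microlocally uniformly exponentially small in $\mathcal U\subseteq\mathbb{R}^d\times\mathbb{R}^d$ if there is $\delta>0$ such that for every $N$ there is $C_N>0$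 with $(1+|x|^2+|\xi|^2)^N|(T_hf_h)(x,\xi)|\le C_Ne^{-\delta/h}$ for all $(x,\xi)\in\mathcal U$ and all sufficiently small $h>0$. It is uniformly microsupported in $K$ if it is microlocally uniformly exponentially small in $\{(x,\xi):\operatorname{dist}((x,\xi),K)>\epsilon\}$ for every $\epsilon>0$. Let $\mathcal S_{h,O}$ be the set of families in $\mathcal S_h$ that are uniformly microsupported in the zero section $\mathbb{R}^d\times\{0\}$. Let $(\Phi,D\subset\mathcal H,\Omega)$ be a tempered (scalar, hermitian) Wightman field on $\mathbb{R}^d$: $D$ is a dense subspace of the Hilbert space $\mathcal H$; $\Phi:\mathcal S(\mathbb{R}^d)\to\mathrm{End}(D)$ is linear, $f\mapsto\Phi(f)v$ is continuous for each $v\in D$, and $\Phi(f)$ is symmetric for real $f$; $U$ is a strongly continuous unitary representation of the restricted Poincaré group on $\mathcal H$ that preserves $D$ and satisfies $U(a,\Lambda)\Phi(f)U(a,\Lambda)^{-1}=\Phi(f(\Lambda^{-1}(\cdot-a)))$ on $D$; $\Omega\in D$ is a unit vector, $U$-invariant and cyclic for the fields; and fields with spacelike separated supports commute (or all anticommute).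 Assume the spectrum condition: the joint spectral measure of the generators $P$ of the translations $U(a,1)=e^{ia\cdot P}$ is carried by $\overline V{}^+$. Then $\Omega$ is a tempered analytic vector: if $K\subset\mathbb{R}^d\times\mathbb{R}^d$ is compact with $K\cap V^-=\emptyset$, then for every family $(f_h)\in\mathcal S_h$ uniformly microsupported in $K$, every $n\ge0$ and all $(q_{1,h}),\dots,(q_{n,h})\in\mathcal S_{h,O}$ there are $C,\delta>0$ such that $$\|\Phi(f_h)\Phi(q_{1,h})\cdots\Phi(q_{n,h})\Omega\|\le Ce^{-\delta/h}$$ for all sufficiently small $h>0$. The same conclusion holds, more generally, for every (not necessarily compact) set $K$ that has positive distance from $V^-$. -/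

import Mathlib

open MeasureTheory Filter Topology Asymptotics
open scoped SchwartzMap ENNReal InnerProductSpace

noncomputable section

namespace WightmanAnalytic

/-! ### Minkowski spacetime and phase space -/

/-- `ℝ^d`, used for points of Minkowski spacetime and, in the dual coordinates, for covectors. The
duality pairing of a vector `x` and a covector `ξ` is `∑ i, x i * ξ i = ⟪x, ξ⟫_ℝ`.
The index `0` is the time coordinate. -/
abbrev Spacetime (d : ℕ) : Type := EuclideanSpace ℝ (Fin d)

/-- Phase space `ℝ^d × ℝ^d` with its Euclidean distance; `p.fst` is the position `x` and `p.snd`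
the covector `ξ`. -/
abbrev PhaseSpace (d : ℕ) : Type := WithLp 2 (Spacetime d × Spacetime d)

section Minkowski

variable (d : ℕ) [NeZero d]

variable {d} in
/-- The Minkowski quadratic form of signature `(+,-,…,-)`. It has the same coordinate expression on
vectors and on covectors. -/
def minkowskiSq (x : Spacetime d) : ℝ :=
  x 0 ^ 2 - ∑ i ∈ Finset.univ.erase (0 : Fin d), x i ^ 2

/-- The closed forward light cone (it contains `0`). -/
def forwardCone : Set (Spacetime d) := {ξ | 0 ≤ minkowskiSq ξ ∧ 0 ≤ ξ 0}

/-- The closed backward light cone (it contains `0`). -/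
def backwardCone : Set (Spacetime d) := {ξ | 0 ≤ minkowskiSq ξ ∧ ξ 0 ≤ 0}

/-- `V⁻`: the bundle of closed backward light cones over Minkowski spacetime. -/
def backwardConeBundle : Set (PhaseSpace d) := {p | p.snd ∈ backwardCone d}

/-- The restricted (proper orthochronous) Lorentz group: the invertible linear maps that preserve
the Minkowski form, have determinant one and preserve the forward cone. It carries the topology
induced from the units of the normed algebra of linear maps. -/
def restrictedLorentz : Subgroup (Spacetime d →L[ℝ] Spacetime d)ˣ where
  carrier := {Λ | (∀ x, minkowskiSq (Λ.val x) = minkowskiSq x) ∧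
    LinearMap.det (Λ.val : Spacetime d →ₗ[ℝ] Spacetime d) = 1 ∧
    ∀ x, Λ.val x ∈ forwardCone d ↔ x ∈ forwardCone d}
  one_mem' := by
    refine ⟨fun x => rfl, ?_, fun x => Iff.rfl⟩
    exact LinearMap.det_id
  mul_mem' := by
    rintro Λ M ⟨h1, h2, h3⟩ ⟨k1, k2, k3⟩
    refine ⟨fun x => (h1 _).trans (k1 x), ?_, fun x => (h3 _).trans (k3 x)⟩
    have h := LinearMap.det_comp (Λ.val : Spacetime d →ₗ[ℝ] Spacetime d)
      (M.val : Spacetime d →ₗ[ℝ] Spacetime d)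
    rw [h2, k2, one_mul] at h
    exact h
  inv_mem' := by
    rintro Λ ⟨h1, h2, h3⟩
    have key : ∀ x, Λ.val ((Λ⁻¹).val x) = x := fun x => by
      have := congrArg (fun T : Spacetime d →L[ℝ] Spacetime d => T x) Λ.mul_inv
      exact this
    refine ⟨fun x => ?_, ?_, fun x => ?_⟩
    · rw [← h1, key]
    · have h := LinearMap.det_comp (Λ.val : Spacetime d →ₗ[ℝ] Spacetime d)
        ((Λ⁻¹).val : Spacetime d →ₗ[ℝ] Spacetime d)
      rw [h2, one_mul] at h
      rw [← h]
      have e : (Λ.val : Spacetime d →ₗ[ℝ] Spacetime d) ∘ₗ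
          ((Λ⁻¹).val : Spacetime d →ₗ[ℝ] Spacetime d) = LinearMap.id :=
        LinearMap.ext key
      rw [e]
      exact LinearMap.det_id
    · rw [← h3, key]

variable {d} in
/-- The Poincaré transform of a test function: `((a, Λ) f)(x) = f (Λ⁻¹ (x - a))`. -/
def poincareAct (a : Spacetime d) (Λ : restrictedLorentz d) (f : 𝓢(Spacetime d, ℂ)) :
    𝓢(Spacetime d, ℂ) :=
  SchwartzMap.compSubConstCLM ℂ a
    (SchwartzMap.compCLMOfContinuousLinearEquiv ℂ
      (ContinuousLinearEquiv.unitsEquiv ℝ (Spacetime d) (Λ⁻¹).val) f)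

end Minkowski

/-! ### The FBI transform and uniform microlocalisation

Families `(f_h)` are functions of a real parameter `h`; only the behaviour as `h ↘ 0`, that is
along the filter `𝓝[>] 0`, matters. -/

section Microlocal

variable {d : ℕ}

/-- The semiclassical FBI transform
`(T_h f)(x, ξ) = α_h ∫ e^{-(x-y)²/(2h)} e^{(i/h)(x-y)·ξ} f(y) dy`,
`α_h = 2^{-d/2} (π h)^{-3d/4}`. -/
def fbi (h : ℝ) (f : 𝓢(Spacetime d, ℂ)) (p : PhaseSpace d) : ℂ :=
  (((2 : ℝ) ^ (-(d : ℝ) / 2) * (Real.pi * h) ^ (-(3 * (d : ℝ)) / 4) : ℝ) : ℂ) *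
    ∫ y : Spacetime d,
      Complex.exp ((-(‖p.fst - y‖ ^ 2 / (2 * h)) : ℝ) : ℂ) *
        Complex.exp (Complex.I * ((⟪p.fst - y, p.snd⟫_ℝ / h : ℝ) : ℂ)) * f y

/-- `(f_h) ∈ 𝓢_h(ℝ^d)`: every Schwartz seminorm is `O(h^{-N})` as `h ↘ 0`, with `N` allowed to
depend on the seminorm. -/
def PolynomiallyBounded (f : ℝ → 𝓢(Spacetime d, ℂ)) : Prop :=
  ∀ k l : ℕ, ∃ N : ℕ,
    (fun h => SchwartzMap.seminorm ℝ k l (f h)) =O[𝓝[>] 0] fun h : ℝ => (h ^ N)⁻¹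

/-- The family is microlocally uniformly exponentially small in `𝒰`: there is one rate `δ` such that
for every `N` the function `(1 + x² + ξ²)^N |T_h f_h|` is at most `C_N e^{-δ/h}` on `𝒰`. -/
def MicrolocallyExpSmall (f : ℝ → 𝓢(Spacetime d, ℂ)) (𝒰 : Set (PhaseSpace d)) : Prop :=
  ∃ δ : ℝ, 0 < δ ∧ ∀ N : ℕ, ∃ C : ℝ, 0 < C ∧ ∀ᶠ h : ℝ in 𝓝[>] 0, ∀ p ∈ 𝒰,
    (1 + ‖p.fst‖ ^ 2 + ‖p.snd‖ ^ 2) ^ N * ‖fbi h (f h) p‖ ≤ C * Real.exp (-δ / h)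

/-- The family is uniformly microsupported in `K`: it is microlocally uniformly exponentially small
in `{p | dist (p, K) > ε}` for every `ε > 0`. The distance to the empty set is `∞`. -/
def UniformlyMicrosupported (f : ℝ → 𝓢(Spacetime d, ℂ)) (K : Set (PhaseSpace d)) : Prop :=
  ∀ ε : ℝ, 0 < ε → MicrolocallyExpSmall f {p | ENNReal.ofReal ε < Metric.infEDist p K}

/-- The zero section `ℝ^d × {0}`. -/
def zeroSection (d : ℕ) : Set (PhaseSpace d) := {p | p.snd = 0}

/-- `(q_h) ∈ 𝓢_{h,O}(ℝ^d)`: polynomially bounded families that are uniformly microsupported in the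
zero section. -/
def ZeroEnergy (q : ℝ → 𝓢(Spacetime d, ℂ)) : Prop :=
  PolynomiallyBounded q ∧ UniformlyMicrosupported q (zeroSection d)

end Microlocal

/-! ### Wightman fields -/

/-- A tempered (scalar, hermitian) Wightman field on `d`-dimensional Minkowski spacetime. The
spectrum condition is the separate predicate `SpectrumCondition` below. -/
structure WightmanField (d : ℕ) [NeZero d] (H : Type*) [NormedAddCommGroup H]
    [InnerProductSpace ℂ H] where
  /-- the invariant dense domain -/
  D : Submodule ℂ H
  D_dense : Dense (D : Set H)
  /-- the smeared field `Φ(f) : D → D` -/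
  Φ : 𝓢(Spacetime d, ℂ) →ₗ[ℂ] Module.End ℂ D
  /-- `Φ` is an operator-valued tempered distribution -/
  continuous_Φ : ∀ v : D, Continuous fun f : 𝓢(Spacetime d, ℂ) => ((Φ f v : D) : H)
  /-- `Φ(f)` is symmetric on `D` for real-valued `f` -/
  symmetric_Φ : ∀ f : 𝓢(Spacetime d, ℂ), (∀ x, (f x).im = 0) → ∀ v w : D,
    ⟪((Φ f v : D) : H), (w : H)⟫_ℂ = ⟪(v : H), ((Φ f w : D) : H)⟫_ℂ
  /-- the vacuum vector -/
  Ω : D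
  norm_Ω : ‖(Ω : H)‖ = 1
  /-- cyclicity of the vacuum -/
  cyclic_Ω : Dense (Submodule.span ℂ
    (Set.range fun L : List 𝓢(Spacetime d, ℂ) => (((L.map Φ).prod Ω : D) : H)) : Set H)
  /-- the unitary representation of the restricted Poincaré group -/
  U : Spacetime d → restrictedLorentz d → (H ≃ₗᵢ[ℂ] H)
  U_mul : ∀ (a b : Spacetime d) (Λ M : restrictedLorentz d) (ψ : H),
    U (a + Λ.val.val b) (Λ * M) ψ = U a Λ (U b M ψ)
  continuous_U : ∀ ψ : H, Continuous fun g : Spacetime d × restrictedLorentz d => U g.1 g.2 ψ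
  U_mem : ∀ (a : Spacetime d) (Λ : restrictedLorentz d) (v : D), U a Λ (v : H) ∈ D
  /-- invariance of the vacuum -/
  U_Ω : ∀ (a : Spacetime d) (Λ : restrictedLorentz d), U a Λ (Ω : H) = Ω
  /-- covariance: `U(a,Λ) Φ(f) U(a,Λ)⁻¹ = Φ((a,Λ) f)` on `D` -/
  covariant : ∀ (a : Spacetime d) (Λ : restrictedLorentz d) (f : 𝓢(Spacetime d, ℂ)) (v : D),
    U a Λ ((Φ f v : D) : H) = (Φ (poincareAct a Λ f) ⟨U a Λ (v : H), U_mem a Λ v⟩ : D)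
  /-- locality: fields with spacelike separated supports commute, or (in the other case of
  statistics) they all anticommute -/
  local_Φ : ∃ σ : ℂ, (σ = 1 ∨ σ = -1) ∧ ∀ f g : 𝓢(Spacetime d, ℂ),
    (∀ x ∈ tsupport f, ∀ y ∈ tsupport g, minkowskiSq (x - y) < 0) →
      ∀ v : D, Φ f (Φ g v) = σ • Φ g (Φ f v)

namespace WightmanField

variable {d : ℕ} [NeZero d] {H : Type*} [NormedAddCommGroup H] [InnerProductSpace ℂ H]
  (W : WightmanField d H)

/-- The spectrum condition: the joint spectral measure of the energy-momentum operators, the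
generators of the translations `U(a,1) = e^{i a·P}`, is carried by the closed forward light cone.
Here `μ` is the spectral measure `⟨ψ, E(·) ψ⟩` of the translation group in the vector `ψ`; it is
determined by its Fourier transform `a ↦ ⟨ψ, U(a,1) ψ⟩`. -/
def SpectrumCondition : Prop :=
  ∀ ψ : H, ∃ μ : Measure (Spacetime d), IsFiniteMeasure μ ∧ μ (forwardCone d)ᶜ = 0 ∧
    ∀ a : Spacetime d,
      ⟪ψ, W.U a 1 ψ⟫_ℂ = ∫ p, Complex.exp (Complex.I * ((⟪a, p⟫_ℝ : ℝ) : ℂ)) ∂μ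

/-- The exponential bound: for every family `(f_h) ∈ 𝓢_h` uniformly microsupported in `K` and all
families `(q_{1,h}), …, (q_{n,h}) ∈ 𝓢_{h,O}`, `n ≥ 0`, one has
`‖Φ(f_h) Φ(q_{1,h}) ⋯ Φ(q_{n,h}) v‖ ≤ C e^{-δ/h}` as `h ↘ 0` for some `C, δ > 0`. -/
def ExpSmallOn (v : W.D) (K : Set (PhaseSpace d)) : Prop :=
  ∀ f : ℝ → 𝓢(Spacetime d, ℂ), PolynomiallyBounded f → UniformlyMicrosupported f K →
    ∀ (n : ℕ) (q : Fin n → ℝ → 𝓢(Spacetime d, ℂ)), (∀ j, ZeroEnergy (q j)) →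
      ∃ C δ : ℝ, 0 < C ∧ 0 < δ ∧ ∀ᶠ h : ℝ in 𝓝[>] 0,
        ‖((W.Φ (f h) ((List.ofFn fun j => W.Φ (q j h)).prod v) : W.D) : H)‖ ≤
          C * Real.exp (-δ / h)

/-- Tempered analytic vectors: the exponential bound holds for every compact set of phase space that
is disjoint from `V⁻`. -/
def IsTemperedAnalytic (v : W.D) : Prop :=
  ∀ K : Set (PhaseSpace d), IsCompact K → Disjoint K (backwardConeBundle d) → W.ExpSmallOn v K

end WightmanField

end WightmanAnalytic

end

noncomputable section

namespace WightmanAnalytic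

/-! ### The Schwartz space is barrelled -/

section Frechet

variable {E F : Type*} [NormedAddCommGroup E] [NormedSpace ℝ E] [NormedAddCommGroup F]
  [NormedSpace ℝ F]

/-! Write `M(f₁, …, fₙ) = Φ(f₁) ⋯ Φ(fₙ) Ω`. The idea is to decompose every test function into
Gaussian wave packets and to use the spectrum condition, as an analyticity statement, on the vectors
created by packets.

Superposition. FBI inversion writes `f` as a multiple of the integral of `T_h f (x, ξ)` times the
packet at `(x, ξ)`. Hence `‖M f‖` is at most an integral of `∏ |T_h fᵢ|` times the norm of `M` at
packets (`norm_multilinear_le_of_packets`). This needs continuity of `M`: separate continuity comes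
from the formal adjoints of the fields and the uniform boundedness principle, and it improves to a
bound by a product of Schwartz seminorms (`exists_multilinear_bound`). On packets that bound is
polynomial in `1/h`, `|x|` and `|ξ|`.

Momentum shift. Up to the factor `exp(|ξ|² / 2h)`, the packet at `(x, ξ)` is a Gaussian translated
by the complex vector `x + iξ`. Translating all packets by `s y` with `s` real is the unitary `exp(i
s y·P)`; at `s = i` it is formally `exp(-y·P)`, which does not decrease norms if `y·p ≤ 0` on the
forward cone. This is `norm_packetCurve_zero_le`, proved by continuing a matrix element
analytically. Undoing the normalisation, replacing every `ξᵢ` by `ξᵢ + y` gains the factor `exp((y·∑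
ξᵢ + n |y|² / 2) / h)`. If `∑ ξᵢ` stays away from the backward cone, a small multiple of a
separating vector (`exists_unit_separating`) makes the exponent at most `-c / h`.

Conclusion. At a tuple of phase space points, either some `T_h fᵢ` is exponentially small, and the
polynomial bound suffices, or each point is near the microsupport of its family. In the latter case
the covector of `f_h` is near `K` and the others are near zero, so the sum is away from the backward
cone and the shift applies. Powers of `1/h` are absorbed by the exponential. -/

theorem schwartz_seminorm_sub_of_cauchySeq {u : ℕ → 𝓢(E, F)} (hu : CauchySeq u) (k l : ℕ)
    {ε : ℝ} (hε : 0 < ε) :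
    ∃ N, ∀ m ≥ N, ∀ n ≥ N, SchwartzMap.seminorm ℝ k l (u m - u n) < ε := by
  have hc : Continuous (SchwartzMap.seminorm ℝ k l : 𝓢(E, F) → ℝ) :=
    (schwartz_withSeminorms ℝ E F).continuous_seminorm (k, l)
  have h0 : {g : 𝓢(E, F) | SchwartzMap.seminorm ℝ k l g < ε} ∈ 𝓝 0 := by
    apply (isOpen_lt hc continuous_const).mem_nhds
    simpa using hε
  rw [cauchySeq_iff] at hu
  have hU := hu {p | p.2 - p.1 ∈ {g : 𝓢(E, F) | SchwartzMap.seminorm ℝ k l g < ε}} (by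
    rw [uniformity_eq_comap_nhds_zero]
    exact preimage_mem_comap h0)
  obtain ⟨N, hN⟩ := hU
  exact ⟨N, fun m hm n hn => hN n hn m hm⟩

/-- A Cauchy sequence of Schwartz functions whose derivatives converge pointwise converges. -/
theorem schwartz_tendsto_of_cauchySeq {u : ℕ → 𝓢(E, F)} (hu : CauchySeq u)
    (g : ∀ l : ℕ, E → E [×l]→L[ℝ] F)
    (hg : ∀ l x, Tendsto (fun n => iteratedFDeriv ℝ l (u n) x) atTop (𝓝 (g l x))) :
    ∃ f : 𝓢(E, F), Tendsto u atTop (𝓝 f) := by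
  -- Letting one index of the Cauchy estimate tend to infinity turns pointwise convergence of the
  -- derivatives into convergence in every weighted supremum norm.
  have key : ∀ (k l : ℕ) (ε : ℝ), 0 < ε → ∃ N, ∀ n ≥ N, ∀ x,
      ‖x‖ ^ k * ‖g l x - iteratedFDeriv ℝ l (u n) x‖ ≤ ε := by
    intro k l ε hε
    obtain ⟨N, hN⟩ := schwartz_seminorm_sub_of_cauchySeq hu k l hε
    refine ⟨N, fun n hn x => ?_⟩
    have ht : Tendsto (fun m => ‖x‖ ^ k * ‖iteratedFDeriv ℝ l (u m) x -
        iteratedFDeriv ℝ l (u n) x‖) atTop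
        (𝓝 (‖x‖ ^ k * ‖g l x - iteratedFDeriv ℝ l (u n) x‖)) :=
      (((hg l x).sub_const _).norm).const_mul _
    refine le_of_tendsto ht ?_
    filter_upwards [eventually_ge_atTop N] with m hm
    have h1 := SchwartzMap.le_seminorm ℝ k l (u m - u n) x
    have h2 : iteratedFDeriv ℝ l (⇑(u m - u n)) x =
        iteratedFDeriv ℝ l (u m) x - iteratedFDeriv ℝ l (u n) x := by
      have : (⇑(u m - u n) : E → F) = ⇑(u m) - ⇑(u n) := rfl
      rw [this, iteratedFDeriv_sub_apply ((u m).contDiffAt l) ((u n).contDiffAt l)]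
    rw [h2] at h1
    exact h1.trans (hN m hm n hn).le
  have hunif : ∀ l, TendstoUniformly (fun n x => iteratedFDeriv ℝ l (u n) x) (g l) atTop := by
    intro l
    rw [Metric.tendstoUniformly_iff]
    intro ε hε
    obtain ⟨N, hN⟩ := key 0 l (ε / 2) (by positivity)
    filter_upwards [eventually_ge_atTop N] with n hn x
    have := hN n hn x
    rw [pow_zero, one_mul, ← dist_eq_norm] at this
    linarith
  have hderiv : ∀ l x, HasFDerivAt (g l) (g (l + 1) x).curryLeft x := by
    intro l x
    refine hasFDerivAt_of_tendstoUniformly (l := atTop)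
      (f := fun n x => iteratedFDeriv ℝ l (u n) x)
      (f' := fun n x => (iteratedFDeriv ℝ (l + 1) (u n) x).curryLeft)
      (g' := fun x => (g (l + 1) x).curryLeft) ?_ ?_ (fun x => hg l x) x
    · have := (continuousMultilinearCurryLeftEquiv ℝ (fun _ : Fin (l + 1) => E)
        F).isometry.uniformContinuous.comp_tendstoUniformly (hunif (l + 1))
      exact this
    · intro n y
      have h := (((u n).smooth ⊤).differentiable_iteratedFDeriv (m := l)
        (by exact_mod_cast ENat.natCast_lt_top l)) y
      have h2 := h.hasFDerivAt
      have h3 : fderiv ℝ (iteratedFDeriv ℝ l (u n)) y =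
          (iteratedFDeriv ℝ (l + 1) (u n) y).curryLeft := by
        ext v m
        simp [iteratedFDeriv_succ_apply_left]
      rw [h3] at h2
      exact h2
  have htaylor : HasFTaylorSeriesUpTo (⊤ : ℕ∞) (fun x => g 0 x 0)
      (fun x l => g l x) := by
    constructor
    · exact fun x => rfl
    · exact fun l _ x => hderiv l x
    · exact fun l _ => continuous_iff_continuousAt.2 fun x => (hderiv l x).continuousAt
  have hit : ∀ l x, iteratedFDeriv ℝ l (fun x => g 0 x 0) x = g l x := by
    intro l x
    exact (htaylor.eq_iteratedFDeriv (m := l) (by exact_mod_cast le_top) x).symm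
  let f : 𝓢(E, F) :=
    { toFun := fun x => g 0 x 0
      smooth' := htaylor.contDiff
      decay' := by
        intro k l
        obtain ⟨N, hN⟩ := key k l 1 one_pos
        obtain ⟨C, hC⟩ := (u N).decay' k l
        refine ⟨1 + C, fun x => ?_⟩
        rw [hit]
        have h1 := hN N le_rfl x
        have h2 := hC x
        have h3 : ‖g l x‖ ≤ ‖g l x - iteratedFDeriv ℝ l (u N) x‖ +
          ‖iteratedFDeriv ℝ l (u N) x‖ := by
          simpa using norm_add_le (g l x - iteratedFDeriv ℝ l (u N) x)
            (iteratedFDeriv ℝ l (u N) x)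
        calc ‖x‖ ^ k * ‖g l x‖ ≤ ‖x‖ ^ k * (‖g l x - iteratedFDeriv ℝ l (u N) x‖ +
              ‖iteratedFDeriv ℝ l (u N) x‖) := by gcongr
          _ ≤ 1 + C := by
            rw [mul_add]
            exact add_le_add h1 h2 }
  refine ⟨f, ?_⟩
  rw [(schwartz_withSeminorms ℝ E F).tendsto_nhds]
  rintro ⟨k, l⟩ ε hε
  obtain ⟨N, hN⟩ := key k l (ε / 2) (by positivity)
  filter_upwards [eventually_ge_atTop N] with n hn
  refine lt_of_le_of_lt (SchwartzMap.seminorm_le_bound ℝ k l (u n - f)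
    (by positivity : 0 ≤ ε / 2) fun x => ?_) (half_lt_self hε)
  have h2 : iteratedFDeriv ℝ l (⇑(u n - f)) x =
      iteratedFDeriv ℝ l (u n) x - g l x := by
    have : (⇑(u n - f) : E → F) = ⇑(u n) - ⇑f := rfl
    rw [this, iteratedFDeriv_sub_apply ((u n).contDiffAt l) (f.contDiffAt l)]
    congr 1
    exact hit l x
  rw [h2, norm_sub_rev]
  exact hN n hn x

instance schwartz_uniformity_isCountablyGenerated :
    (uniformity 𝓢(E, F)).IsCountablyGenerated :=
  IsUniformAddGroup.uniformity_countably_generated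

instance schwartz_completeSpace [CompleteSpace F] : CompleteSpace 𝓢(E, F) := by
  refine UniformSpace.complete_of_cauchySeq_tendsto fun u hu => ?_
  have hc : ∀ l x, ∃ a, Tendsto (fun n => iteratedFDeriv ℝ l (u n) x) atTop (𝓝 a) := by
    intro l x
    refine cauchySeq_tendsto_of_complete (Metric.cauchySeq_iff.2 fun ε hε => ?_)
    obtain ⟨N, hN⟩ := schwartz_seminorm_sub_of_cauchySeq hu 0 l hε
    refine ⟨N, fun m hm n hn => ?_⟩
    have h1 := SchwartzMap.norm_iteratedFDeriv_le_seminorm ℝ (u m - u n) l x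
    have h2 : iteratedFDeriv ℝ l (⇑(u m - u n)) x =
        iteratedFDeriv ℝ l (u m) x - iteratedFDeriv ℝ l (u n) x := by
      have : (⇑(u m - u n) : E → F) = ⇑(u m) - ⇑(u n) := rfl
      rw [this, iteratedFDeriv_sub_apply ((u m).contDiffAt l) ((u n).contDiffAt l)]
    rw [h2] at h1
    rw [dist_eq_norm]
    exact h1.trans_lt (hN m hm n hn)
  choose g hg using hc
  exact schwartz_tendsto_of_cauchySeq hu g hg

/-- Complete and countably generated uniformities satisfy Baire's theorem. The resulting
barrelledness is what the uniform boundedness arguments rest on. -/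
instance schwartz_baireSpace [CompleteSpace F] : BaireSpace 𝓢(E, F) := by
  let _ : PseudoMetricSpace 𝓢(E, F) := UniformSpace.pseudoMetricSpace 𝓢(E, F)
  infer_instance

end Frechet

/-! ### Separately continuous multilinear maps on the Schwartz space -/

section Multilinear

variable {E : Type*} [NormedAddCommGroup E] [NormedSpace ℝ E]
  {H : Type*} [NormedAddCommGroup H] [NormedSpace ℂ H]

/-- The supremum of the Schwartz seminorms with both indices at most `m`. -/
def supSeminorm (E : Type*) [NormedAddCommGroup E] [NormedSpace ℝ E] (m : ℕ) :
    Seminorm ℂ 𝓢(E, ℂ) :=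
  (Finset.Iic (m, m)).sup (schwartzSeminormFamily ℂ E ℂ)

theorem seminorm_le_supSeminorm {k l m : ℕ} (hk : k ≤ m) (hl : l ≤ m) (f : 𝓢(E, ℂ)) :
    SchwartzMap.seminorm ℂ k l f ≤ supSeminorm E m f :=
  Seminorm.le_def.1 (Finset.le_sup (f := schwartzSeminormFamily ℂ E ℂ)
    (Finset.mem_Iic.2 (show ((k, l) : ℕ × ℕ) ≤ (m, m) from ⟨hk, hl⟩))) f

theorem supSeminorm_le {m : ℕ} {f : 𝓢(E, ℂ)} {C : ℝ} (hC : 0 ≤ C)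
    (h : ∀ k ≤ m, ∀ l ≤ m, SchwartzMap.seminorm ℂ k l f ≤ C) : supSeminorm E m f ≤ C :=
  Seminorm.finset_sup_apply_le hC fun i hi =>
    h i.1 (Finset.mem_Iic.1 hi).1 i.2 (Finset.mem_Iic.1 hi).2

theorem supSeminorm_pos {m : ℕ} {f : 𝓢(E, ℂ)} (hf : f ≠ 0) : 0 < supSeminorm E m f := by
  rcases (apply_nonneg (supSeminorm E m) f).lt_or_eq with h | h
  · exact h
  · exfalso
    apply hf
    ext x
    have h1 := SchwartzMap.norm_le_seminorm ℂ f x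
    have h2 := seminorm_le_supSeminorm (Nat.zero_le m) (Nat.zero_le m) f
    have : ‖f x‖ ≤ 0 := by linarith
    simpa using this

/-- Banach–Steinhaus in seminorm form: on a barrelled space a pointwise finite supremum of
continuous seminorms is itself continuous. -/
theorem exists_continuous_seminorm_bound {ι : Type*} (p : ι → Seminorm ℂ 𝓢(E, ℂ))
    (hp : ∀ i, Continuous (p i)) (hb : ∀ f, BddAbove (Set.range fun i => p i f)) :
    ∃ q : Seminorm ℂ 𝓢(E, ℂ), Continuous q ∧ ∀ i f, p i f ≤ q f := by
  have hb' : BddAbove (Set.range p) := Seminorm.bddAbove_range_iff.2 hb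
  have hc := Seminorm.continuous_iSup p hp hb'
  rw [← Seminorm.coe_iSup_eq hb'] at hc
  refine ⟨⨆ i, p i, hc, fun i f => ?_⟩
  rw [Seminorm.coe_iSup_eq hb', iSup_apply]
  exact le_ciSup (hb f) i

/-- Along null sequences of arguments, separately continuous multilinear maps stay bounded. -/
theorem bddAbove_multilinear_of_tendsto_zero {n : ℕ}
    (M : MultilinearMap ℂ (fun _ : Fin n => 𝓢(E, ℂ)) H)
    (hM : ∀ f i, Continuous fun g => M (Function.update f i g))
    (f : ℕ → Fin n → 𝓢(E, ℂ)) (hf : ∀ i, Tendsto (fun k => f k i) atTop (𝓝 0)) :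
    BddAbove (Set.range fun k => ‖M (f k)‖) := by
  induction n with
  | zero =>
    refine ⟨‖M 0‖, ?_⟩
    rintro _ ⟨k, rfl⟩
    have : f k = 0 := Subsingleton.elim _ _
    simp [this]
  | succ n ih =>
    let p : ℕ → Seminorm ℂ 𝓢(E, ℂ) := fun k =>
      (normSeminorm ℂ H).comp (M.toLinearMap (f k) 0)
    have hp : ∀ k, Continuous (p k) := fun k => continuous_norm.comp (hM (f k) 0)
    have hval : ∀ k g, p k g = ‖M (Fin.cons g (Fin.tail (f k)))‖ := by
      intro k g
      have : Function.update (f k) 0 g = Fin.cons g (Fin.tail (f k)) := by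
        conv_lhs => rw [← Fin.cons_self_tail (f k)]
        rw [Fin.update_cons_zero]
      simp [p, this]
    -- With the first argument frozen at `g`, the induction hypothesis bounds the sequence. Uniform
    -- boundedness then replaces `g` by the moving argument `f k 0`, which tends to zero.
    have hb : ∀ g, BddAbove (Set.range fun k => p k g) := by
      intro g
      simp_rw [hval]
      refine ih (M.curryLeft g) ?_ (fun k => Fin.tail (f k)) (fun i => hf i.succ)
      intro f' i
      have := hM (Fin.cons g f') i.succ
      simpa [MultilinearMap.curryLeft_apply, Fin.cons_update] using this
    obtain ⟨q, hc, hq⟩ := exists_continuous_seminorm_bound p hp hb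
    have ht : Tendsto (fun k => q (f k 0)) atTop (𝓝 (q 0)) :=
      (hc.tendsto 0).comp (hf 0)
    obtain ⟨C, hC⟩ := ht.bddAbove_range
    refine ⟨C, ?_⟩
    rintro _ ⟨k, rfl⟩
    refine le_trans ?_ (hC ⟨k, rfl⟩)
    have h1 := hq k (f k 0)
    rw [hval] at h1
    have h2 : (Fin.cons (f k 0) (Fin.tail (f k)) : Fin (n + 1) → 𝓢(E, ℂ)) = f k :=
      Fin.cons_self_tail (f k)
    rwa [h2] at h1

/-- Separately continuous multilinear maps on the Schwartz space are bounded by a product of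
Schwartz seminorms. -/
theorem exists_multilinear_bound {n : ℕ}
    (M : MultilinearMap ℂ (fun _ : Fin n => 𝓢(E, ℂ)) H)
    (hM : ∀ f i, Continuous fun g => M (Function.update f i g)) :
    ∃ (m : ℕ) (C : ℝ), 0 < C ∧ ∀ f, ‖M f‖ ≤ C * ∏ i, supSeminorm E m (f i) := by
  by_contra! hcon
  have h1 : ∀ m : ℕ, ∃ f : Fin n → 𝓢(E, ℂ),
      ((m : ℝ) + 1) ^ (n + 1) * ∏ i, supSeminorm E m (f i) < ‖M f‖ := fun m =>
    hcon m _ (by positivity)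
  choose f hf using h1
  have hpos : ∀ m i, 0 < supSeminorm E m (f m i) := by
    intro m i
    refine supSeminorm_pos fun h0 => ?_
    have h2 := hf m
    rw [M.map_coord_zero i h0, norm_zero] at h2
    have : 0 ≤ ((m : ℝ) + 1) ^ (n + 1) * ∏ i, supSeminorm E m (f m i) :=
      mul_nonneg (by positivity) (Finset.prod_nonneg fun i _ => apply_nonneg _ _)
    linarith
  -- The rescaling gives every argument seminorm `1 / (m + 1)`. It uses up `n` of the `n + 1`
  -- factors `m + 1` in the failed estimate; the one left makes the values unbounded along a null
  -- sequence.
  let c : ℕ → Fin n → ℝ := fun m i => (((m : ℝ) + 1) * supSeminorm E m (f m i))⁻¹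
  have hcpos : ∀ m i, 0 < c m i := fun m i =>
    inv_pos.2 (mul_pos (by positivity) (hpos m i))
  let g : ℕ → Fin n → 𝓢(E, ℂ) := fun m i => ((c m i : ℝ) : ℂ) • f m i
  have hg : ∀ m i, supSeminorm E m (g m i) = ((m : ℝ) + 1)⁻¹ := by
    intro m i
    simp only [g, map_smul_eq_mul, Complex.norm_real]
    rw [Real.norm_of_nonneg (hcpos m i).le]
    simp only [c, mul_inv]
    rw [mul_assoc, inv_mul_cancel₀ (hpos m i).ne', mul_one]
  have hlim : ∀ i, Tendsto (fun m => g m i) atTop (𝓝 0) := by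
    intro i
    rw [(schwartz_withSeminorms ℂ E ℂ).tendsto_nhds]
    rintro ⟨k, l⟩ ε hε
    have h3 : Tendsto (fun m : ℕ => ((m : ℝ) + 1)⁻¹) atTop (𝓝 0) := by
      simpa [one_div] using tendsto_one_div_add_atTop_nhds_zero_nat (𝕜 := ℝ)
    filter_upwards [eventually_ge_atTop (max k l), h3.eventually (gt_mem_nhds hε)] with m hm hm2
    rw [sub_zero]
    refine lt_of_le_of_lt (seminorm_le_supSeminorm (le_trans (le_max_left k l) hm)
      (le_trans (le_max_right k l) hm) (g m i)) ?_
    rwa [hg]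
  obtain ⟨B, hB⟩ := bddAbove_multilinear_of_tendsto_zero M hM g hlim
  obtain ⟨m, hm⟩ := exists_nat_gt B
  have h4 : ‖M (g m)‖ ≤ B := hB ⟨m, rfl⟩
  have h5 : M (g m) = (∏ i, ((c m i : ℝ) : ℂ)) • M (f m) :=
    M.map_smul_univ (fun i => ((c m i : ℝ) : ℂ)) (f m)
  have h6 : (m : ℝ) + 1 < ‖M (g m)‖ := by
    rw [h5, norm_smul, norm_prod]
    have h7 : ∏ i, ‖((c m i : ℝ) : ℂ)‖ = ∏ i, c m i :=
      Finset.prod_congr rfl fun i _ => by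
        rw [Complex.norm_real, Real.norm_of_nonneg (hcpos m i).le]
    rw [h7]
    have h8 : ∏ i, c m i = (((m : ℝ) + 1) ^ n)⁻¹ * (∏ i, supSeminorm E m (f m i))⁻¹ := by
      simp [c, Finset.prod_mul_distrib, mul_comm]
    have h9 : 0 < ∏ i, supSeminorm E m (f m i) := Finset.prod_pos fun i _ => hpos m i
    have h10 : (m : ℝ) + 1 = (∏ i, c m i) *
        (((m : ℝ) + 1) ^ (n + 1) * ∏ i, supSeminorm E m (f m i)) := by
      rw [h8, pow_succ]
      field_simp
    calc (m : ℝ) + 1 = _ := h10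
      _ < _ := mul_lt_mul_of_pos_left (hf m) (Finset.prod_pos fun i _ => hcpos m i)
  linarith

end Multilinear

/-! ### Products of fields applied to the vacuum -/

namespace WightmanField

variable {d : ℕ} [NeZero d] {H : Type*} [NormedAddCommGroup H] [InnerProductSpace ℂ H]
  (W : WightmanField d H)

/-- `A` has a formal adjoint on the domain of the field. -/
def HasFormalAdjoint (A : Module.End ℂ W.D) : Prop :=
  ∃ B : Module.End ℂ W.D, ∀ v w : W.D, ⟪(A v : H), (w : H)⟫_ℂ = ⟪(v : H), (B w : H)⟫_ℂ

theorem HasFormalAdjoint.mul {W : WightmanField d H} {A B : Module.End ℂ W.D}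
    (hA : W.HasFormalAdjoint A) (hB : W.HasFormalAdjoint B) : W.HasFormalAdjoint (A * B) := by
  obtain ⟨A', hA'⟩ := hA
  obtain ⟨B', hB'⟩ := hB
  exact ⟨B' * A', fun v w => by simp only [Module.End.mul_apply]; rw [hA', hB']⟩

theorem hasFormalAdjoint_one : W.HasFormalAdjoint 1 := ⟨1, fun _ _ => rfl⟩

/-- Split `f` into real and imaginary parts, on which the field is symmetric; the adjoint is the
field at the complex conjugate of `f`. -/
theorem hasFormalAdjoint_Φ (f : 𝓢(Spacetime d, ℂ)) : W.HasFormalAdjoint (W.Φ f) := by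
  let re : 𝓢(Spacetime d, ℂ) :=
    SchwartzMap.postcompCLM (Complex.ofRealCLM.comp Complex.reCLM) f
  let im : 𝓢(Spacetime d, ℂ) :=
    SchwartzMap.postcompCLM (Complex.ofRealCLM.comp Complex.imCLM) f
  have hf : f = re + Complex.I • im := by
    ext x
    have h1 : re x = ((f x).re : ℂ) := rfl
    have h2 : im x = ((f x).im : ℂ) := rfl
    rw [add_apply, smul_apply, h1, h2, smul_eq_mul, mul_comm,
      Complex.re_add_im]
  have hre := W.symmetric_Φ re fun x => by
    have h1 : re x = ((f x).re : ℂ) := rfl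
    rw [h1, Complex.ofReal_im]
  have him := W.symmetric_Φ im fun x => by
    have h1 : im x = ((f x).im : ℂ) := rfl
    rw [h1, Complex.ofReal_im]
  refine ⟨W.Φ re - Complex.I • W.Φ im, fun v w => ?_⟩
  conv_lhs => rw [hf]
  simp only [map_add, map_smul, LinearMap.add_apply, LinearMap.smul_apply, LinearMap.sub_apply,
    Submodule.coe_add, Submodule.coe_smul, Submodule.coe_sub, inner_add_left, inner_smul_left,
    inner_sub_right, inner_smul_right, hre, him, Complex.conj_I]
  ring

/-- Although `A` may be unbounded, `⟪w, A Φ(f) v⟫ = ⟪B w, Φ(f) v⟫` is continuous in `f` for each `w`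
in the domain. The supremum over the unit ball of the domain is finite for each `f`, so uniform
boundedness applies. -/
theorem continuous_apply_Φ {A : Module.End ℂ W.D} (hA : W.HasFormalAdjoint A) (v : W.D) :
    Continuous fun f : 𝓢(Spacetime d, ℂ) => ((A (W.Φ f v) : W.D) : H) := by
  obtain ⟨B, hB⟩ := hA
  let L : 𝓢(Spacetime d, ℂ) →ₗ[ℂ] H :=
    W.D.subtype ∘ₗ A ∘ₗ (LinearMap.applyₗ v) ∘ₗ W.Φ
  have hL : ∀ f, L f = ((A (W.Φ f v) : W.D) : H) := fun f => rfl
  let ι := {w : W.D // ‖(w : H)‖ ≤ 1}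
  let p : ι → Seminorm ℂ 𝓢(Spacetime d, ℂ) := fun w =>
    (normSeminorm ℂ ℂ).comp ((innerₛₗ ℂ ((w.1 : W.D) : H)) ∘ₗ L)
  have hpv : ∀ w f, p w f = ‖⟪((w.1 : W.D) : H), L f⟫_ℂ‖ := fun w f => rfl
  have hp : ∀ w, Continuous (p w) := by
    intro w
    have h1 : ∀ f, p w f = ‖⟪((B w.1 : W.D) : H), ((W.Φ f v : W.D) : H)⟫_ℂ‖ := by
      intro f
      rw [hpv, hL, ← inner_conj_symm, hB, inner_conj_symm]
    have h2 : (p w : 𝓢(Spacetime d, ℂ) → ℝ) =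
      fun f => ‖⟪((B w.1 : W.D) : H), ((W.Φ f v : W.D) : H)⟫_ℂ‖ := funext h1
    rw [h2]
    exact (continuous_const.inner (W.continuous_Φ v)).norm
  have hb : ∀ f, BddAbove (Set.range fun w => p w f) := by
    intro f
    refine ⟨‖L f‖, ?_⟩
    rintro _ ⟨w, rfl⟩
    simp only [hpv]
    calc _ ≤ ‖((w.1 : W.D) : H)‖ * ‖L f‖ := norm_inner_le_norm _ _
      _ ≤ 1 * ‖L f‖ := by gcongr; exact w.2
      _ = ‖L f‖ := one_mul _
  obtain ⟨q, hc, hq⟩ := exists_continuous_seminorm_bound p hp hb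
  have hle : ∀ f, ‖L f‖ ≤ q f := by
    intro f
    rcases eq_or_ne (L f) 0 with h0 | h0
    · rw [h0, norm_zero]; exact apply_nonneg _ _
    · have hn : ‖L f‖ ≠ 0 := norm_ne_zero_iff.2 h0
      -- The vector `L f` lies in the domain because `A` preserves it, so its normalisation is an
      -- admissible test vector at which the supremum is attained.
      let w : ι := ⟨((‖L f‖⁻¹ : ℝ) : ℂ) • (A (W.Φ f v)), by
        rw [Submodule.coe_smul, norm_smul, ← hL, Complex.norm_real, norm_inv, norm_norm,
          inv_mul_cancel₀ hn]⟩
      have h1 := hq w f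
      refine le_trans (le_of_eq ?_) h1
      have h2 : ((w.1 : W.D) : H) = ((‖L f‖⁻¹ : ℝ) : ℂ) • L f := rfl
      rw [hpv, h2, inner_smul_left, norm_mul, inner_self_eq_norm_sq_to_K]
      simp only [map_inv₀, Complex.conj_ofReal, Complex.norm_real, norm_inv, norm_norm, norm_pow,
        RCLike.norm_ofReal, Complex.ofReal_inv, abs_norm]
      field_simp
  have h3 : Continuous L := by
    refine continuous_of_continuousAt_zero L ?_
    rw [ContinuousAt, map_zero]
    refine squeeze_zero_norm hle ?_
    simpa using hc.tendsto 0
  exact h3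

/-- The multilinear map `(f₁, …, fₙ) ↦ Φ(f₁) ⋯ Φ(fₙ) Ω`. -/
def vacuumVector (n : ℕ) : MultilinearMap ℂ (fun _ : Fin n => 𝓢(Spacetime d, ℂ)) H :=
  (W.D.subtype ∘ₗ LinearMap.applyₗ W.Ω).compMultilinearMap
    ((MultilinearMap.mkPiAlgebraFin ℂ n (Module.End ℂ W.D)).compLinearMap fun _ => W.Φ)

theorem vacuumVector_apply (n : ℕ) (f : Fin n → 𝓢(Spacetime d, ℂ)) :
    W.vacuumVector n f = (((List.ofFn fun i => W.Φ (f i)).prod W.Ω : W.D) : H) := rfl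

/-- The general `A` serves the induction: fields to the left of the varying slot are absorbed into
it one at a time. -/
theorem continuous_apply_vacuum_update (n : ℕ) {A : Module.End ℂ W.D}
    (hA : W.HasFormalAdjoint A) (f : Fin n → 𝓢(Spacetime d, ℂ)) (i : Fin n) :
    Continuous fun g => ((A ((List.ofFn fun j => W.Φ (Function.update f i g j)).prod W.Ω) :
      W.D) : H) := by
  induction n generalizing A with
  | zero => exact i.elim0
  | succ n ih =>
    refine Fin.cases ?_ (fun j => ?_) i
    · have := W.continuous_apply_Φ hA ((List.ofFn fun j => W.Φ (f (Fin.succ j))).prod W.Ω)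
      simpa [List.ofFn_succ] using this
    · have := ih (hA.mul (W.hasFormalAdjoint_Φ (f 0))) (Fin.tail f) j
      have h2 : ∀ g, (fun k => W.Φ (Function.update f j.succ g (Fin.succ k))) =
          fun k => W.Φ (Function.update (Fin.tail f) j g k) := by
        intro g
        funext k
        rw [← Fin.tail_update_succ]
        rfl
      simp only [List.ofFn_succ, List.prod_cons, Module.End.mul_apply, h2]
      simpa [Function.update_of_ne (Fin.succ_ne_zero j).symm] using this

theorem continuous_vacuumVector_update (n : ℕ) (f : Fin n → 𝓢(Spacetime d, ℂ)) (i : Fin n) :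
    Continuous fun g => W.vacuumVector n (Function.update f i g) :=
  W.continuous_apply_vacuum_update n W.hasFormalAdjoint_one f i

end WightmanField

/-! ### Gaussian wave packets -/

section Packet

variable {E : Type*} [NormedAddCommGroup E] [InnerProductSpace ℝ E]

/-- The Gaussian wave packet at the point `(a, b)` of phase space. -/
def packetFun (h : ℝ) (a b w : E) : ℂ :=
  Complex.exp (((-(‖w - a‖ ^ 2 / (2 * h)) : ℝ) : ℂ) +
    Complex.I * ((⟪w - a, b⟫_ℝ / h : ℝ) : ℂ))

/-- The logarithmic derivative of a wave packet. -/
def packetSlope (h : ℝ) (a b w : E) : E →L[ℝ] ℂ :=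
  (-h⁻¹) • Complex.ofRealCLM.comp (innerSL ℝ (w - a)) +
    (Complex.I * ((h⁻¹ : ℝ) : ℂ)) • Complex.ofRealCLM.comp (innerSL ℝ b)

theorem contDiff_packetFun_joint (h : ℝ) {n : WithTop ℕ∞} :
    ContDiff ℝ n fun p : E × E × E => packetFun h p.2.1 p.2.2 p.1 := by
  unfold packetFun
  have h1 : ContDiff ℝ n fun p : E × E × E => -(‖p.1 - p.2.1‖ ^ 2 / (2 * h)) :=
    ((ContDiff.norm_sq ℝ (by fun_prop)).div_const _).neg
  have h2 : ContDiff ℝ n fun p : E × E × E => ⟪p.1 - p.2.1, p.2.2⟫_ℝ / h :=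
    (ContDiff.inner ℝ (by fun_prop) (by fun_prop)).div_const _
  exact ((Complex.ofRealCLM.contDiff.comp h1).add
    (contDiff_const.mul (Complex.ofRealCLM.contDiff.comp h2))).cexp

theorem contDiff_packetFun (h : ℝ) (a b : E) {n : WithTop ℕ∞} :
    ContDiff ℝ n (packetFun h a b) := by
  have h1 : ContDiff ℝ n fun w : E => (w, a, b) := contDiff_id.prodMk contDiff_const
  exact (contDiff_packetFun_joint (E := E) (n := n) h).comp h1

theorem hasFDerivAt_packetFun (h : ℝ) (a b w : E) :
    HasFDerivAt (packetFun h a b) (packetFun h a b w • packetSlope h a b w) w := by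
  have h0 : HasFDerivAt (fun w : E => w - a) (ContinuousLinearMap.id ℝ E) w :=
    (hasFDerivAt_id w).sub_const a
  have h1 := ((h0.norm_sq).mul_const (2 * h)⁻¹).neg
  have h2 := ((h0.inner ℝ (hasFDerivAt_const b w)).mul_const h⁻¹)
  have h3 := (Complex.ofRealCLM.hasFDerivAt.comp w h1)
  have h4 := (Complex.ofRealCLM.hasFDerivAt.comp w h2).const_mul Complex.I
  have h5 := (h3.add h4).cexp
  refine (h5.congr_fderiv ?_).congr_of_eventuallyEq (Eventually.of_forall fun y => ?_)
  · ext v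
    simp [packetSlope, packetFun, div_eq_mul_inv, real_inner_comm b v]
    ring
  · simp [packetFun, div_eq_mul_inv]

theorem norm_packetFun (h : ℝ) (a b w : E) :
    ‖packetFun h a b w‖ = Real.exp (-(‖w - a‖ ^ 2 / (2 * h))) := by
  rw [packetFun, Complex.norm_exp]
  simp only [Complex.add_re, Complex.ofReal_re, Complex.mul_re, Complex.I_re, Complex.ofReal_im,
    Complex.I_im, zero_mul, mul_zero, sub_zero, add_zero]

theorem norm_packetSlope_le {h : ℝ} (hh : 0 < h) (a b w : E) :
    ‖packetSlope h a b w‖ ≤ (‖w - a‖ + ‖b‖ + 1) / h := by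
  refine ContinuousLinearMap.opNorm_le_bound _ (by positivity) fun v => ?_
  have h1 : ‖packetSlope h a b w v‖ ≤ h⁻¹ * |⟪w - a, v⟫_ℝ| + h⁻¹ * |⟪b, v⟫_ℝ| := by
    have e : packetSlope h a b w v = ((-h⁻¹ * ⟪w - a, v⟫_ℝ : ℝ) : ℂ) +
        Complex.I * ((h⁻¹ * ⟪b, v⟫_ℝ : ℝ) : ℂ) := by
      simp [packetSlope, inner_sub_left]
      ring
    rw [e]
    refine (norm_add_le _ _).trans (le_of_eq ?_)
    rw [norm_mul, Complex.norm_I, Complex.norm_real, Complex.norm_real, one_mul, Real.norm_eq_abs,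
      Real.norm_eq_abs, abs_mul, abs_mul, abs_neg, abs_of_pos (inv_pos.2 hh)]
  have h2 := abs_real_inner_le_norm (w - a) v
  have h3 := abs_real_inner_le_norm b v
  calc _ ≤ h⁻¹ * (‖w - a‖ * ‖v‖) + h⁻¹ * (‖b‖ * ‖v‖) := h1.trans (by gcongr)
    _ = (‖w - a‖ + ‖b‖) / h * ‖v‖ := by ring
    _ ≤ _ := by
      have : (‖w - a‖ + ‖b‖) / h ≤ (‖w - a‖ + ‖b‖ + 1) / h :=
        div_le_div_of_nonneg_right (by linarith) hh.le
      gcongr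

theorem contDiff_packetSlope (h : ℝ) (a b : E) {n : WithTop ℕ∞} :
    ContDiff ℝ n (packetSlope h a b) := by
  unfold packetSlope
  have h1 : ContDiff ℝ n fun w : E => Complex.ofRealCLM.comp (innerSL ℝ (w - a)) :=
    contDiff_const.clm_comp ((innerSL ℝ).contDiff.comp (contDiff_id.sub contDiff_const))
  exact (h1.const_smul (-h⁻¹)).add contDiff_const

/-- The slope is affine in `w`, so only orders zero and one contribute. The summand `1` lets the
same bound cover the constant first derivative, and makes the bound at least one when `h ≤ 1`. -/
theorem norm_iteratedFDeriv_packetSlope_le {h : ℝ} (hh : 0 < h) (a b w : E) (j : ℕ) :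
    ‖iteratedFDeriv ℝ j (packetSlope h a b) w‖ ≤ (‖w - a‖ + ‖b‖ + 1) / h := by
  let T : E →L[ℝ] (E →L[ℝ] ℂ) :=
    (-h⁻¹) • (ContinuousLinearMap.compL ℝ E ℝ ℂ Complex.ofRealCLM).comp (innerSL ℝ)
  have hT : ∀ y, HasFDerivAt (packetSlope h a b) T y := by
    intro y
    have h1 : HasFDerivAt (fun w : E => T (w - a) +
        (Complex.I * ((h⁻¹ : ℝ) : ℂ)) • Complex.ofRealCLM.comp (innerSL ℝ b)) T y := by
      have := (T.hasFDerivAt.comp y ((hasFDerivAt_id y).sub_const a)).add_const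
        ((Complex.I * ((h⁻¹ : ℝ) : ℂ)) • Complex.ofRealCLM.comp (innerSL ℝ b))
      exact this
    exact h1
  have hTn : ‖T‖ ≤ 1 / h := by
    refine ContinuousLinearMap.opNorm_le_bound _ (by positivity) fun v => ?_
    refine ContinuousLinearMap.opNorm_le_bound _ (by positivity) fun u => ?_
    have h2 := abs_real_inner_le_norm v u
    have h1 : ‖T v u‖ = h⁻¹ * |⟪v, u⟫_ℝ| := by
      simp [T, abs_of_pos hh]
    rw [h1]
    calc _ ≤ h⁻¹ * (‖v‖ * ‖u‖) := by gcongr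
      _ = _ := by ring
  have hfd : fderiv ℝ (packetSlope h a b) = fun _ => T := funext fun y => (hT y).fderiv
  match j with
  | 0 => simpa using norm_packetSlope_le hh a b w
  | 1 =>
    rw [← norm_iteratedFDeriv_fderiv, hfd]
    simp only [norm_iteratedFDeriv_zero]
    refine hTn.trans ?_
    gcongr
    linarith [norm_nonneg (w - a), norm_nonneg b]
  | j + 2 =>
    rw [← norm_iteratedFDeriv_fderiv, hfd, iteratedFDeriv_const_of_ne (by simp)]
    simp only [Pi.zero_apply, norm_zero]
    positivity

/-- Apply Leibniz to the identity that the derivative of a packet is the packet times its slope;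
every order of differentiation costs one factor of the slope bound. -/
theorem exists_norm_iteratedFDeriv_packetFun_le (l : ℕ) :
    ∃ c : ℝ, 0 < c ∧ ∀ h : ℝ, 0 < h → h ≤ 1 → ∀ a b w : E,
      ‖iteratedFDeriv ℝ l (packetFun h a b) w‖ ≤
        c * ((‖w - a‖ + ‖b‖ + 1) / h) ^ l * Real.exp (-(‖w - a‖ ^ 2 / (2 * h))) := by
  induction l using Nat.strong_induction_on with
  | _ l ih =>
  match l with
  | 0 =>
    refine ⟨1, one_pos, fun h _ _ a b w => ?_⟩
    simp [norm_packetFun]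
  | l + 1 =>
    choose! c hc hb using ih
    refine ⟨∑ i ∈ Finset.range (l + 1), (l.choose i : ℝ) * c i, ?_, ?_⟩
    · refine Finset.sum_pos (fun i hi => ?_) ⟨0, by simp⟩
      have := Nat.choose_pos (Nat.lt_succ_iff.1 (Finset.mem_range.1 hi))
      exact mul_pos (by exact_mod_cast this) (hc i (Finset.mem_range.1 hi))
    · intro h h0 h1 a b w
      set A := (‖w - a‖ + ‖b‖ + 1) / h with hA
      set e := Real.exp (-(‖w - a‖ ^ 2 / (2 * h))) with he
      have hA1 : 1 ≤ A := by
        rw [hA, le_div_iff₀ h0]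
        linarith [norm_nonneg (w - a), norm_nonneg b]
      have hfd : fderiv ℝ (packetFun h a b) =
          fun y => packetFun h a b y • packetSlope h a b y :=
        funext fun y => (hasFDerivAt_packetFun h a b y).fderiv
      rw [← norm_iteratedFDeriv_fderiv, hfd]
      refine (norm_iteratedFDeriv_smul_le (N := l) (contDiff_packetFun h a b)
        (contDiff_packetSlope h a b) w le_rfl).trans ?_
      rw [Finset.sum_mul, Finset.sum_mul]
      refine Finset.sum_le_sum fun i hi => ?_
      have hi' := Finset.mem_range.1 hi
      have h2 := hb i hi' h h0 h1 a b w
      have h3 := norm_iteratedFDeriv_packetSlope_le h0 a b w (l - i)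
      have hci := hc i hi'
      calc _ ≤ (l.choose i : ℝ) * (c i * A ^ i * e) * A := by gcongr
        _ = (l.choose i : ℝ) * c i * A ^ (i + 1) * e := by ring
        _ ≤ (l.choose i : ℝ) * c i * A ^ (l + 1) * e := by
          have : A ^ (i + 1) ≤ A ^ (l + 1) := pow_le_pow_right₀ hA1 (by omega)
          gcongr

theorem one_add_pow_mul_exp_le (N : ℕ) {h t : ℝ} (h0 : 0 < h) (h1 : h ≤ 1) (ht : 0 ≤ t) :
    (1 + t) ^ N * Real.exp (-(t ^ 2 / (2 * h))) ≤ N.factorial * Real.exp 2 := by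
  have h2 : (1 + t) ^ N ≤ N.factorial * Real.exp (1 + t) := by
    have := Real.pow_div_factorial_le_exp (1 + t) (by linarith) N
    rwa [div_le_iff₀ (by positivity), mul_comm] at this
  have h3 : -(t ^ 2 / (2 * h)) ≤ 1 - t := by
    have : t ^ 2 / 2 ≤ t ^ 2 / (2 * h) := by
      apply div_le_div_of_nonneg_left (by positivity) (by positivity) (by linarith)
    nlinarith [sq_nonneg (t - 1)]
  calc _ ≤ (N.factorial * Real.exp (1 + t)) * Real.exp (1 - t) := by gcongr
    _ = _ := by
      rw [mul_assoc, ← Real.exp_add]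
      congr 2
      ring

theorem exists_packetFun_decay (l N : ℕ) :
    ∃ C : ℝ, 0 < C ∧ ∀ h : ℝ, 0 < h → h ≤ 1 → ∀ a b w : E,
      (1 + ‖w - a‖) ^ N * ‖iteratedFDeriv ℝ l (packetFun h a b) w‖ ≤
        C * (h ^ l)⁻¹ * (1 + ‖b‖) ^ l := by
  obtain ⟨c, hc, hb⟩ := exists_norm_iteratedFDeriv_packetFun_le (E := E) l
  refine ⟨c * ((N + l).factorial * Real.exp 2), by positivity, fun h h0 h1 a b w => ?_⟩
  have h2 := hb h h0 h1 a b w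
  have h3 := one_add_pow_mul_exp_le (N + l) h0 h1 (norm_nonneg (w - a))
  have h4 : ((‖w - a‖ + ‖b‖ + 1) / h) ^ l ≤ (h ^ l)⁻¹ * (1 + ‖b‖) ^ l * (1 + ‖w - a‖) ^ l := by
    rw [div_pow, div_eq_mul_inv, mul_comm, mul_assoc, ← mul_pow]
    gcongr
    nlinarith [norm_nonneg (w - a), norm_nonneg b,
      mul_nonneg (norm_nonneg (w - a)) (norm_nonneg b)]
  calc _ ≤ (1 + ‖w - a‖) ^ N * (c * ((h ^ l)⁻¹ * (1 + ‖b‖) ^ l * (1 + ‖w - a‖) ^ l) *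
        Real.exp (-(‖w - a‖ ^ 2 / (2 * h)))) := by
        gcongr
        exact h2.trans (by gcongr)
    _ = c * ((1 + ‖w - a‖) ^ (N + l) * Real.exp (-(‖w - a‖ ^ 2 / (2 * h)))) *
        (h ^ l)⁻¹ * (1 + ‖b‖) ^ l := by rw [pow_add]; ring
    _ ≤ _ := by gcongr

theorem one_add_norm_le_mul {V : Type*} [NormedAddCommGroup V] (x w : V) : 1 + ‖w‖ ≤ (1 + ‖w - x‖) * (1 + ‖x‖) := by
  have : ‖w‖ ≤ ‖w - x‖ + ‖x‖ := by simpa using norm_add_le (w - x) x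
  nlinarith [norm_nonneg (w - x), norm_nonneg x, mul_nonneg (norm_nonneg (w - x)) (norm_nonneg x)]

theorem exists_packetFun_seminorm_le (k l : ℕ) :
    ∃ C : ℝ, 0 < C ∧ ∀ h : ℝ, 0 < h → h ≤ 1 → ∀ a b w : E,
      ‖w‖ ^ k * ‖iteratedFDeriv ℝ l (packetFun h a b) w‖ ≤
        C * (h ^ l)⁻¹ * (1 + ‖a‖) ^ k * (1 + ‖b‖) ^ l := by
  obtain ⟨C, hC, hb⟩ := exists_packetFun_decay (E := E) l k
  refine ⟨C, hC, fun h h0 h1 a b w => ?_⟩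
  have h2 := hb h h0 h1 a b w
  have h3 : ‖w‖ ^ k ≤ (1 + ‖a‖) ^ k * (1 + ‖w - a‖) ^ k := by
    rw [← mul_pow]
    gcongr
    linarith [one_add_norm_le_mul a w]
  calc _ ≤ (1 + ‖a‖) ^ k * (1 + ‖w - a‖) ^ k *
        ‖iteratedFDeriv ℝ l (packetFun h a b) w‖ := by gcongr
    _ ≤ (1 + ‖a‖) ^ k * (C * (h ^ l)⁻¹ * (1 + ‖b‖) ^ l) := by
      rw [mul_assoc]
      gcongr
    _ = _ := by ring

/-- The Gaussian wave packet at `(a, b)` as a Schwartz function. -/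
def packet {h : ℝ} (hh : h ∈ Set.Ioc (0 : ℝ) 1) (a b : E) : 𝓢(E, ℂ) where
  toFun := packetFun h a b
  smooth' := contDiff_packetFun h a b
  decay' k l := by
    obtain ⟨C, _, hC⟩ := exists_packetFun_seminorm_le (E := E) k l
    exact ⟨_, hC h hh.1 hh.2 a b⟩

theorem packet_apply {h : ℝ} (hh : h ∈ Set.Ioc (0 : ℝ) 1) (a b w : E) :
    packet hh a b w = packetFun h a b w := rfl

theorem exists_seminorm_packet_le (k l : ℕ) :
    ∃ C : ℝ, 0 < C ∧ ∀ (h : ℝ) (hh : h ∈ Set.Ioc (0 : ℝ) 1) (a b : E),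
      SchwartzMap.seminorm ℂ k l (packet hh a b) ≤
        C * (h ^ l)⁻¹ * (1 + ‖a‖) ^ k * (1 + ‖b‖) ^ l := by
  obtain ⟨C, hC, hb⟩ := exists_packetFun_seminorm_le (E := E) k l
  refine ⟨C, hC, fun h hh a b => ?_⟩
  have := hh.1
  exact SchwartzMap.seminorm_le_bound ℂ k l _ (by positivity) (hb h hh.1 hh.2 a b)

theorem exists_supSeminorm_packet_le (m : ℕ) :
    ∃ C : ℝ, 0 < C ∧ ∀ (h : ℝ) (hh : h ∈ Set.Ioc (0 : ℝ) 1) (a b : E),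
      supSeminorm E m (packet hh a b) ≤
        C * (h ^ m)⁻¹ * (1 + ‖a‖) ^ m * (1 + ‖b‖) ^ m := by
  choose C hC hb using fun k l => exists_seminorm_packet_le (E := E) k l
  refine ⟨∑ k ∈ Finset.range (m + 1), ∑ l ∈ Finset.range (m + 1), C k l,
    Finset.sum_pos (fun k _ => Finset.sum_pos (fun l _ => hC k l) ⟨0, by simp⟩) ⟨0, by simp⟩,
    fun h hh a b => ?_⟩
  have h0 := hh.1
  have hS : 0 ≤ ∑ k ∈ Finset.range (m + 1), ∑ l ∈ Finset.range (m + 1), C k l :=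
    Finset.sum_nonneg fun k _ => Finset.sum_nonneg fun l _ => (hC k l).le
  refine supSeminorm_le (by positivity) fun k hk l hl => ?_
  refine (hb k l h hh a b).trans ?_
  have h1 : C k l ≤ ∑ k ∈ Finset.range (m + 1), ∑ l ∈ Finset.range (m + 1), C k l := by
    refine le_trans ?_ (Finset.single_le_sum
      (f := fun k => ∑ l ∈ Finset.range (m + 1), C k l)
      (fun k _ => Finset.sum_nonneg fun l _ => (hC k l).le)
      (Finset.mem_range.2 (Nat.lt_succ_of_le hk)))
    exact Finset.single_le_sum (f := fun l => C k l) (fun l _ => (hC k l).le)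
      (Finset.mem_range.2 (Nat.lt_succ_of_le hl))
  have h2 : (h ^ l)⁻¹ ≤ (h ^ m)⁻¹ :=
    inv_anti₀ (by positivity) (pow_le_pow_of_le_one h0.le hh.2 hl)
  have h3 : (1 + ‖a‖) ^ k ≤ (1 + ‖a‖) ^ m :=
    pow_le_pow_right₀ (by linarith [norm_nonneg a]) hk
  have h4 : (1 + ‖b‖) ^ l ≤ (1 + ‖b‖) ^ m :=
    pow_le_pow_right₀ (by linarith [norm_nonneg b]) hl
  gcongr

/-- A family of Schwartz functions is continuous if its derivatives are jointly continuous and its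
seminorms locally bounded. -/
theorem continuous_schwartz_of_joint {E : Type*} [NormedAddCommGroup E] [NormedSpace ℝ E]
    [ProperSpace E] {X : Type*} [TopologicalSpace X] (φ : X → 𝓢(E, ℂ))
    (h1 : ∀ l, Continuous fun p : X × E => iteratedFDeriv ℝ l (φ p.1) p.2)
    (h2 : ∀ k l x₀, ∃ C : ℝ, ∀ᶠ x in 𝓝 x₀, SchwartzMap.seminorm ℂ k l (φ x) ≤ C) :
    Continuous φ := by
  rw [continuous_iff_continuousAt]
  intro x₀
  rw [ContinuousAt, (schwartz_withSeminorms ℂ E ℂ).tendsto_nhds]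
  rintro ⟨k, l⟩ ε hε
  obtain ⟨C, hC⟩ := h2 (k + 1) l x₀
  have hC0 : 0 ≤ C := (apply_nonneg _ _).trans hC.self_of_nhds
  -- Outside the ball of radius `R` the spare power of `‖y‖` leaves at most `2C / R < ε / 2`;
  -- inside, compactness handles the difference.
  set R : ℝ := 4 * C / ε + 1 with hR
  have hRpos : 0 < R := by positivity
  have hcomp : ∀ᶠ x in 𝓝 x₀, ∀ y ∈ Metric.closedBall (0 : E) R,
      ‖y‖ ^ k * ‖iteratedFDeriv ℝ l (φ x) y - iteratedFDeriv ℝ l (φ x₀) y‖ < ε / 2 := by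
    refine (isCompact_closedBall (0 : E) R).eventually_forall_of_forall_eventually
      (P := fun x y => ‖y‖ ^ k *
        ‖iteratedFDeriv ℝ l (φ x) y - iteratedFDeriv ℝ l (φ x₀) y‖ < ε / 2) fun y _ => ?_
    have hc : Continuous fun z : X × E => ‖z.2‖ ^ k *
        ‖iteratedFDeriv ℝ l (φ z.1) z.2 - iteratedFDeriv ℝ l (φ x₀) z.2‖ := by
      have h3 : Continuous fun z : X × E => iteratedFDeriv ℝ l (φ x₀) z.2 :=
        (h1 l).comp (continuous_const.prodMk continuous_snd :
          Continuous fun z : X × E => (x₀, z.2))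
      exact (continuous_snd.norm.pow k).mul (((h1 l).sub h3).norm)
    refine hc.continuousAt.eventually_lt_const ?_
    simpa using half_pos hε
  filter_upwards [hC, hcomp] with x hx hxy
  refine lt_of_le_of_lt (SchwartzMap.seminorm_le_bound ℂ k l (φ x - φ x₀)
    (by positivity : 0 ≤ ε / 2) fun y => ?_) (half_lt_self hε)
  have hsub : iteratedFDeriv ℝ l (⇑(φ x - φ x₀)) y =
      iteratedFDeriv ℝ l (φ x) y - iteratedFDeriv ℝ l (φ x₀) y := by
    have : (⇑(φ x - φ x₀) : E → ℂ) = ⇑(φ x) - ⇑(φ x₀) := rfl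
    rw [this, iteratedFDeriv_sub_apply ((φ x).contDiffAt l) ((φ x₀).contDiffAt l)]
  by_cases hy : y ∈ Metric.closedBall (0 : E) R
  · rw [hsub]
    exact (hxy y hy).le
  · have hy' : R < ‖y‖ := by simpa using hy
    have h4 := SchwartzMap.le_seminorm ℂ (k + 1) l (φ x) y
    have h5 := SchwartzMap.le_seminorm ℂ (k + 1) l (φ x₀) y
    have h6 := hC.self_of_nhds
    have h7 : ‖y‖ * (‖y‖ ^ k * ‖iteratedFDeriv ℝ l (φ x) y - iteratedFDeriv ℝ l (φ x₀) y‖) ≤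
        2 * C := by
      calc _ = ‖y‖ ^ (k + 1) *
            ‖iteratedFDeriv ℝ l (φ x) y - iteratedFDeriv ℝ l (φ x₀) y‖ := by ring
        _ ≤ ‖y‖ ^ (k + 1) * (‖iteratedFDeriv ℝ l (φ x) y‖ + ‖iteratedFDeriv ℝ l (φ x₀) y‖) := by
          gcongr
          exact norm_sub_le _ _
        _ ≤ 2 * C := by linarith
    rw [hsub]
    by_contra! hlt
    have h8 : R * (ε / 2) ≤ ‖y‖ *
        (‖y‖ ^ k * ‖iteratedFDeriv ℝ l (φ x) y - iteratedFDeriv ℝ l (φ x₀) y‖) := by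
      gcongr
    have h9 : R * (ε / 2) = 2 * C + ε / 2 := by
      rw [hR]
      field_simp
      ring
    linarith

/-- The derivatives in `w` are restrictions of the full derivatives of a function jointly smooth in
`(w, a, b)`. -/
theorem continuous_iteratedFDeriv_packetFun (h : ℝ) (l : ℕ) :
    Continuous fun p : (E × E) × E => iteratedFDeriv ℝ l (packetFun h p.1.1 p.1.2) p.2 := by
  let ι : E →L[ℝ] E × E × E := ContinuousLinearMap.inl ℝ E (E × E)
  let Q : E × E × E → ℂ := fun p => packetFun h p.2.1 p.2.2 p.1
  have hQ : ContDiff ℝ l Q := contDiff_packetFun_joint h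
  have key : ∀ p : (E × E) × E, iteratedFDeriv ℝ l (packetFun h p.1.1 p.1.2) p.2 =
      ContinuousMultilinearMap.compContinuousLinearMapL (fun _ : Fin l => ι)
        (iteratedFDeriv ℝ l Q (p.2, p.1)) := by
    rintro ⟨⟨a, b⟩, w⟩
    have h1 : packetFun h a b = (fun z => Q (((0 : E), a, b) + z)) ∘ ι := by
      funext y
      simp [Q, ι]
    have h2 : ContDiff ℝ l fun z => Q (((0 : E), a, b) + z) :=
      hQ.comp (contDiff_const.add contDiff_id)
    simp only
    rw [h1, ι.iteratedFDeriv_comp_right h2 w le_rfl, iteratedFDeriv_comp_add_left]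
    simp [ι]
  simp_rw [key]
  exact (ContinuousLinearMap.continuous _).comp
    ((hQ.continuous_iteratedFDeriv le_rfl).comp (continuous_snd.prodMk continuous_fst))

theorem continuous_packet [ProperSpace E] {h : ℝ} (hh : h ∈ Set.Ioc (0 : ℝ) 1) :
    Continuous fun p : E × E => packet hh p.1 p.2 := by
  refine continuous_schwartz_of_joint _ (fun l => continuous_iteratedFDeriv_packetFun h l) ?_
  intro k l x₀
  obtain ⟨C, hC, hb⟩ := exists_seminorm_packet_le (E := E) k l
  have hc : Continuous fun p : E × E => C * (h ^ l)⁻¹ * (1 + ‖p.1‖) ^ k * (1 + ‖p.2‖) ^ l := by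
    fun_prop
  refine ⟨C * (h ^ l)⁻¹ * (1 + ‖x₀.1‖) ^ k * (1 + ‖x₀.2‖) ^ l + 1, ?_⟩
  filter_upwards [hc.continuousAt.eventually_lt_const (lt_add_one _)] with p hp
  exact (hb h hh p.1 p.2).trans hp.le

end Packet

/-! ### Continuous functionals commute with integrals of Schwartz functions -/

section Pettis

variable {E : Type*} [NormedAddCommGroup E] [NormedSpace ℝ E]

theorem one_add_norm_pow_mul_le_supSeminorm {k l m : ℕ} (hk : k ≤ m) (hl : l ≤ m)
    (f : 𝓢(E, ℂ)) (y : E) :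
    (1 + ‖y‖) ^ k * ‖iteratedFDeriv ℝ l f y‖ ≤ 2 ^ m * supSeminorm E m f :=
  SchwartzMap.one_add_le_sup_seminorm_apply (𝕜 := ℂ) (m := (m, m)) hk hl f y

/-- Tuples of multilinear maps of orders at most `m`. -/
def JetFiber (E : Type*) [NormedAddCommGroup E] [NormedSpace ℝ E] (m : ℕ) : Type _ :=
  ∀ l : Fin (m + 1), E [×l]→L[ℝ] ℂ

instance (m : ℕ) : NormedAddCommGroup (JetFiber E m) := Pi.normedAddCommGroup

instance (m : ℕ) : NormedSpace ℂ (JetFiber E m) := Pi.normedSpace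

instance (m : ℕ) : CompleteSpace (JetFiber E m) :=
  inferInstanceAs (CompleteSpace (∀ l : Fin (m + 1), E [×l]→L[ℝ] ℂ))

/-- The components of a tuple of multilinear maps. -/
def JetFiber.proj (m : ℕ) (l : Fin (m + 1)) : JetFiber E m →L[ℂ] (E [×l]→L[ℝ] ℂ) :=
  ContinuousLinearMap.proj (R := ℂ) (φ := fun l : Fin (m + 1) => E [×l]→L[ℝ] ℂ) l

/-- The tuple of the derivatives of order at most `m`, weighted by `(1 + ‖y‖) ^ m`. -/
def weightedJet (m : ℕ) (f : 𝓢(E, ℂ)) (y : E) : JetFiber E m :=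
  fun l => (((1 + ‖y‖) ^ m : ℝ) : ℂ) • iteratedFDeriv ℝ l f y

theorem norm_weightedJet_le (m : ℕ) (f : 𝓢(E, ℂ)) (y : E) :
    ‖weightedJet m f y‖ ≤ 2 ^ m * supSeminorm E m f := by
  refine (pi_norm_le_iff_of_nonneg (mul_nonneg (by positivity) (apply_nonneg _ _))).2 fun l => ?_
  rw [weightedJet, norm_smul, Complex.norm_real, Real.norm_of_nonneg (by positivity)]
  exact one_add_norm_pow_mul_le_supSeminorm le_rfl (Nat.lt_succ_iff.1 l.2) f y

theorem continuous_weightedJet (m : ℕ) (f : 𝓢(E, ℂ)) : Continuous (weightedJet m f) := by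
  refine continuous_pi (A := fun l : Fin (m + 1) => E [×l]→L[ℝ] ℂ) fun l => ?_
  have h1 : Continuous fun y : E => (((1 + ‖y‖) ^ m : ℝ) : ℂ) := by fun_prop
  exact h1.smul ((f.smooth ⊤).continuous_iteratedFDeriv (m := (l : ℕ))
    (by exact_mod_cast le_top))

/-- The weighted jet of a Schwartz function as a bounded continuous function. -/
def jetFun (m : ℕ) (f : 𝓢(E, ℂ)) :
    BoundedContinuousFunction E (JetFiber E m) :=
  BoundedContinuousFunction.ofNormedAddCommGroup (weightedJet m f) (continuous_weightedJet m f) _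
    (norm_weightedJet_le m f)

/-- The weighted jet as a continuous linear map to a Banach space. -/
def jetCLM (m : ℕ) :
    𝓢(E, ℂ) →L[ℂ] BoundedContinuousFunction E (JetFiber E m) :=
  SchwartzMap.mkCLMtoNormedSpace (jetFun m)
    (fun f g => by
      ext1 y
      funext l
      change (((1 + ‖y‖) ^ m : ℝ) : ℂ) • iteratedFDeriv ℝ l (⇑f + ⇑g) y =
        (((1 + ‖y‖) ^ m : ℝ) : ℂ) • iteratedFDeriv ℝ l f y +
          (((1 + ‖y‖) ^ m : ℝ) : ℂ) • iteratedFDeriv ℝ l g y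
      rw [iteratedFDeriv_add_apply (f.contDiffAt _) (g.contDiffAt _), smul_add])
    (fun c f => by
      ext1 y
      funext l
      change (((1 + ‖y‖) ^ m : ℝ) : ℂ) • iteratedFDeriv ℝ l (c • ⇑f) y =
        c • (((1 + ‖y‖) ^ m : ℝ) : ℂ) • iteratedFDeriv ℝ l f y
      rw [iteratedFDeriv_const_smul_apply (f.contDiffAt _), smul_comm])
    ⟨Finset.Iic (m, m), 2 ^ m, by positivity, fun f =>
      (BoundedContinuousFunction.norm_le (mul_nonneg (by positivity) (apply_nonneg _ _))).2
        (norm_weightedJet_le m f)⟩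

theorem jetCLM_apply_apply (m : ℕ) (f : 𝓢(E, ℂ)) (y : E) (l : Fin (m + 1)) :
    jetCLM m f y l = (((1 + ‖y‖) ^ m : ℝ) : ℂ) • iteratedFDeriv ℝ l f y := rfl

theorem norm_jetCLM_le (m : ℕ) (f : 𝓢(E, ℂ)) :
    ‖jetCLM m f‖ ≤ 2 ^ m * supSeminorm E m f :=
  (BoundedContinuousFunction.norm_le (mul_nonneg (by positivity) (apply_nonneg _ _))).2
    (norm_weightedJet_le m f)

theorem supSeminorm_le_norm_jetCLM (m : ℕ) (f : 𝓢(E, ℂ)) :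
    supSeminorm E m f ≤ ‖jetCLM m f‖ := by
  refine supSeminorm_le (norm_nonneg _) fun k hk l hl => ?_
  refine SchwartzMap.seminorm_le_bound ℂ k l f (norm_nonneg _) fun y => ?_
  have h1 := (norm_le_pi_norm (G := fun l : Fin (m + 1) => E [×l]→L[ℝ] ℂ) (jetCLM m f y)
    ⟨l, Nat.lt_succ_of_le hl⟩).trans
    ((jetCLM m f).norm_coe_le_norm y)
  rw [jetCLM_apply_apply, norm_smul, Complex.norm_real, Real.norm_of_nonneg (by positivity)] at h1
  refine le_trans ?_ h1
  have h2 : ‖y‖ ^ k ≤ (1 + ‖y‖) ^ m :=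
    (pow_le_pow_left₀ (norm_nonneg _) (by linarith) k).trans
      (pow_le_pow_right₀ (by linarith [norm_nonneg y]) hk)
  gcongr

theorem jetCLM_injective (m : ℕ) : Function.Injective (jetCLM (E := E) m) := by
  rw [injective_iff_map_eq_zero]
  intro f hf
  by_contra h0
  have h1 := supSeminorm_le_norm_jetCLM m f
  rw [hf, norm_zero] at h1
  linarith [supSeminorm_pos (m := m) h0]

theorem exists_supSeminorm_bound (q : Seminorm ℂ 𝓢(E, ℂ)) (hq : Continuous q) :
    ∃ (m : ℕ) (C : ℝ), 0 ≤ C ∧ ∀ f, q f ≤ C * supSeminorm E m f := by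
  obtain ⟨s, C, -, hC⟩ := Seminorm.bound_of_continuous (schwartz_withSeminorms ℂ E ℂ) q hq
  obtain ⟨m, hm⟩ : ∃ m : ℕ, s ⊆ Finset.Iic (m, m) := by
    refine ⟨s.sup fun i => max i.1 i.2, fun i hi => Finset.mem_Iic.2 ?_⟩
    have : max i.1 i.2 ≤ s.sup fun i => max i.1 i.2 := Finset.le_sup (f := fun i => max i.1 i.2) hi
    exact ⟨(le_max_left _ _).trans this, (le_max_right _ _).trans this⟩
  refine ⟨m, C, C.2, fun f => (hC f).trans ?_⟩
  rw [smul_apply, NNReal.smul_def, smul_eq_mul]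
  exact mul_le_mul_of_nonneg_left (Seminorm.le_def.1 (Finset.sup_mono hm) f) C.2

theorem continuous_supSeminorm (m : ℕ) : Continuous (supSeminorm E m) :=
  Seminorm.continuous_finsetSup fun i _ => (schwartz_withSeminorms ℂ E ℂ).continuous_seminorm i

/-- A continuous functional is bounded by one `supSeminorm`, hence by the supremum norm of a
weighted jet. It therefore descends to the range of the injective jet map, and Hahn–Banach extends
it to the Banach space. -/
theorem exists_extension_of_functional (u : 𝓢(E, ℂ) →L[ℂ] ℂ) :
    ∃ (m : ℕ) (g : BoundedContinuousFunction E (JetFiber E m) →L[ℂ] ℂ),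
      ∀ f, g (jetCLM m f) = u f := by
  obtain ⟨m, C, hC0, hC⟩ := exists_supSeminorm_bound
    ((normSeminorm ℂ ℂ).comp u.toLinearMap) (continuous_norm.comp u.continuous)
  let e := LinearEquiv.ofInjective (jetCLM (E := E) m).toLinearMap (jetCLM_injective m)
  let v : LinearMap.range (jetCLM (E := E) m).toLinearMap →ₗ[ℂ] ℂ := u.toLinearMap ∘ₗ e.symm
  have hv : ∀ x, ‖v x‖ ≤ C * ‖x‖ := by
    intro x
    obtain ⟨f, rfl⟩ := e.surjective x
    have h1 : v (e f) = u f := by simp [v]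
    rw [h1]
    exact (hC f).trans (mul_le_mul_of_nonneg_left (supSeminorm_le_norm_jetCLM m f) hC0)
  obtain ⟨g, hg, -⟩ := exists_extension_norm_eq _ (v.mkContinuous C hv)
  refine ⟨m, g, fun f => ?_⟩
  have h2 := hg (e f)
  have h3 : (v.mkContinuous C hv) (e f) = u f := by simp [v]
  rw [h3] at h2
  exact h2

variable {X : Type*} [TopologicalSpace X] [SecondCountableTopology X] [MeasurableSpace X]
  [OpensMeasurableSpace X] {μ : Measure X}

/-- Differentiation under the integral, one order at a time; the seminorm of the next order
dominates uniformly in `y`. -/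
theorem iteratedFDeriv_integral_schwartz {φ : X → 𝓢(E, ℂ)} (hφ : Continuous φ) {w : X → ℂ}
    (hw : AEStronglyMeasurable w μ)
    (hint : ∀ m, Integrable (fun x => ‖w x‖ * supSeminorm E m (φ x)) μ) {f : 𝓢(E, ℂ)}
    (hf : ∀ y, f y = ∫ x, w x * φ x y ∂μ) (l : ℕ) (y : E) :
    Integrable (fun x => w x • iteratedFDeriv ℝ l (φ x) y) μ ∧
      iteratedFDeriv ℝ l f y = ∫ x, w x • iteratedFDeriv ℝ l (φ x) y ∂μ := by
  have hcont : ∀ (l : ℕ) (y : E), Continuous fun x => iteratedFDeriv ℝ l (φ x) y := by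
    intro l y
    have h1 : Continuous fun x => jetCLM l (φ x) y (Fin.last l) :=
      (((JetFiber.proj l (Fin.last l)).comp
        (BoundedContinuousFunction.evalCLM ℂ y)).comp (jetCLM l)).continuous.comp hφ
    have h2 : ∀ x, iteratedFDeriv ℝ l (φ x) y =
        ((((1 + ‖y‖) ^ l)⁻¹ : ℝ) : ℂ) • jetCLM l (φ x) y (Fin.last l) := by
      intro x
      rw [jetCLM_apply_apply, smul_smul, ← Complex.ofReal_mul, inv_mul_cancel₀ (by positivity),
        Complex.ofReal_one, one_smul]
      rfl
    simp_rw [h2]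
    exact (continuous_const (y := ((((1 + ‖y‖) ^ l)⁻¹ : ℝ) : ℂ))).smul h1
  have hmeas : ∀ (l : ℕ) (y : E),
      AEStronglyMeasurable (fun x => w x • iteratedFDeriv ℝ l (φ x) y) μ := fun l y =>
    hw.smul (hcont l y).aestronglyMeasurable
  have hbound : ∀ (l : ℕ) (y : E) (x : X), ‖w x • iteratedFDeriv ℝ l (φ x) y‖ ≤
      ‖w x‖ * supSeminorm E l (φ x) := by
    intro l y x
    rw [norm_smul]
    gcongr
    exact (SchwartzMap.norm_iteratedFDeriv_le_seminorm ℂ (φ x) l y).trans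
      (seminorm_le_supSeminorm (Nat.zero_le l) le_rfl _)
  have hI : ∀ (l : ℕ) (y : E), Integrable (fun x => w x • iteratedFDeriv ℝ l (φ x) y) μ :=
    fun l y => (hint l).mono' (hmeas l y) (Eventually.of_forall (hbound l y))
  refine ⟨hI l y, ?_⟩
  induction l generalizing y with
  | zero =>
    have h1 : ∀ g : 𝓢(E, ℂ), iteratedFDeriv ℝ 0 g y =
        (continuousMultilinearCurryFin0 ℝ E ℂ).symm (g y) := fun g => rfl
    have h2 : ∀ x, w x • iteratedFDeriv ℝ 0 (φ x) y =
        (continuousMultilinearCurryFin0 ℝ E ℂ).symm (w x * φ x y) := by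
      intro x
      ext m
      simp [h1]
    rw [h1, hf]
    simp_rw [h2]
    exact ((continuousMultilinearCurryFin0 ℝ E ℂ).symm.toContinuousLinearEquiv.integral_comp_comm
      _).symm
  | succ l ih =>
    let c := continuousMultilinearCurryLeftEquiv ℝ (fun _ : Fin (l + 1) => E) ℂ
    have hd : ∀ (g : 𝓢(E, ℂ)) (y : E), HasFDerivAt (iteratedFDeriv ℝ l g)
        (c (iteratedFDeriv ℝ (l + 1) g y)) y := by
      intro g y
      have h := (((g.smooth ⊤).differentiable_iteratedFDeriv (m := l)
        (by exact_mod_cast ENat.natCast_lt_top l)) y).hasFDerivAt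
      have h3 : fderiv ℝ (iteratedFDeriv ℝ l g) y = c (iteratedFDeriv ℝ (l + 1) g y) := by
        ext v m
        simp [c, iteratedFDeriv_succ_apply_left]
      rw [h3] at h
      exact h
    have hcw : ∀ (x : X) (y : E), c (w x • iteratedFDeriv ℝ (l + 1) (φ x) y) =
        w x • c (iteratedFDeriv ℝ (l + 1) (φ x) y) := by
      intro x y
      ext v m
      simp [c]
    have h1 : HasFDerivAt (fun y => ∫ x, w x • iteratedFDeriv ℝ l (φ x) y ∂μ)
        (∫ x, c (w x • iteratedFDeriv ℝ (l + 1) (φ x) y) ∂μ) y := by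
      refine hasFDerivAt_integral_of_dominated_of_fderiv_le (s := Set.univ) (μ := μ)
        (bound := fun x => ‖w x‖ * supSeminorm E (l + 1) (φ x))
        (F' := fun y x => c (w x • iteratedFDeriv ℝ (l + 1) (φ x) y))
        univ_mem (Eventually.of_forall fun y => hmeas l y) (hI l y)
        (c.continuous.comp_aestronglyMeasurable (hmeas (l + 1) y))
        (Eventually.of_forall fun x y _ => ?_) (hint (l + 1))
        (Eventually.of_forall fun x y _ => ?_)
      · rw [c.norm_map]
        exact hbound (l + 1) y x
      · rw [hcw]
        exact (hd (φ x) y).const_smul (w x)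
    have h2 : (fun y => ∫ x, w x • iteratedFDeriv ℝ l (φ x) y ∂μ) = iteratedFDeriv ℝ l f :=
      funext fun y => (ih y).symm
    rw [h2] at h1
    have h3 := (hd f y).unique h1
    have h4 : ∫ x, c (w x • iteratedFDeriv ℝ (l + 1) (φ x) y) ∂μ =
        c (∫ x, w x • iteratedFDeriv ℝ (l + 1) (φ x) y ∂μ) := by
      let cL : (E [×(l + 1)]→L[ℝ] ℂ) →L[ℝ] (E →L[ℝ] (E [×l]→L[ℝ] ℂ)) :=
        c.toContinuousLinearEquiv.toContinuousLinearMap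
      exact ContinuousLinearMap.integral_comp_comm (𝕜 := ℝ) (E := E [×(l + 1)]→L[ℝ] ℂ)
        (Fₗ := E →L[ℝ] (E [×l]→L[ℝ] ℂ)) cL (hI (l + 1) y)
    rw [h4] at h3
    exact c.injective h3

/-- Transport the superposition to the Banach space of jets, where it becomes a Bochner integral
that the extended functional commutes with. The vector identity is checked by evaluating each
component of the jet at each point. -/
theorem functional_integral_schwartz (u : 𝓢(E, ℂ) →L[ℂ] ℂ) {φ : X → 𝓢(E, ℂ)}
    (hφ : Continuous φ) {w : X → ℂ} (hw : AEStronglyMeasurable w μ)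
    (hint : ∀ m, Integrable (fun x => ‖w x‖ * supSeminorm E m (φ x)) μ) {f : 𝓢(E, ℂ)}
    (hf : ∀ y, f y = ∫ x, w x * φ x y ∂μ) : u f = ∫ x, w x * u (φ x) ∂μ := by
  obtain ⟨m, g, hg⟩ := exists_extension_of_functional u
  have hI : Integrable (fun x => w x • jetCLM m (φ x)) μ := by
    refine ((hint m).const_mul (2 ^ m)).mono'
      (hw.smul ((jetCLM m).continuous.comp hφ).aestronglyMeasurable)
      (Eventually.of_forall fun x => ?_)
    rw [norm_smul]
    calc _ ≤ ‖w x‖ * (2 ^ m * supSeminorm E m (φ x)) := by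
          gcongr
          exact norm_jetCLM_le m (φ x)
      _ = _ := by ring
  have key : jetCLM m f = ∫ x, w x • jetCLM m (φ x) ∂μ := by
    ext1 y
    funext l
    let ev : BoundedContinuousFunction E (JetFiber E m) →L[ℂ]
        (E [×l]→L[ℝ] ℂ) :=
      (JetFiber.proj m l).comp (BoundedContinuousFunction.evalCLM ℂ y)
    have h1 : ev (∫ x, w x • jetCLM m (φ x) ∂μ) = ∫ x, ev (w x • jetCLM m (φ x)) ∂μ :=
      (ev.integral_comp_comm hI).symm
    have h2 : ∀ x, ev (w x • jetCLM m (φ x)) =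
        (((1 + ‖y‖) ^ m : ℝ) : ℂ) • (w x • iteratedFDeriv ℝ l (φ x) y) := by
      intro x
      rw [map_smul, smul_comm]
      rfl
    change ev (jetCLM m f) = ev (∫ x, w x • jetCLM m (φ x) ∂μ)
    rw [h1]
    simp_rw [h2]
    rw [integral_smul, ← (iteratedFDeriv_integral_schwartz hφ hw hint hf l y).2]
    rfl
  rw [← hg f, key, ← g.integral_comp_comm hI]
  simp [hg]

/-- The norm of a continuous vector-valued linear map at a superposition of Schwartz functions is at
most the superposition of the norms. -/
theorem enorm_le_lintegral_schwartz {H : Type*} [NormedAddCommGroup H] [InnerProductSpace ℂ H]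
    (u : 𝓢(E, ℂ) →L[ℂ] H) {φ : X → 𝓢(E, ℂ)}
    (hφ : Continuous φ) {w : X → ℂ} (hw : AEStronglyMeasurable w μ)
    (hint : ∀ m, Integrable (fun x => ‖w x‖ * supSeminorm E m (φ x)) μ) {f : 𝓢(E, ℂ)}
    (hf : ∀ y, f y = ∫ x, w x * φ x y ∂μ) : ‖u f‖ₑ ≤ ∫⁻ x, ‖w x‖ₑ * ‖u (φ x)‖ₑ ∂μ := by
  rcases eq_or_ne (u f) 0 with h0 | h0
  · simp [h0]
  · let v : 𝓢(E, ℂ) →L[ℂ] ℂ := (innerSL ℂ (u f)).comp u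
    have h1 := functional_integral_schwartz v hφ hw hint hf
    have h2 : ‖v f‖ₑ = ‖u f‖ₑ * ‖u f‖ₑ := by
      have h3 : v f = ((‖u f‖ * ‖u f‖ : ℝ) : ℂ) := by
        simp [v, inner_self_eq_norm_sq_to_K, sq]
      rw [h3, ← enorm_norm, Complex.norm_real, enorm_norm, enorm_mul, enorm_norm]
    have h4 : ‖v f‖ₑ ≤ ‖u f‖ₑ * ∫⁻ x, ‖w x‖ₑ * ‖u (φ x)‖ₑ ∂μ := by
      rw [h1, ← lintegral_const_mul' _ _ enorm_ne_top]
      refine (enorm_integral_le_lintegral_enorm _).trans (lintegral_mono fun x => ?_)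
      rw [enorm_mul, mul_left_comm]
      gcongr
      rw [← enorm_norm (u f), ← enorm_norm (u (φ x)), ← enorm_mul, enorm_le_iff_norm_le, norm_mul,
        norm_norm, norm_norm]
      exact norm_inner_le_norm _ _
    rw [h2] at h4
    exact (ENNReal.mul_le_mul_iff_right (enorm_ne_zero.2 h0) enorm_ne_top).1 h4

end Pettis

/-! ### Bounds and inversion for the FBI transform -/

section FBI

variable {d : ℕ}

open scoped FourierTransform in
theorem exists_fourier_supSeminorm_le {E : Type*} [NormedAddCommGroup E] [InnerProductSpace ℝ E]
    [FiniteDimensional ℝ E] [MeasurableSpace E] [BorelSpace E] (k : ℕ) :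
    ∃ (m : ℕ) (C : ℝ), 0 ≤ C ∧ ∀ (g : 𝓢(E, ℂ)) (v : E),
      (1 + ‖v‖) ^ k * ‖𝓕 g v‖ ≤ C * supSeminorm E m g := by
  obtain ⟨m, C, hC, hb⟩ := exists_supSeminorm_bound
    ((supSeminorm E k).comp (SchwartzMap.fourierTransformCLM ℂ).toLinearMap)
    ((continuous_supSeminorm k).comp (SchwartzMap.fourierTransformCLM ℂ).continuous)
  refine ⟨m, 2 ^ k * C, by positivity, fun g v => ?_⟩
  have h1 := one_add_norm_pow_mul_le_supSeminorm le_rfl (Nat.zero_le k) (𝓕 g) v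
  rw [norm_iteratedFDeriv_zero] at h1
  have h2 : supSeminorm E k (𝓕 g) ≤ C * supSeminorm E m g := hb g
  calc _ ≤ 2 ^ k * supSeminorm E k (𝓕 g) := h1
    _ ≤ 2 ^ k * (C * supSeminorm E m g) := by gcongr
    _ = _ := by ring

/-- Decay in the window centre `x` follows from `1 + ‖x‖ ≤ (1 + ‖w - x‖)(1 + ‖w‖)`: the Gaussian
absorbs the first factor and `f` the second, which raises the seminorm index by `N`. -/
theorem exists_packet_mul_supSeminorm_le (m N : ℕ) :
    ∃ C : ℝ, 0 < C ∧ ∀ (h : ℝ) (hh : h ∈ Set.Ioc (0 : ℝ) 1) (x : Spacetime d)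
      (f : 𝓢(Spacetime d, ℂ)),
      (1 + ‖x‖) ^ N * supSeminorm (Spacetime d) m
        (SchwartzMap.smulLeftCLM ℂ (packet hh x 0) f) ≤
          C * (h ^ m)⁻¹ * supSeminorm (Spacetime d) (m + N) f := by
  choose c hc hb using fun i => exists_packetFun_decay (E := Spacetime d) i N
  set K := ∑ i ∈ Finset.range (m + 1), c i with hK
  have hK0 : 0 < K := Finset.sum_pos (fun i _ => hc i) ⟨0, by simp⟩
  refine ⟨2 ^ m * K * 2 ^ (m + N), by positivity, fun h hh x f => ?_⟩
  have h0 := hh.1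
  set S := supSeminorm (Spacetime d) (m + N) f with hS
  have hS0 : 0 ≤ S := apply_nonneg _ _
  rw [mul_comm, ← le_div_iff₀ (by positivity)]
  refine supSeminorm_le (by positivity) fun k hk l hl => ?_
  refine SchwartzMap.seminorm_le_bound ℂ k l _ (by positivity) fun w => ?_
  rw [le_div_iff₀ (by positivity), SchwartzMap.smulLeftCLM_apply (packet hh x 0).hasTemperateGrowth]
  have h1 := norm_iteratedFDeriv_smul_le (𝕜 := ℝ) (N := l) (contDiff_packetFun h x 0)
    (f.smooth l) w le_rfl
  have h2 : (1 + ‖x‖) ^ N ≤ (1 + ‖w - x‖) ^ N * (1 + ‖w‖) ^ N := by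
    rw [← mul_pow]
    gcongr
    rw [norm_sub_rev]
    exact one_add_norm_le_mul w x
  have h3 : ∀ i ∈ Finset.range (l + 1), ‖w‖ ^ k * ((l.choose i : ℝ) *
      ‖iteratedFDeriv ℝ i (packetFun h x 0) w‖ * ‖iteratedFDeriv ℝ (l - i) f w‖) *
        (1 + ‖x‖) ^ N ≤ (l.choose i : ℝ) * (K * (h ^ m)⁻¹ * (2 ^ (m + N) * S)) := by
    intro i hi
    have hi' : i ≤ l := Nat.lt_succ_iff.1 (Finset.mem_range.1 hi)
    have h4 := hb i h h0 hh.2 x 0 w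
    rw [norm_zero, add_zero, one_pow, mul_one] at h4
    have h5 : (1 + ‖w‖) ^ (k + N) * ‖iteratedFDeriv ℝ (l - i) f w‖ ≤ 2 ^ (m + N) * S :=
      one_add_norm_pow_mul_le_supSeminorm (by omega) (by omega) f w
    have h6 : ‖w‖ ^ k ≤ (1 + ‖w‖) ^ k := by gcongr; linarith
    have h7 : c i * (h ^ i)⁻¹ ≤ K * (h ^ m)⁻¹ := by
      have h8 : c i ≤ K := Finset.single_le_sum (f := c) (fun j _ => (hc j).le)
        (Finset.mem_range.2 (by omega))
      have h9 : (h ^ i)⁻¹ ≤ (h ^ m)⁻¹ :=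
        inv_anti₀ (by positivity) (pow_le_pow_of_le_one h0.le hh.2 (by omega))
      gcongr
    calc _ ≤ (1 + ‖w‖) ^ k * ((l.choose i : ℝ) *
      ‖iteratedFDeriv ℝ i (packetFun h x 0) w‖ * ‖iteratedFDeriv ℝ (l - i) f w‖) *
        ((1 + ‖w - x‖) ^ N * (1 + ‖w‖) ^ N) := by gcongr
      _ = (l.choose i : ℝ) * (((1 + ‖w - x‖) ^ N * ‖iteratedFDeriv ℝ i (packetFun h x 0) w‖) *
        ((1 + ‖w‖) ^ (k + N) * ‖iteratedFDeriv ℝ (l - i) f w‖)) := by rw [pow_add]; ring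
      _ ≤ _ := by
        refine mul_le_mul_of_nonneg_left (mul_le_mul (h4.trans h7) h5 (by positivity)
          (by positivity)) (by positivity)
  calc _ ≤ ‖w‖ ^ k * (∑ i ∈ Finset.range (l + 1), (l.choose i : ℝ) *
      ‖iteratedFDeriv ℝ i (packetFun h x 0) w‖ * ‖iteratedFDeriv ℝ (l - i) f w‖) *
        (1 + ‖x‖) ^ N := by
        gcongr
        exact h1
    _ ≤ ∑ i ∈ Finset.range (l + 1), (l.choose i : ℝ) * (K * (h ^ m)⁻¹ * (2 ^ (m + N) * S)) := by
        rw [Finset.mul_sum, Finset.sum_mul]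
        exact Finset.sum_le_sum h3
    _ = 2 ^ l * (K * (h ^ m)⁻¹ * (2 ^ (m + N) * S)) := by
        rw [← Finset.sum_mul]
        congr 1
        exact_mod_cast Nat.sum_range_choose l
    _ ≤ 2 ^ m * (K * (h ^ m)⁻¹ * (2 ^ (m + N) * S)) := by
        gcongr
        · norm_num
    _ = _ := by ring

/-- The normalisation constant of the FBI transform. -/
def fbiConst (d : ℕ) (h : ℝ) : ℝ :=
  (2 : ℝ) ^ (-(d : ℝ) / 2) * (Real.pi * h) ^ (-(3 * (d : ℝ)) / 4)

theorem fbiConst_pos {h : ℝ} (h0 : 0 < h) : 0 < fbiConst d h := by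
  unfold fbiConst
  positivity

theorem fbiConst_le {h : ℝ} (hh : h ∈ Set.Ioc (0 : ℝ) 1) : fbiConst d h ≤ (h ^ d)⁻¹ := by
  have h0 := hh.1
  have h1 : (2 : ℝ) ^ (-(d : ℝ) / 2) ≤ 1 :=
    Real.rpow_le_one_of_one_le_of_nonpos (by norm_num)
      (by have : (0 : ℝ) ≤ d := Nat.cast_nonneg d
          linarith)
  have hd : (0 : ℝ) ≤ d := Nat.cast_nonneg d
  have h2 : (Real.pi * h) ^ (-(3 * (d : ℝ)) / 4) ≤ h ^ (-(3 * (d : ℝ)) / 4) := by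
    refine Real.rpow_le_rpow_of_nonpos h0 ?_ (by linarith)
    nlinarith [Real.pi_gt_three]
  have h3 : h ^ (-(3 * (d : ℝ)) / 4) ≤ h ^ (-(d : ℝ)) :=
    Real.rpow_le_rpow_of_exponent_ge h0 hh.2 (by linarith)
  rw [Real.rpow_neg h0.le, Real.rpow_natCast] at h3
  unfold fbiConst
  calc _ ≤ 1 * (h ^ d)⁻¹ := by
        gcongr
        exact h2.trans h3
    _ = _ := one_mul _

open scoped FourierTransform in
-- Up to a phase and a constant, the FBI transform is the Fourier transform of `f` cut off by a
-- Gaussian window at `x`. Both its decay and its inversion are read off from this.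
theorem fbi_eq {h : ℝ} (hh : h ∈ Set.Ioc (0 : ℝ) 1) (f : 𝓢(Spacetime d, ℂ)) (x ξ : Spacetime d) :
    fbi h f (WithLp.toLp 2 (x, ξ)) = (fbiConst d h : ℂ) *
      (Complex.exp (Complex.I * ((⟪x, ξ⟫_ℝ / h : ℝ) : ℂ)) *
        𝓕 (SchwartzMap.smulLeftCLM ℂ (packet hh x 0) f) ((2 * Real.pi * h)⁻¹ • ξ)) := by
  have h0 := hh.1
  have h1 : (WithLp.toLp 2 (x, ξ)).fst = x := rfl
  have h2 : (WithLp.toLp 2 (x, ξ)).snd = ξ := rfl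
  rw [fbi, fbiConst, h1, h2]
  congr 1
  rw [SchwartzMap.fourier_coe, Real.fourier_eq, ← integral_const_mul]
  congr 1
  funext y
  rw [SchwartzMap.smulLeftCLM_apply_apply (packet hh x 0).hasTemperateGrowth, Circle.smul_def,
    Real.fourierChar_apply, packet_apply, packetFun, smul_eq_mul, smul_eq_mul, ← mul_assoc,
    ← mul_assoc, ← Complex.exp_add, ← Complex.exp_add, ← Complex.exp_add, real_inner_smul_right,
    inner_zero_right, norm_sub_rev, inner_sub_left]
  congr 2
  push_cast
  have hpi : (Real.pi : ℂ) ≠ 0 := by exact_mod_cast Real.pi_ne_zero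
  have hc : (h : ℂ) ≠ 0 := by exact_mod_cast h0.ne'
  field_simp
  ring

theorem continuous_fbi {h : ℝ} (h0 : 0 < h) (f : 𝓢(Spacetime d, ℂ)) :
    Continuous fun p : Spacetime d × Spacetime d => fbi h f (WithLp.toLp 2 p) := by
  unfold fbi
  refine continuous_const.mul (continuous_of_dominated (bound := fun y => ‖f y‖) ?_ ?_ ?_ ?_)
  · intro p
    refine Continuous.aestronglyMeasurable ?_
    have := f.continuous
    fun_prop
  · intro p
    refine Eventually.of_forall fun y => ?_
    rw [norm_mul, norm_mul, Complex.norm_exp, Complex.norm_exp]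
    simp only [Complex.ofReal_re, Complex.mul_re, Complex.I_re, Complex.ofReal_im,
      Complex.I_im, zero_mul, mul_zero, sub_zero, Real.exp_zero, mul_one]
    refine mul_le_of_le_one_left (norm_nonneg _) (Real.exp_le_one_iff.2 ?_)
    rw [neg_nonpos]
    positivity
  · exact f.integrable.norm
  · refine Eventually.of_forall fun y => ?_
    change Continuous fun p : Spacetime d × Spacetime d =>
      Complex.exp ((-(‖p.1 - y‖ ^ 2 / (2 * h)) : ℝ) : ℂ) *
        Complex.exp (Complex.I * ((⟪p.1 - y, p.2⟫_ℝ / h : ℝ) : ℂ)) * f y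
    fun_prop

/-- Decay in `ξ` is continuity of the Fourier transform on Schwartz space; decay in `x` is that of
the windowed function. The constant `8` dominates `2πh`. -/
theorem exists_fbi_bound (N : ℕ) :
    ∃ (m M : ℕ) (C : ℝ), 0 < C ∧ ∀ (h : ℝ), h ∈ Set.Ioc (0 : ℝ) 1 →
      ∀ (f : 𝓢(Spacetime d, ℂ)) (x ξ : Spacetime d),
      (1 + ‖x‖) ^ N * (1 + ‖ξ‖) ^ N * ‖fbi h f (WithLp.toLp 2 (x, ξ))‖ ≤
        C * (h ^ M)⁻¹ * supSeminorm (Spacetime d) m f := by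
  obtain ⟨m, C, hC, hb⟩ := exists_fourier_supSeminorm_le (E := Spacetime d) N
  obtain ⟨C', hC', hb'⟩ := exists_packet_mul_supSeminorm_le (d := d) m N
  refine ⟨m + N, d + m, 8 ^ N * (C + 1) * C', by positivity, fun h hh f x ξ => ?_⟩
  have h0 := hh.1
  set g := SchwartzMap.smulLeftCLM ℂ (packet hh x 0) f
  set v := (2 * Real.pi * h)⁻¹ • ξ with hv
  have h1 := hb g v
  have h2 : (1 + ‖x‖) ^ N * supSeminorm (Spacetime d) m g ≤
      C' * (h ^ m)⁻¹ * supSeminorm (Spacetime d) (m + N) f := hb' h hh x f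
  have hpi := Real.pi_pos
  have h3 : (1 + ‖ξ‖) ^ N ≤ 8 ^ N * (1 + ‖v‖) ^ N := by
    rw [← mul_pow]
    gcongr
    have h4 : ‖ξ‖ = 2 * Real.pi * h * ‖v‖ := by
      rw [hv, norm_smul, Real.norm_of_nonneg (by positivity)]
      field_simp
    have h5 : 2 * Real.pi * h ≤ 8 := by nlinarith [Real.pi_lt_four, hh.2]
    nlinarith [norm_nonneg v]
  have h6 : ‖fbi h f (WithLp.toLp 2 (x, ξ))‖ =
      fbiConst d h * ‖FourierTransform.fourier g v‖ := by
    rw [fbi_eq hh, norm_mul, norm_mul, Complex.norm_real,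
      Real.norm_of_nonneg (fbiConst_pos h0).le, mul_comm Complex.I, Complex.norm_exp_ofReal_mul_I,
      one_mul]
  have hf0 : 0 ≤ supSeminorm (Spacetime d) (m + N) f := apply_nonneg _ _
  have hg0 : 0 ≤ supSeminorm (Spacetime d) m g := apply_nonneg _ _
  rw [h6]
  calc _ ≤ (1 + ‖x‖) ^ N * (8 ^ N * (1 + ‖v‖) ^ N) *
        ((h ^ d)⁻¹ * ‖FourierTransform.fourier g v‖) := by
        have := fbiConst_le (d := d) hh
        have := (fbiConst_pos (d := d) h0).le
        gcongr
    _ = 8 ^ N * (h ^ d)⁻¹ * (1 + ‖x‖) ^ N *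
        ((1 + ‖v‖) ^ N * ‖FourierTransform.fourier g v‖) := by ring
    _ ≤ 8 ^ N * (h ^ d)⁻¹ * (1 + ‖x‖) ^ N * ((C + 1) * supSeminorm (Spacetime d) m g) := by
        refine mul_le_mul_of_nonneg_left (h1.trans ?_) (by positivity)
        gcongr
        linarith
    _ = 8 ^ N * (h ^ d)⁻¹ * (C + 1) * ((1 + ‖x‖) ^ N * supSeminorm (Spacetime d) m g) := by ring
    _ ≤ 8 ^ N * (h ^ d)⁻¹ * (C + 1) *
        (C' * (h ^ m)⁻¹ * supSeminorm (Spacetime d) (m + N) f) := by gcongr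
    _ = _ := by
        rw [pow_add]
        field_simp

/-- An integrable weight on phase space. -/
def phaseWeight (d : ℕ) (p : Spacetime d × Spacetime d) : ℝ :=
  ((1 + ‖p.1‖) ^ (d + 1) * (1 + ‖p.2‖) ^ (d + 1))⁻¹

theorem phaseWeight_pos (p : Spacetime d × Spacetime d) : 0 < phaseWeight d p := by
  unfold phaseWeight
  positivity

theorem integrable_phaseWeight : Integrable (phaseWeight d) := by
  have h1 : Integrable fun x : Spacetime d => ((1 + ‖x‖) ^ (d + 1))⁻¹ := by
    have h2 : ((Module.finrank ℝ (Spacetime d) : ℕ) : ℝ) < (d : ℝ) + 1 := by simp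
    refine (integrable_one_add_norm (μ := volume) h2).congr (Eventually.of_forall fun x => ?_)
    simp only
    rw [Real.rpow_neg (by positivity), ← Nat.cast_succ, Real.rpow_natCast]
  refine (h1.mul_prod h1).congr (Eventually.of_forall fun p => ?_)
  simp [phaseWeight, mul_comm]

theorem integrable_fbi_mul_supSeminorm {h : ℝ} (hh : h ∈ Set.Ioc (0 : ℝ) 1)
    (f : 𝓢(Spacetime d, ℂ)) (m : ℕ) :
    Integrable fun p : Spacetime d × Spacetime d =>
      ‖fbi h f (WithLp.toLp 2 p)‖ * supSeminorm (Spacetime d) m (packet hh p.1 p.2) := by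
  obtain ⟨C, hC, hb⟩ := exists_supSeminorm_packet_le (E := Spacetime d) m
  obtain ⟨m', M, C', hC', hb'⟩ := exists_fbi_bound (d := d) (m + (d + 1))
  have h0 := hh.1
  refine (integrable_phaseWeight.const_mul (C * (h ^ m)⁻¹ *
    (C' * (h ^ M)⁻¹ * supSeminorm (Spacetime d) m' f))).mono' ?_
    (Eventually.of_forall fun p => ?_)
  · refine Continuous.aestronglyMeasurable ?_
    exact (continuous_fbi h0 f).norm.mul ((continuous_supSeminorm m).comp (continuous_packet hh))
  · have h1 := hb h hh p.1 p.2
    have h2 := hb' h hh f p.1 p.2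
    rw [Real.norm_of_nonneg (mul_nonneg (norm_nonneg _) (apply_nonneg _ _))]
    have h3 : 0 < (1 + ‖p.1‖) ^ (d + 1) * (1 + ‖p.2‖) ^ (d + 1) := by positivity
    rw [phaseWeight, ← div_eq_mul_inv, le_div_iff₀ h3]
    calc _ ≤ ‖fbi h f (WithLp.toLp 2 p)‖ * (C * (h ^ m)⁻¹ * (1 + ‖p.1‖) ^ m * (1 + ‖p.2‖) ^ m) *
          ((1 + ‖p.1‖) ^ (d + 1) * (1 + ‖p.2‖) ^ (d + 1)) := by gcongr
      _ = C * (h ^ m)⁻¹ * ((1 + ‖p.1‖) ^ (m + (d + 1)) * (1 + ‖p.2‖) ^ (m + (d + 1)) *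
          ‖fbi h f (WithLp.toLp 2 (p.1, p.2))‖) := by rw [pow_add, pow_add]; ring
      _ ≤ _ := by gcongr

/-- The constant of the FBI inversion formula. -/
def fbiInvConst (d : ℕ) (h : ℝ) : ℝ :=
  fbiConst d h * (2 * Real.pi * h) ^ d * (Real.pi * h) ^ ((d : ℝ) / 2)

theorem integrable_fbi_mul_packet {h : ℝ} (hh : h ∈ Set.Ioc (0 : ℝ) 1)
    (f : 𝓢(Spacetime d, ℂ)) (w : Spacetime d) :
    Integrable fun p : Spacetime d × Spacetime d =>
      fbi h f (WithLp.toLp 2 p) * packet hh p.1 p.2 w := by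
  refine (integrable_fbi_mul_supSeminorm hh f 0).mono' ?_ (Eventually.of_forall fun p => ?_)
  · refine ((continuous_fbi hh.1 f).mul ?_).aestronglyMeasurable
    simp only [packet_apply, packetFun]
    fun_prop
  · rw [norm_mul]
    gcongr
    exact (SchwartzMap.norm_le_seminorm ℂ _ w).trans (seminorm_le_supSeminorm le_rfl le_rfl _)

/-- For fixed `x`, Fourier inversion in `ξ` gives `f w` times the square of the window, that is
`exp(-‖x - w‖² / h)`; the Gaussian integral in `x` supplies the remaining factor `(πh)^(d/2)`. -/
theorem fbi_inversion {h : ℝ} (hh : h ∈ Set.Ioc (0 : ℝ) 1)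
    (f : 𝓢(Spacetime d, ℂ)) (w : Spacetime d) :
    ∫ p : Spacetime d × Spacetime d, fbi h f (WithLp.toLp 2 p) * packet hh p.1 p.2 w =
      (fbiInvConst d h : ℂ) * f w := by
  have h0 := hh.1
  have hpi := Real.pi_pos
  rw [Measure.volume_eq_prod, integral_prod _ (integrable_fbi_mul_packet hh f w)]
  have hinner : ∀ x : Spacetime d,
      ∫ ξ, fbi h f (WithLp.toLp 2 (x, ξ)) * packet hh x ξ w =
        ((fbiConst d h * (2 * Real.pi * h) ^ d : ℝ) : ℂ) * f w *
          ((Real.exp (-h⁻¹ * ‖x - w‖ ^ 2) : ℝ) : ℂ) := by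
    intro x
    set g := SchwartzMap.smulLeftCLM ℂ (packet hh x 0) f with hg
    have hgw : g w = packet hh x 0 w * f w := by
      rw [hg, SchwartzMap.smulLeftCLM_apply_apply (packet hh x 0).hasTemperateGrowth, smul_eq_mul]
    let k : Spacetime d → ℂ := fun v =>
      (Real.fourierChar ⟪v, w⟫_ℝ) • FourierTransform.fourier g v
    have h1 : ∀ ξ, fbi h f (WithLp.toLp 2 (x, ξ)) * packet hh x ξ w =
        (fbiConst d h : ℂ) * packet hh x 0 w * k ((2 * Real.pi * h)⁻¹ • ξ) := by
      intro ξ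
      rw [fbi_eq hh, ← hg]
      simp only [k]
      rw [Circle.smul_def, Real.fourierChar_apply, smul_eq_mul, packet_apply, packet_apply,
        packetFun, packetFun, real_inner_smul_left, inner_zero_right]
      have e : Complex.exp (Complex.I * ((⟪x, ξ⟫_ℝ / h : ℝ) : ℂ)) *
          Complex.exp (((-(‖w - x‖ ^ 2 / (2 * h)) : ℝ) : ℂ) +
            Complex.I * ((⟪w - x, ξ⟫_ℝ / h : ℝ) : ℂ)) =
          Complex.exp (((-(‖w - x‖ ^ 2 / (2 * h)) : ℝ) : ℂ) +
            Complex.I * ((0 / h : ℝ) : ℂ)) *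
          Complex.exp (((2 * Real.pi * ((2 * Real.pi * h)⁻¹ * ⟪ξ, w⟫_ℝ) : ℝ) : ℂ) *
            Complex.I) := by
        rw [← Complex.exp_add, ← Complex.exp_add, inner_sub_left, real_inner_comm ξ w]
        congr 1
        push_cast
        have hpi : (Real.pi : ℂ) ≠ 0 := by exact_mod_cast Real.pi_ne_zero
        have hc : (h : ℂ) ≠ 0 := by exact_mod_cast h0.ne'
        field_simp
        ring
      linear_combination (fbiConst d h : ℂ) *
        FourierTransform.fourier g ((2 * Real.pi * h)⁻¹ • ξ) * e
    simp_rw [h1]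
    rw [integral_const_mul, Measure.integral_comp_smul volume k]
    have h2 : ∫ v, k v = g w := by
      have h3 : FourierTransformInv.fourierInv (FourierTransform.fourier g) = g :=
        FourierTransform.fourierInv_fourier_eq g
      have h4 := congrArg (fun φ : 𝓢(Spacetime d, ℂ) => φ w) h3
      rw [SchwartzMap.fourierInv_coe, Real.fourierInv_eq] at h4
      exact h4
    rw [h2, hgw]
    have h5 : |(((2 * Real.pi * h)⁻¹) ^ Module.finrank ℝ (Spacetime d))⁻¹| =
        (2 * Real.pi * h) ^ d := by
      rw [finrank_euclideanSpace_fin, inv_pow, inv_inv, abs_of_pos (by positivity)]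
    have h6 : packet hh x 0 w * packet hh x 0 w =
        ((Real.exp (-h⁻¹ * ‖x - w‖ ^ 2) : ℝ) : ℂ) := by
      rw [packet_apply, packetFun, ← Complex.exp_add, Complex.ofReal_exp, inner_zero_right,
        norm_sub_rev]
      congr 1
      push_cast
      have hc : (h : ℂ) ≠ 0 := by exact_mod_cast h0.ne'
      field_simp
      ring
    rw [h5, Complex.real_smul]
    push_cast at h6 ⊢
    linear_combination (fbiConst d h : ℂ) * (2 * Real.pi * h) ^ d * f w * h6
  simp_rw [hinner]
  rw [integral_const_mul, integral_complex_ofReal,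
    integral_sub_right_eq_self (fun x : Spacetime d => Real.exp (-h⁻¹ * ‖x‖ ^ 2)) w,
    GaussianFourier.integral_rexp_neg_mul_sq_norm (inv_pos.2 h0), finrank_euclideanSpace_fin,
    div_inv_eq_mul, fbiInvConst]
  push_cast
  ring

theorem fbiInvConst_pos {h : ℝ} (h0 : 0 < h) : 0 < fbiInvConst d h := by
  have := fbiConst_pos (d := d) h0
  unfold fbiInvConst
  positivity

/-- The constant equals `2^(d/2) (πh)^(3d/4)`, so inverting it costs only a power of `1/h`. -/
theorem fbiInvConst_inv_le {h : ℝ} (hh : h ∈ Set.Ioc (0 : ℝ) 1) :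
    (fbiInvConst d h)⁻¹ ≤ (h ^ d)⁻¹ := by
  have h0 := hh.1
  have hpi := Real.pi_pos
  have hd : (0 : ℝ) ≤ d := Nat.cast_nonneg d
  have hp : 0 < Real.pi * h := by positivity
  refine inv_anti₀ (by positivity) ?_
  have h1 : fbiInvConst d h = (2 : ℝ) ^ ((d : ℝ) / 2) * (Real.pi * h) ^ (3 * (d : ℝ) / 4) := by
    have e1 : (2 * Real.pi * h) ^ d = (2 : ℝ) ^ (d : ℝ) * (Real.pi * h) ^ (d : ℝ) := by
      rw [Real.rpow_natCast, Real.rpow_natCast, ← mul_pow, mul_assoc]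
    rw [fbiInvConst, fbiConst, e1]
    calc _ = ((2 : ℝ) ^ (-(d : ℝ) / 2) * (2 : ℝ) ^ (d : ℝ)) * ((Real.pi * h) ^ (-(3 * (d : ℝ)) / 4) *
          (Real.pi * h) ^ (d : ℝ) * (Real.pi * h) ^ ((d : ℝ) / 2)) := by ring
      _ = _ := by
        rw [← Real.rpow_add (by norm_num), ← Real.rpow_add hp, ← Real.rpow_add hp]
        congr 2 <;> ring
  rw [h1]
  have h2 : h ^ (d : ℝ) ≤ h ^ (3 * (d : ℝ) / 4) :=
    Real.rpow_le_rpow_of_exponent_ge h0 hh.2 (by linarith)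
  have h3 : h ^ (3 * (d : ℝ) / 4) ≤ (Real.pi * h) ^ (3 * (d : ℝ) / 4) := by
    refine Real.rpow_le_rpow h0.le ?_ (by positivity)
    nlinarith [Real.pi_gt_three]
  have h4 : (1 : ℝ) ≤ (2 : ℝ) ^ ((d : ℝ) / 2) :=
    Real.one_le_rpow (by norm_num) (by positivity)
  rw [Real.rpow_natCast] at h2
  calc _ ≤ 1 * (Real.pi * h) ^ (3 * (d : ℝ) / 4) := by
        rw [one_mul]
        exact h2.trans h3
    _ ≤ _ := by gcongr

/-- A continuous linear map is controlled by its values on wave packets, weighted with the FBI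
transform. -/
theorem enorm_le_lintegral_fbi {H : Type*} [NormedAddCommGroup H] [InnerProductSpace ℂ H]
    (u : 𝓢(Spacetime d, ℂ) →L[ℂ] H) {h : ℝ} (hh : h ∈ Set.Ioc (0 : ℝ) 1)
    (f : 𝓢(Spacetime d, ℂ)) :
    ‖u f‖ₑ ≤ ENNReal.ofReal (fbiInvConst d h)⁻¹ *
      ∫⁻ p : Spacetime d × Spacetime d, ‖fbi h f (WithLp.toLp 2 p)‖ₑ * ‖u (packet hh p.1 p.2)‖ₑ := by
  have hk := fbiInvConst_pos (d := d) hh.1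
  have h1 := enorm_le_lintegral_schwartz u (μ := volume) (continuous_packet hh)
    (w := fun p => fbi h f (WithLp.toLp 2 p)) (continuous_fbi hh.1 f).aestronglyMeasurable
    (fun m => integrable_fbi_mul_supSeminorm hh f m) (f := (fbiInvConst d h : ℂ) • f)
    (fun y => (fbi_inversion hh f y).symm)
  rw [map_smul, enorm_smul] at h1
  have h2 : ‖(fbiInvConst d h : ℂ)‖ₑ = ENNReal.ofReal (fbiInvConst d h) := by
    rw [← ofReal_norm, Complex.norm_real, Real.norm_of_nonneg hk.le]
  rw [h2] at h1
  calc ‖u f‖ₑ = ENNReal.ofReal (fbiInvConst d h)⁻¹ * (ENNReal.ofReal (fbiInvConst d h) *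
        ‖u f‖ₑ) := by
        rw [← mul_assoc, ← ENNReal.ofReal_mul (by positivity), inv_mul_cancel₀ hk.ne',
          ENNReal.ofReal_one, one_mul]
    _ ≤ _ := by gcongr

/-- A separately continuous multilinear map is controlled by its values on wave packets. -/
theorem norm_multilinear_le_of_packets {H : Type*} [NormedAddCommGroup H] [InnerProductSpace ℂ H]
    {n : ℕ} (M : MultilinearMap ℂ (fun _ : Fin n => 𝓢(Spacetime d, ℂ)) H)
    (hM : ∀ f i, Continuous fun g => M (Function.update f i g))
    {h : ℝ} (hh : h ∈ Set.Ioc (0 : ℝ) 1) (f : Fin n → 𝓢(Spacetime d, ℂ)) {A : ℝ} (hA : 0 ≤ A)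
    (hb : ∀ p : Fin n → Spacetime d × Spacetime d,
      (∏ i, ‖fbi h (f i) (WithLp.toLp 2 (p i))‖) * ‖M fun i => packet hh (p i).1 (p i).2‖ ≤
        A * ∏ i, phaseWeight d (p i)) :
    ‖M f‖ ≤ A * ((fbiInvConst d h)⁻¹ * ∫ p, phaseWeight d p) ^ n := by
  have hk := fbiInvConst_pos (d := d) hh.1
  induction n generalizing A with
  | zero =>
    have h1 := hb 0
    have h2 : (fun i => packet hh ((0 : Fin 0 → Spacetime d × Spacetime d) i).1
      ((0 : Fin 0 → Spacetime d × Spacetime d) i).2) = f := Subsingleton.elim _ _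
    rw [h2] at h1
    simpa using h1
  | succ n ih =>
    set B := (fbiInvConst d h)⁻¹ * ∫ p, phaseWeight d p with hB
    have hB0 : 0 ≤ B := mul_nonneg (by positivity)
      (integral_nonneg fun p => (phaseWeight_pos p).le)
    let u : 𝓢(Spacetime d, ℂ) →L[ℂ] H := ⟨M.toLinearMap f 0, hM f 0⟩
    have hu : ∀ g, u g = M (Fin.cons g (Fin.tail f)) := by
      intro g
      have : Function.update f 0 g = Fin.cons g (Fin.tail f) := by
        conv_lhs => rw [← Fin.cons_self_tail f]
        rw [Fin.update_cons_zero]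
      change M (Function.update f 0 g) = _
      rw [this]
    have h1 : ∀ p : Spacetime d × Spacetime d, ‖fbi h (f 0) (WithLp.toLp 2 p)‖ *
        ‖u (packet hh p.1 p.2)‖ ≤ A * B ^ n * phaseWeight d p := by
      intro p
      -- Multiplying the curried map by the FBI value of the first function puts the hypothesis in
      -- the form required for the remaining slots, with `A` replaced by `A * phaseWeight d p`.
      have h2 := ih ((fbi h (f 0) (WithLp.toLp 2 p)) • M.curryLeft (packet hh p.1 p.2)) ?_
        (Fin.tail f) (A := A * phaseWeight d p) (mul_nonneg hA (phaseWeight_pos p).le) ?_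
      · rw [smul_apply, norm_smul, MultilinearMap.curryLeft_apply, ← hu] at h2
        calc _ ≤ _ := h2
          _ = _ := by ring
      · intro f' i
        have := (hM (Fin.cons (packet hh p.1 p.2) f') i.succ).const_smul
          (fbi h (f 0) (WithLp.toLp 2 p))
        simpa [MultilinearMap.curryLeft_apply, Fin.cons_update] using! this
      · intro p'
        have h3 := hb (Fin.cons p p')
        rw [Fin.prod_univ_succ, Fin.prod_univ_succ] at h3
        simp only [Fin.cons_zero, Fin.cons_succ] at h3
        have h4 : (fun i : Fin (n + 1) => packet hh
            ((Fin.cons p p' : Fin (n + 1) → Spacetime d × Spacetime d) i).1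
            ((Fin.cons p p' : Fin (n + 1) → Spacetime d × Spacetime d) i).2) =
            Fin.cons (packet hh p.1 p.2) fun i => packet hh (p' i).1 (p' i).2 := by
          funext i
          refine Fin.cases ?_ (fun j => ?_) i <;> simp
        rw [h4] at h3
        rw [smul_apply, norm_smul, MultilinearMap.curryLeft_apply]
        calc _ = _ := by
              simp only [Fin.tail]
              ring
          _ ≤ _ := h3
          _ = _ := by ring
    have h5 := enorm_le_lintegral_fbi u hh (f 0)
    have h6 : u (f 0) = M f := by rw [hu]; congr 1; exact Fin.cons_self_tail f
    rw [h6] at h5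
    have h7 : ∫⁻ p : Spacetime d × Spacetime d, ‖fbi h (f 0) (WithLp.toLp 2 p)‖ₑ *
        ‖u (packet hh p.1 p.2)‖ₑ ≤ ENNReal.ofReal (A * B ^ n * ∫ p, phaseWeight d p) := by
      rw [← integral_const_mul, ofReal_integral_eq_lintegral_ofReal
        (integrable_phaseWeight.const_mul _) (Eventually.of_forall fun p =>
          mul_nonneg (by positivity) (phaseWeight_pos p).le)]
      refine lintegral_mono fun p => ?_
      rw [← ofReal_norm, ← ofReal_norm, ← ENNReal.ofReal_mul (norm_nonneg _)]
      exact ENNReal.ofReal_le_ofReal (h1 p)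
    have hI : 0 ≤ ∫ p, phaseWeight d p := integral_nonneg fun p => (phaseWeight_pos p).le
    have h8 : ‖M f‖ₑ ≤ ENNReal.ofReal (A * B ^ (n + 1)) := by
      refine h5.trans ?_
      calc _ ≤ ENNReal.ofReal (fbiInvConst d h)⁻¹ *
            ENNReal.ofReal (A * B ^ n * ∫ p, phaseWeight d p) := by gcongr
        _ = _ := by
          rw [← ENNReal.ofReal_mul (by positivity)]
          congr 1
          rw [hB]
          ring
    rw [← ofReal_norm, ENNReal.ofReal_le_ofReal_iff (by positivity)] at h8
    exact h8

end FBI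

/-! ### Holomorphic dependence on complex translations -/

section Holomorphic

/-- A quantitative first-order Taylor estimate for entire functions. -/
theorem norm_sub_sub_deriv_le {f : ℂ → ℂ} (hf : Differentiable ℂ f) {s₀ : ℂ} {C : ℝ}
    (hC : ∀ z ∈ Metric.closedBall s₀ 3, ‖f z‖ ≤ C) {s : ℂ} (hs : ‖s - s₀‖ ≤ 1) :
    ‖f s - f s₀ - (s - s₀) * deriv f s₀‖ ≤ C * ‖s - s₀‖ ^ 2 := by
  have hf' : Differentiable ℂ (deriv f) := hf.deriv
  -- Each Cauchy estimate on unit circles costs one unit of radius: the bound `C` on radius three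
  -- passes to `f'` on radius two and to `f''` on radius one.
  have h1 : ∀ z ∈ Metric.closedBall s₀ 2, ‖deriv f z‖ ≤ C := by
    intro z hz
    have := Complex.norm_deriv_le_of_forall_mem_sphere_norm_le (c := z) one_pos hf.diffContOnCl
      (fun w hw => hC w ?_)
    · simpa using this
    · have h2 := dist_triangle w z s₀
      rw [Metric.mem_sphere] at hw
      rw [Metric.mem_closedBall] at hz ⊢
      linarith
  have h2 : ∀ z ∈ Metric.closedBall s₀ 1, ‖deriv (deriv f) z‖ ≤ C := by
    intro z hz
    have := Complex.norm_deriv_le_of_forall_mem_sphere_norm_le (c := z) one_pos hf'.diffContOnCl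
      (fun w hw => h1 w ?_)
    · simpa using this
    · have h2 := dist_triangle w z s₀
      rw [Metric.mem_sphere] at hw
      rw [Metric.mem_closedBall] at hz ⊢
      linarith
  have h3 : ∀ z ∈ Metric.closedBall s₀ ‖s - s₀‖, ‖deriv f z - deriv f s₀‖ ≤ C * ‖s - s₀‖ := by
    intro z hz
    have h4 : z ∈ Metric.closedBall s₀ 1 := Metric.closedBall_subset_closedBall hs hz
    have h5 := (convex_closedBall s₀ 1).norm_image_sub_le_of_norm_deriv_le
      (fun w _ => hf' w) h2 (Metric.mem_closedBall_self zero_le_one) h4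
    refine h5.trans ?_
    have h6 : 0 ≤ C := (norm_nonneg _).trans (h2 z h4)
    rw [Metric.mem_closedBall, dist_eq_norm] at hz
    gcongr
  let φ : ℂ → ℂ := fun z => f z - z * deriv f s₀
  have hφ : ∀ z, HasDerivAt φ (deriv f z - deriv f s₀) z := by
    intro z
    have := (hf z).hasDerivAt.sub ((hasDerivAt_id z).mul_const (deriv f s₀))
    exact (this.congr_deriv (by simp)).congr_of_eventuallyEq (Eventually.of_forall fun _ => rfl)
  have h7 := (convex_closedBall s₀ ‖s - s₀‖).norm_image_sub_le_of_norm_deriv_le (f := φ)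
    (fun w _ => (hφ w).differentiableAt) (fun z hz => by rw [(hφ z).deriv]; exact h3 z hz)
    (Metric.mem_closedBall_self (norm_nonneg _)) (y := s)
    (by rw [Metric.mem_closedBall, dist_eq_norm])
  calc _ = ‖φ s - φ s₀‖ := by
        congr 1
        simp only [φ]
        ring
    _ ≤ _ := h7
    _ = _ := by ring

/-- A locally bounded, separately entire function is entire on the diagonal. -/
theorem differentiable_diag {k : ℂ → ℂ → ℂ} (h1 : ∀ t, Differentiable ℂ fun s => k s t)
    (h2 : ∀ s, Differentiable ℂ (k s))
    (hb : ∀ R : ℝ, ∃ C : ℝ, ∀ s t, ‖s‖ ≤ R → ‖t‖ ≤ R → ‖k s t‖ ≤ C) :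
    Differentiable ℂ fun s => k s s := by
  intro s₀
  obtain ⟨C, hC⟩ := hb (‖s₀‖ + 3)
  let D : ℂ → ℂ := fun t => deriv (fun s => k s t) s₀
  have hball : ∀ z ∈ Metric.closedBall s₀ 3, ‖z‖ ≤ ‖s₀‖ + 3 := by
    intro z hz
    rw [Metric.mem_closedBall, dist_eq_norm] at hz
    have : ‖z‖ ≤ ‖z - s₀‖ + ‖s₀‖ := by simpa using norm_add_le (z - s₀) s₀
    linarith
  have hC0 : 0 ≤ C := (norm_nonneg _).trans (hC s₀ s₀ (by linarith) (by linarith))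
  have hT : ∀ s t, ‖s - s₀‖ ≤ 1 → ‖t - s₀‖ ≤ 1 →
      ‖k s t - k s₀ t - (s - s₀) * D t‖ ≤ C * ‖s - s₀‖ ^ 2 := by
    intro s t hs ht
    refine norm_sub_sub_deriv_le (h1 t) (fun z hz => hC z t (hball z hz) ?_) hs
    refine hball t ?_
    rw [Metric.mem_closedBall, dist_eq_norm]
    linarith
  -- Near `s₀` the partial derivative `D` is a uniform limit of difference quotients, each
  -- continuous in `t`, with error at most `C δ`.
  have hD : ContinuousAt D s₀ := by
    refine continuousAt_of_locally_uniform_approx_of_continuousAt fun U hU => ?_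
    obtain ⟨ε, hε, hεU⟩ := Metric.mem_uniformity_dist.1 hU
    set δ : ℝ := min 1 (ε / (2 * (C + 1))) with hδ
    have hδ0 : 0 < δ := by positivity
    have hδ1 : δ ≤ 1 := min_le_left _ _
    refine ⟨Metric.closedBall s₀ 1, Metric.closedBall_mem_nhds _ one_pos,
      fun t => (k (s₀ + δ) t - k s₀ t) / δ, ?_, fun t ht => hεU ?_⟩
    · exact ((h2 _).continuous.sub (h2 _).continuous).continuousAt.div_const _
    · rw [Metric.mem_closedBall, dist_eq_norm] at ht
      have hn : ‖((δ : ℝ) : ℂ)‖ = δ := by rw [Complex.norm_real, Real.norm_of_nonneg hδ0.le]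
      have h3 := hT (s₀ + δ) t (by rw [add_sub_cancel_left, hn]; exact hδ1) ht
      rw [add_sub_cancel_left, hn] at h3
      have hc : ((δ : ℝ) : ℂ) ≠ 0 := by exact_mod_cast hδ0.ne'
      have h4 : D t - (k (s₀ + δ) t - k s₀ t) / δ =
          -((k (s₀ + δ) t - k s₀ t - δ * D t) / δ) := by
        field_simp
        ring
      rw [dist_eq_norm, h4, norm_neg, norm_div, hn, div_lt_iff₀ hδ0]
      have h5 : δ * (2 * (C + 1)) ≤ ε := by
        rw [← le_div_iff₀ (by positivity)]
        exact min_le_right _ _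
      nlinarith
  have h3 : HasDerivAt (fun s => k s s) (D s₀ + deriv (k s₀) s₀) s₀ := by
    have hA : HasDerivAt (fun s => k s s - k s₀ s - (s - s₀) * D s) 0 s₀ := by
      rw [hasDerivAt_iff_isLittleO]
      have hO : (fun s => k s s - k s₀ s - (s - s₀) * D s) =O[𝓝 s₀] fun s => ‖s - s₀‖ ^ 2 := by
        refine IsBigO.of_bound C ?_
        filter_upwards [Metric.closedBall_mem_nhds s₀ one_pos] with s hs
        rw [Metric.mem_closedBall, dist_eq_norm] at hs
        rw [Real.norm_of_nonneg (by positivity)]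
        exact hT s s hs hs
      have ho : (fun s => ‖s - s₀‖ ^ 2) =o[𝓝 s₀] fun s => s - s₀ := by
        have := (isLittleO_pow_id (𝕜 := ℂ) one_lt_two).comp_tendsto
          (tendsto_sub_nhds_zero_iff.2 (tendsto_id (x := 𝓝 s₀)))
        refine IsLittleO.congr' (f₁ := fun s => ‖(s - s₀) ^ 2‖) this.norm_left ?_ ?_
        · exact Eventually.of_forall fun s => by simp
        · exact Eventually.of_forall fun s => rfl
      refine (hO.trans_isLittleO ho).congr_left fun s => ?_
      simp
    have hB : HasDerivAt (fun s => (s - s₀) * D s) (D s₀) s₀ := by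
      rw [hasDerivAt_iff_tendsto_slope]
      have h4 : Tendsto D (𝓝[≠] s₀) (𝓝 (D s₀)) := hD.tendsto.mono_left nhdsWithin_le_nhds
      refine h4.congr' ?_
      filter_upwards [self_mem_nhdsWithin] with s hs
      have : s - s₀ ≠ 0 := sub_ne_zero.2 hs
      rw [slope_def_field, sub_self, zero_mul, sub_zero]
      field_simp
    have hE := (hA.add hB).add (h2 s₀ s₀).hasDerivAt
    refine (hE.congr_deriv (by ring)).congr_of_eventuallyEq (Eventually.of_forall fun s => ?_)
    simp only [Pi.add_apply]
    ring
  exact h3.differentiableAt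

variable {E : Type*} [NormedAddCommGroup E] [InnerProductSpace ℝ E]

/-- The complex translate of a Gaussian: the wave packet at `(a, b)`, normalised so that it depends
holomorphically on `a + i b`. -/
def cpacket {h : ℝ} (hh : h ∈ Set.Ioc (0 : ℝ) 1) (a b : E) : 𝓢(E, ℂ) :=
  ((Real.exp (‖b‖ ^ 2 / (2 * h)) : ℝ) : ℂ) • packet hh a b

theorem cpacket_apply {h : ℝ} (hh : h ∈ Set.Ioc (0 : ℝ) 1) (a b w : E) :
    cpacket hh a b w = Complex.exp (((‖b‖ ^ 2 / (2 * h) : ℝ) : ℂ) +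
      (((-(‖w - a‖ ^ 2 / (2 * h)) : ℝ) : ℂ) + Complex.I * ((⟪w - a, b⟫_ℝ / h : ℝ) : ℂ))) := by
  rw [Complex.exp_add, ← Complex.ofReal_exp]
  rfl

/-- The curve of complex translates of a Gaussian in the direction `y`. -/
def cpacketLine {h : ℝ} (hh : h ∈ Set.Ioc (0 : ℝ) 1) (y a b : E) (s : ℂ) : 𝓢(E, ℂ) :=
  cpacket hh (a + s.re • y) (b + s.im • y)

/-- The exponent is `-(w - a - i b)² / 2h` with the complex bilinear square, and the line replaces
`a + i b` by `a + i b + s y`; so it is a quadratic polynomial in `s`. -/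
theorem differentiable_cpacketLine_apply {h : ℝ} (hh : h ∈ Set.Ioc (0 : ℝ) 1) (y a b w : E) :
    Differentiable ℂ fun s => cpacketLine hh y a b s w := by
  have h0 := hh.1
  have key : ∀ s : ℂ, cpacketLine hh y a b s w = Complex.exp (
      (((‖b‖ ^ 2 / (2 * h) - ‖w - a‖ ^ 2 / (2 * h) : ℝ) : ℂ) +
        Complex.I * ((⟪w - a, b⟫_ℝ / h : ℝ) : ℂ)) +
      s * (((⟪w - a, y⟫_ℝ / h : ℝ) : ℂ) - Complex.I * ((⟪b, y⟫_ℝ / h : ℝ) : ℂ)) -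
      s ^ 2 * ((‖y‖ ^ 2 / (2 * h) : ℝ) : ℂ)) := by
    intro s
    rw [cpacketLine, cpacket_apply]
    congr 1
    have e1 : ‖b + s.im • y‖ ^ 2 = ‖b‖ ^ 2 + 2 * (s.im * ⟪b, y⟫_ℝ) + s.im ^ 2 * ‖y‖ ^ 2 := by
      rw [norm_add_sq_real, real_inner_smul_right, norm_smul, mul_pow, Real.norm_eq_abs, sq_abs]
    have e2 : ‖w - (a + s.re • y)‖ ^ 2 = ‖w - a‖ ^ 2 - 2 * (s.re * ⟪w - a, y⟫_ℝ) +
        s.re ^ 2 * ‖y‖ ^ 2 := by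
      rw [← sub_sub, norm_sub_sq_real, real_inner_smul_right, norm_smul, mul_pow,
        Real.norm_eq_abs, sq_abs]
    have e3 : ⟪w - (a + s.re • y), b + s.im • y⟫_ℝ = ⟪w - a, b⟫_ℝ + s.im * ⟪w - a, y⟫_ℝ -
        s.re * ⟪b, y⟫_ℝ - s.re * s.im * ‖y‖ ^ 2 := by
      rw [← sub_sub, inner_sub_left, inner_add_right, inner_add_right, real_inner_smul_right,
        real_inner_smul_right, real_inner_smul_left, real_inner_smul_left,
        real_inner_self_eq_norm_sq, real_inner_comm b y]
      ring
    rw [e1, e2, e3]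
    have hs : s = (s.re : ℂ) + s.im * Complex.I := (Complex.re_add_im s).symm
    conv_rhs => rw [hs]
    have hc : (h : ℂ) ≠ 0 := by exact_mod_cast h0.ne'
    push_cast
    field_simp
    ring_nf
    simp only [Complex.I_sq]
    ring
  simp_rw [key]
  fun_prop

theorem continuous_cpacketLine [ProperSpace E] {h : ℝ} (hh : h ∈ Set.Ioc (0 : ℝ) 1) (y a b : E) :
    Continuous (cpacketLine hh y a b) := by
  have h1 : Continuous fun s : ℂ => ((a + s.re • y, b + s.im • y) : E × E) := by fun_prop
  have h2 : Continuous fun s : ℂ => ((Real.exp (‖b + s.im • y‖ ^ 2 / (2 * h)) : ℝ) : ℂ) := by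
    fun_prop
  have h3 : Continuous fun s : ℂ => packet hh (a + s.re • y) (b + s.im • y) := by
    have := (continuous_packet (E := E) hh).comp h1
    simpa only [Function.comp_def] using this
  have h4 := h2.smul h3
  exact h4

theorem exists_supSeminorm_cpacketLine_le [ProperSpace E] {h : ℝ} (hh : h ∈ Set.Ioc (0 : ℝ) 1)
    (y a b : E) (m : ℕ) (R : ℝ) :
    ∃ C : ℝ, ∀ s, ‖s‖ ≤ R → supSeminorm E m (cpacketLine hh y a b s) ≤ C := by
  have hc : Continuous fun s => supSeminorm E m (cpacketLine hh y a b s) :=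
    (continuous_supSeminorm m).comp (continuous_cpacketLine hh y a b)
  obtain ⟨C, hC⟩ := (isCompact_closedBall (0 : ℂ) R).bddAbove_image hc.continuousOn
  exact ⟨C, fun s hs => hC ⟨s, by simpa using hs, rfl⟩⟩

/-- Cauchy's formula holds pointwise in `w` and presents the curve as a superposition over a circle.
The functional commutes with it, so the scalar function is a Cauchy integral, hence holomorphic. -/
theorem differentiable_functional_cpacketLine [ProperSpace E] {h : ℝ}
    (hh : h ∈ Set.Ioc (0 : ℝ) 1) (y a b : E) (u : 𝓢(E, ℂ) →L[ℂ] ℂ) :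
    Differentiable ℂ fun s => u (cpacketLine hh y a b s) := by
  intro s₀
  set R : NNReal := ‖s₀‖₊ + 1 with hR
  have hR0 : (0 : ℝ) < R := by rw [hR]; positivity
  have hcont := continuous_cpacketLine hh y a b
  have key : ∀ s ∈ Metric.ball (0 : ℂ) R, u (cpacketLine hh y a b s) =
      (2 * Real.pi * Complex.I)⁻¹ • ∮ z in C(0, R), (z - s)⁻¹ • u (cpacketLine hh y a b z) := by
    intro s hs
    let c : ℝ → ℂ := fun θ => (2 * Real.pi * Complex.I)⁻¹ *
      (deriv (circleMap 0 R) θ * (circleMap 0 R θ - s)⁻¹)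
    have hcc : Continuous c := by
      have h1 : ∀ θ, circleMap 0 R θ - s ≠ 0 := by
        intro θ h0
        have h2 : s = circleMap 0 R θ := (sub_eq_zero.1 h0).symm
        rw [h2, Metric.mem_ball, dist_zero_right, norm_circleMap_zero, abs_of_pos hR0] at hs
        exact lt_irrefl _ hs
      have h2 : Continuous fun θ : ℝ => (circleMap 0 R θ - s)⁻¹ :=
        ((continuous_circleMap 0 R).sub continuous_const).inv₀ h1
      have h3 : Continuous fun θ : ℝ => deriv (circleMap 0 R) θ := by
        simp only [deriv_circleMap]
        exact (continuous_circleMap 0 R).mul continuous_const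
      exact continuous_const.mul (h3.mul h2)
    have hφ : Continuous fun θ : ℝ => cpacketLine hh y a b (circleMap 0 R θ) :=
      hcont.comp (continuous_circleMap 0 R)
    have hpi : (0 : ℝ) ≤ 2 * Real.pi := by positivity
    have h4 := functional_integral_schwartz (μ := volume.restrict (Set.Ioc 0 (2 * Real.pi))) u hφ
      (w := c) hcc.aestronglyMeasurable
      (fun m => by
        have h5 : Continuous fun θ : ℝ => ‖c θ‖ *
            supSeminorm E m (cpacketLine hh y a b (circleMap 0 R θ)) :=
          hcc.norm.mul ((continuous_supSeminorm m).comp hφ)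
        exact (h5.intervalIntegrable 0 (2 * Real.pi)).1)
      (f := cpacketLine hh y a b s) (fun w => by
        have h6 := Complex.two_pi_I_inv_smul_circleIntegral_sub_inv_smul_of_differentiable_on_off_countable
          (f := fun z => cpacketLine hh y a b z w) Set.countable_empty hs
          (differentiable_cpacketLine_apply hh y a b w).continuous.continuousOn
          (fun z _ => differentiable_cpacketLine_apply hh y a b w z)
        rw [← h6, circleIntegral, intervalIntegral.integral_of_le hpi, ← integral_smul]
        congr 1
        funext θ
        simp only [c, smul_eq_mul]
        ring)
    rw [h4, circleIntegral, intervalIntegral.integral_of_le hpi, ← integral_smul]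
    congr 1
    funext θ
    simp only [c, smul_eq_mul]
    ring
  have hci : CircleIntegrable (fun z => u (cpacketLine hh y a b z)) 0 R :=
    (u.continuous.comp hcont).continuousOn.circleIntegrable hR0.le
  have hd := (hasFPowerSeriesOn_cauchy_integral hci (by exact_mod_cast hR0)).differentiableOn
  rw [Metric.eball_coe] at hd
  have hs₀ : s₀ ∈ Metric.ball (0 : ℂ) R := by
    rw [Metric.mem_ball, dist_zero_right, hR]
    push_cast
    linarith
  exact ((hd.congr key) s₀ hs₀).differentiableAt (Metric.isOpen_ball.mem_nhds hs₀)

/-- Give the first slot its own complex variable: the function is then separately entire by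
induction, locally bounded by the seminorm estimate, and entire on the diagonal. -/
theorem differentiable_multilinear_cpacketLine [ProperSpace E] {h : ℝ}
    (hh : h ∈ Set.Ioc (0 : ℝ) 1) {n : ℕ} (M : MultilinearMap ℂ (fun _ : Fin n => 𝓢(E, ℂ)) ℂ)
    (hM : ∀ f i, Continuous fun g => M (Function.update f i g)) (y : E) (a b : Fin n → E) :
    Differentiable ℂ fun s => M fun i => cpacketLine hh y (a i) (b i) s := by
  induction n with
  | zero =>
    have : (fun s => M fun i => cpacketLine hh y (a i) (b i) s) = fun _ => M 0 := by
      funext s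
      congr 1
      exact Subsingleton.elim _ _
    rw [this]
    exact differentiable_const _
  | succ n ih =>
    let k : ℂ → ℂ → ℂ := fun s t => M (Fin.cons (cpacketLine hh y (a 0) (b 0) s)
      fun i => cpacketLine hh y (a i.succ) (b i.succ) t)
    have hk : ∀ s, (M fun i => cpacketLine hh y (a i) (b i) s) = k s s := by
      intro s
      simp only [k]
      congr 1
      funext i
      refine Fin.cases ?_ (fun j => ?_) i <;> simp
    simp_rw [hk]
    refine differentiable_diag ?_ ?_ ?_
    · intro t
      let f : Fin (n + 1) → 𝓢(E, ℂ) :=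
        Fin.cons 0 fun i => cpacketLine hh y (a i.succ) (b i.succ) t
      let u : 𝓢(E, ℂ) →L[ℂ] ℂ := ⟨M.toLinearMap f 0, hM f 0⟩
      have h1 := differentiable_functional_cpacketLine hh y (a 0) (b 0) u
      have h2 : ∀ g, u g = M (Fin.cons g fun i => cpacketLine hh y (a i.succ) (b i.succ) t) := by
        intro g
        change M (Function.update f 0 g) = _
        rw [Fin.update_cons_zero]
      simp_rw [h2] at h1
      exact h1
    · intro s
      refine ih (M.curryLeft (cpacketLine hh y (a 0) (b 0) s)) (fun f' i => ?_)
        (fun i => a i.succ) (fun i => b i.succ)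
      have := hM (Fin.cons (cpacketLine hh y (a 0) (b 0) s) f') i.succ
      simpa [MultilinearMap.curryLeft_apply, Fin.cons_update] using this
    · intro R
      obtain ⟨m, C, hC, hb⟩ := exists_multilinear_bound M hM
      choose B hB using fun i => exists_supSeminorm_cpacketLine_le hh y (a i) (b i) m R
      refine ⟨C * ∏ i, B i, fun s t hs ht => (hb _).trans ?_⟩
      refine mul_le_mul_of_nonneg_left (Finset.prod_le_prod (fun i _ => apply_nonneg _ _)
        fun i _ => ?_) hC.le
      refine Fin.cases ?_ (fun j => ?_) i
      · exact hB 0 s hs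
      · exact hB j.succ t ht

end Holomorphic

/-! ### The spectrum condition and complex translations -/

/-- If the characteristic function of a non-positive random variable extends to an entire function
that is bounded on a right strip, then the extension is bounded there by the total mass. -/
theorem norm_le_measureReal_of_charFun {Ω : Type*} [MeasurableSpace Ω] {ν : Measure Ω}
    [IsFiniteMeasure ν] {X : Ω → ℝ} (hX : Measurable X) (hneg : ∀ᵐ ω ∂ν, X ω ≤ 0) {κ : ℂ → ℂ}
    (hκ : Differentiable ℂ κ) {B : ℝ} (hB : ∀ z : ℂ, z.re ∈ Set.Icc (0 : ℝ) 3 → ‖κ z‖ ≤ B)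
    (h0 : ∀ t : ℝ, κ (Complex.I * t) = ∫ ω, Complex.exp (Complex.I * ((t * X ω : ℝ) : ℂ)) ∂ν) :
    ‖κ 2‖ ≤ ν.real Set.univ := by
  let G : ℂ → ℂ := fun z => ∫ ω, Complex.exp (z * X ω) ∂ν
  have hle : ∀ z : ℂ, 0 ≤ z.re → ∀ᵐ ω ∂ν, ‖Complex.exp (z * X ω)‖ ≤ 1 := by
    intro z hz
    filter_upwards [hneg] with ω hω
    rw [Complex.norm_exp, Complex.re_mul_ofReal, Real.exp_le_one_iff]
    exact mul_nonpos_of_nonneg_of_nonpos hz hω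
  have hmeas : ∀ z : ℂ, AEStronglyMeasurable (fun ω => Complex.exp (z * X ω)) ν := fun z => by
    have : Measurable fun ω => Complex.exp (z * X ω) := by fun_prop
    exact this.aestronglyMeasurable
  have hG : ∀ z : ℂ, 0 ≤ z.re → ‖G z‖ ≤ ν.real Set.univ := by
    intro z hz
    simpa using norm_integral_le_of_norm_le_const (hle z hz)
  have hGd : ∀ z : ℂ, 0 < z.re → DifferentiableAt ℂ G z := by
    intro z hz
    refine (ProbabilityTheory.hasDerivAt_complexMGF (X := X) (μ := ν) ?_).differentiableAt
    refine interior_mono (s := Set.Ioi 0) (fun t ht => ?_) (by rwa [interior_Ioi])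
    refine Integrable.of_bound (C := 1) (by fun_prop) ?_
    filter_upwards [hneg] with ω hω
    rw [Real.norm_of_nonneg (Real.exp_pos _).le, Real.exp_le_one_iff]
    exact mul_nonpos_of_nonneg_of_nonpos (le_of_lt ht) hω
  have hGc : ContinuousOn G (Complex.HadamardThreeLines.verticalClosedStrip 0 3) := by
    refine continuousOn_of_dominated (bound := fun _ => 1) (fun z _ => hmeas z)
      (fun z hz => hle z hz.1) (integrable_const _) ?_
    exact Eventually.of_forall fun ω => by fun_prop
  have hI : ∀ z : ℂ, z.re = 0 → κ z = G z := by
    intro z hz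
    have h1 : z = Complex.I * (z.im : ℂ) := by
      apply Complex.ext <;> simp [hz]
    rw [h1, h0]
    simp only [G]
    congr 1
    funext ω
    push_cast
    ring_nf
  -- The difference `κ - G` is bounded on the strip and vanishes on its left edge, so the three
  -- lines bound at `2` contains the factor `0^(1/3) = 0`. The right edge `3` only serves to have
  -- `2` inside.
  have h3 := Complex.HadamardThreeLines.norm_le_interp_of_mem_verticalClosedStrip'
    (f := fun z => κ z - G z) (z := 2) (l := 0) (u := 3) (a := 0) (b := B + ν.real Set.univ)
    (by norm_num) (by simp [Complex.HadamardThreeLines.verticalClosedStrip]; norm_num) ?_ ?_ ?_ ?_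
  · have h4 : (0 : ℝ) ^ (1 - ((2 : ℂ).re - 0) / (3 - 0) : ℝ) = 0 :=
      Real.zero_rpow (by norm_num)
    rw [h4, zero_mul, norm_le_zero_iff, sub_eq_zero] at h3
    rw [h3]
    exact hG 2 (by norm_num)
  · refine ⟨fun z hz => ((hκ z).sub (hGd z hz.1)).differentiableWithinAt, ?_⟩
    refine (hκ.continuous.continuousOn.sub hGc).mono ?_
    refine closure_minimal ?_ (isClosed_Icc.preimage Complex.continuous_re)
    exact Set.preimage_mono Set.Ioo_subset_Icc_self
  · refine ⟨B + ν.real Set.univ, ?_⟩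
    rintro _ ⟨z, hz, rfl⟩
    exact (norm_sub_le _ _).trans (add_le_add (hB z hz) (hG z hz.1))
  · intro z hz
    rw [hI z hz, sub_self, norm_zero]
  · intro z hz
    have hz' : z.re = 3 := hz
    refine (norm_sub_le _ _).trans (add_le_add (hB z ?_) (hG z ?_)) <;> rw [hz'] <;> norm_num

namespace WightmanField

variable {d : ℕ} [NeZero d] {H : Type*} [NormedAddCommGroup H] [InnerProductSpace ℂ H]
  (W : WightmanField d H)

/-- Covariance moves `U` past every field until it meets the invariant vacuum. -/
theorem U_vacuumVector (a : Spacetime d) (Λ : restrictedLorentz d) (n : ℕ)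
    (f : Fin n → 𝓢(Spacetime d, ℂ)) :
    W.U a Λ (W.vacuumVector n f) = W.vacuumVector n fun i => poincareAct a Λ (f i) := by
  simp only [vacuumVector_apply]
  induction n with
  | zero => simpa using W.U_Ω a Λ
  | succ n ih =>
    have h1 := W.covariant a Λ (f 0) ((List.ofFn fun i => W.Φ (f (Fin.succ i))).prod W.Ω)
    simp only [List.ofFn_succ, List.prod_cons, Module.End.mul_apply]
    rw [h1]
    congr 2
    exact Subtype.ext (ih fun i => f i.succ)

theorem poincareAct_cpacket {h : ℝ} (hh : h ∈ Set.Ioc (0 : ℝ) 1) (a x ξ : Spacetime d) :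
    poincareAct a 1 (cpacket hh x ξ) = cpacket hh (x + a) ξ := by
  ext w
  have h1 : poincareAct a 1 (cpacket hh x ξ) w = cpacket hh x ξ (w - a) := by
    simp only [poincareAct, inv_one]
    rfl
  rw [h1, cpacket_apply, cpacket_apply, show w - a - x = w - (x + a) by abel]

/-- The vacuum vectors created by complex translates of Gaussians. -/
def packetCurve {h : ℝ} (hh : h ∈ Set.Ioc (0 : ℝ) 1) {n : ℕ} (y : Spacetime d)
    (x ξ : Fin n → Spacetime d) (s : ℂ) : H :=
  W.vacuumVector n fun i => cpacketLine hh y (x i) (ξ i) s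

/-- The real part of the parameter moves the positions only, which is a unitary translation. Hence
norms depend only on the imaginary part, which gives boundedness on horizontal strips. -/
theorem packetCurve_add_ofReal {h : ℝ} (hh : h ∈ Set.Ioc (0 : ℝ) 1) {n : ℕ} (y : Spacetime d)
    (x ξ : Fin n → Spacetime d) (s : ℂ) (r : ℝ) :
    W.packetCurve hh y x ξ (s + r) = W.U (r • y) 1 (W.packetCurve hh y x ξ s) := by
  rw [packetCurve, packetCurve, U_vacuumVector]
  congr 1
  funext i
  simp only [cpacketLine, poincareAct_cpacket]
  congr 1
  · simp only [Complex.add_re, Complex.ofReal_re, add_smul, add_assoc]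
  · simp

theorem exists_packetCurve_bound {h : ℝ} (hh : h ∈ Set.Ioc (0 : ℝ) 1) {n : ℕ} (y : Spacetime d)
    (x ξ : Fin n → Spacetime d) (R : ℝ) :
    ∃ C : ℝ, ∀ s : ℂ, ‖s‖ ≤ R → ‖W.packetCurve hh y x ξ s‖ ≤ C := by
  obtain ⟨m, C, hC, hb⟩ := exists_multilinear_bound (W.vacuumVector n)
    (W.continuous_vacuumVector_update n)
  choose B hB using fun i => exists_supSeminorm_cpacketLine_le hh y (x i) (ξ i) m R
  refine ⟨C * ∏ i, B i, fun s hs => (hb _).trans ?_⟩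
  exact mul_le_mul_of_nonneg_left (Finset.prod_le_prod (fun i _ => apply_nonneg _ _)
    fun i _ => hB i s hs) hC.le

theorem norm_packetCurve_eq_im {h : ℝ} (hh : h ∈ Set.Ioc (0 : ℝ) 1) {n : ℕ} (y : Spacetime d)
    (x ξ : Fin n → Spacetime d) (s : ℂ) :
    ‖W.packetCurve hh y x ξ s‖ = ‖W.packetCurve hh y x ξ (s.im * Complex.I)‖ := by
  have h1 : s = s.im * Complex.I + s.re := by rw [add_comm, Complex.re_add_im]
  conv_lhs => rw [h1, packetCurve_add_ofReal, LinearIsometryEquiv.norm_map]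

theorem differentiable_inner_packetCurve {h : ℝ} (hh : h ∈ Set.Ioc (0 : ℝ) 1) {n : ℕ}
    (y : Spacetime d) (x ξ : Fin n → Spacetime d) (v : H) :
    Differentiable ℂ fun s => ⟪v, W.packetCurve hh y x ξ s⟫_ℂ := by
  refine differentiable_multilinear_cpacketLine hh
    ((innerSL ℂ v).toLinearMap.compMultilinearMap (W.vacuumVector n)) (fun f i => ?_) y x ξ
  exact (innerSL ℂ v).continuous.comp (W.continuous_vacuumVector_update n f i)

/-- Complex translations in directions that are non-positive on the forward cone increase the norm
of vacuum vectors. -/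
theorem norm_packetCurve_zero_le (hspec : W.SpectrumCondition) {h : ℝ}
    (hh : h ∈ Set.Ioc (0 : ℝ) 1) {n : ℕ} {y : Spacetime d}
    (hy : ∀ p ∈ forwardCone d, ⟪y, p⟫_ℝ ≤ 0) (x ξ : Fin n → Spacetime d) :
    ‖W.packetCurve hh y x ξ 0‖ ≤ ‖W.packetCurve hh y x ξ Complex.I‖ := by
  set Ψ := W.packetCurve hh y x ξ with hΨ
  obtain ⟨ν, hν, hν0, hνU⟩ := hspec (Ψ Complex.I)
  -- Formally `Ψ s = exp(i s y·P) Ψ 0`, so `k z z` is `⟪Ψ i, exp(z y·P) Ψ i⟫`, with value `‖Ψ 0‖²`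
  -- at `z = 2`. The conjugation in the antilinear slot makes `k` holomorphic in both variables.
  let k : ℂ → ℂ → ℂ := fun z w => ⟪Ψ (Complex.I * (1 - (starRingEnd ℂ) z / 2)),
    Ψ (Complex.I * (1 - w / 2))⟫_ℂ
  have hd : ∀ v, Differentiable ℂ fun w : ℂ => ⟪v, Ψ (Complex.I * (1 - w / 2))⟫_ℂ := by
    intro v
    have h1 : Differentiable ℂ fun w : ℂ => Complex.I * (1 - w / 2) := by fun_prop
    exact (W.differentiable_inner_packetCurve hh y x ξ v).comp h1
  have hκ : Differentiable ℂ fun z => k z z := by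
    refine differentiable_diag (fun w => ?_) (fun z => hd _) fun R => ?_
    · intro z
      have h1 := (hd (Ψ (Complex.I * (1 - w / 2))) ((starRingEnd ℂ) z)).conj_conj
      rw [Complex.conj_conj] at h1
      refine h1.congr_of_eventuallyEq (Eventually.of_forall fun z => ?_)
      simp only [k, Function.comp_apply, inner_conj_symm]
    · obtain ⟨C, hC⟩ := W.exists_packetCurve_bound hh y x ξ (1 + R)
      have hn : ∀ z : ℂ, ‖z‖ ≤ R → ‖Ψ (Complex.I * (1 - z / 2))‖ ≤ C := by
        intro z hz
        refine hC _ ?_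
        rw [norm_mul, Complex.norm_I, one_mul]
        refine (norm_sub_le _ _).trans ?_
        rw [norm_one, norm_div, Complex.norm_ofNat]
        linarith [norm_nonneg z]
      refine ⟨C * C, fun z w hz hw => (norm_inner_le_norm _ _).trans ?_⟩
      have h1 := hn _ (show ‖(starRingEnd ℂ) z‖ ≤ R by rwa [RCLike.norm_conj])
      exact mul_le_mul h1 (hn w hw) (norm_nonneg _) ((norm_nonneg _).trans h1)
  obtain ⟨C, hC⟩ := W.exists_packetCurve_bound hh y x ξ 1
  -- The imaginary part of the argument is `1 - Re z / 2`, which stays between `-1/2` and `1` on the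
  -- strip, so the bound on the unit disc suffices.
  have hB : ∀ z : ℂ, z.re ∈ Set.Icc (0 : ℝ) 3 → ‖k z z‖ ≤ C * C := by
    intro z hz
    have h1 : ∀ w : ℂ, w.re ∈ Set.Icc (0 : ℝ) 3 → ‖Ψ (Complex.I * (1 - w / 2))‖ ≤ C := by
      intro w hw
      rw [hΨ, norm_packetCurve_eq_im]
      refine hC _ ?_
      have h2 : (Complex.I * (1 - w / 2)).im = 1 - w.re / 2 := by simp
      rw [h2, norm_mul, Complex.norm_I, mul_one, Complex.norm_real, Real.norm_eq_abs, abs_le]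
      constructor <;> linarith [hw.1, hw.2]
    have h2 := h1 ((starRingEnd ℂ) z) (by simpa using hz)
    exact (norm_inner_le_norm _ _).trans
      (mul_le_mul h2 (h1 z hz) (norm_nonneg _) ((norm_nonneg _).trans h2))
  have h0 : ∀ t : ℝ, k (Complex.I * t) (Complex.I * t) =
      ∫ p, Complex.exp (Complex.I * ((t * ⟪y, p⟫_ℝ : ℝ) : ℂ)) ∂ν := by
    intro t
    have h1 : Complex.I * (1 - (starRingEnd ℂ) (Complex.I * t) / 2) =
        Complex.I + ((-t / 2 : ℝ) : ℂ) := by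
      simp only [map_mul, Complex.conj_I, Complex.conj_ofReal]
      push_cast
      linear_combination ((t : ℂ) / 2) * Complex.I_sq
    have h2 : Complex.I * (1 - Complex.I * t / 2) =
        (Complex.I + ((-t / 2 : ℝ) : ℂ)) + ((t : ℝ) : ℂ) := by
      push_cast
      linear_combination (-(t : ℂ) / 2) * Complex.I_sq
    have h3 := hνU (t • y)
    simp only [real_inner_smul_left] at h3
    rw [← h3]
    simp only [k]
    have h4 : Ψ (Complex.I + ((-t / 2 : ℝ) : ℂ) + (t : ℂ)) =
        W.U ((-t / 2) • y) 1 (W.U (t • y) 1 (Ψ Complex.I)) := by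
      rw [hΨ, add_right_comm, packetCurve_add_ofReal, packetCurve_add_ofReal]
    rw [h1, h2, h4, hΨ, packetCurve_add_ofReal, LinearIsometryEquiv.inner_map_map]
  have hX : Measurable fun p : Spacetime d => ⟪y, p⟫_ℝ := by fun_prop
  have hneg : ∀ᵐ p ∂ν, ⟪y, p⟫_ℝ ≤ 0 := by
    have : ∀ᵐ p ∂ν, p ∈ forwardCone d := hν0
    filter_upwards [this] with p hp using hy p hp
  have h5 := norm_le_measureReal_of_charFun hX hneg hκ hB h0
  have h6 : k 2 2 = ⟪Ψ 0, Ψ 0⟫_ℂ := by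
    have h2 : (starRingEnd ℂ) 2 = 2 := Complex.conj_ofReal 2
    simp only [k, h2]
    norm_num
  have h7 : (ν.real Set.univ : ℂ) = ⟪Ψ Complex.I, Ψ Complex.I⟫_ℂ := by
    have := h0 0
    simpa [k] using this.symm
  have h8 : ν.real Set.univ = ‖Ψ Complex.I‖ ^ 2 := by
    rw [inner_self_eq_norm_sq_to_K] at h7
    exact Complex.ofReal_injective (by simpa using h7)
  rw [h6, h8, inner_self_eq_norm_sq_to_K] at h5
  have h9 : ‖Ψ 0‖ ^ 2 ≤ ‖Ψ Complex.I‖ ^ 2 := by simpa using h5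
  exact (sq_le_sq₀ (norm_nonneg _) (norm_nonneg _)).1 h9

end WightmanField

/-! ### Momentum shifts and bounds for vacuum vectors of wave packets. -/

namespace WightmanField

variable {d : ℕ} [NeZero d] {H : Type*} [NormedAddCommGroup H] [InnerProductSpace ℂ H]
  (W : WightmanField d H)

/-- Shifting the momenta of wave packets in a direction that is non-positive on the forward cone. -/
theorem norm_vacuumVector_packet_le_shift (hspec : W.SpectrumCondition) {h : ℝ}
    (hh : h ∈ Set.Ioc (0 : ℝ) 1) {n : ℕ} {y : Spacetime d}
    (hy : ∀ p ∈ forwardCone d, ⟪y, p⟫_ℝ ≤ 0) (x ξ : Fin n → Spacetime d) :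
    ‖W.vacuumVector n fun i => packet hh (x i) (ξ i)‖ ≤
      Real.exp ((⟪y, ∑ i, ξ i⟫_ℝ + n * ‖y‖ ^ 2 / 2) / h) *
        ‖W.vacuumVector n fun i => packet hh (x i) (ξ i + y)‖ := by
  have h0 := hh.1
  have h1 : ∀ b : Fin n → Spacetime d, ‖W.vacuumVector n fun i => cpacket hh (x i) (b i)‖ =
      Real.exp (∑ i, ‖b i‖ ^ 2 / (2 * h)) * ‖W.vacuumVector n fun i => packet hh (x i) (b i)‖ := by
    intro b
    unfold cpacket
    rw [MultilinearMap.map_smul_univ, norm_smul, norm_prod, Real.exp_sum]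
    congr 1
    refine Finset.prod_congr rfl fun i _ => ?_
    rw [Complex.norm_real, Real.norm_of_nonneg (Real.exp_pos _).le]
  have h2 := W.norm_packetCurve_zero_le hspec hh hy x ξ
  have e0 : W.packetCurve hh y x ξ 0 = W.vacuumVector n fun i => cpacket hh (x i) (ξ i) := by
    simp [packetCurve, cpacketLine]
  have e1 : W.packetCurve hh y x ξ Complex.I =
      W.vacuumVector n fun i => cpacket hh (x i) (ξ i + y) := by
    simp [packetCurve, cpacketLine]
  rw [e0, e1, h1, h1] at h2
  -- The exponential gain is the ratio of the holomorphic normalisations at `ξᵢ` and `ξᵢ + y`.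
  have h3 : ∑ i, ‖ξ i + y‖ ^ 2 / (2 * h) =
      ∑ i, ‖ξ i‖ ^ 2 / (2 * h) + (⟪y, ∑ i, ξ i⟫_ℝ + n * ‖y‖ ^ 2 / 2) / h := by
    have : ∀ i, ‖ξ i + y‖ ^ 2 / (2 * h) = ‖ξ i‖ ^ 2 / (2 * h) + (⟪y, ξ i⟫_ℝ / h +
        ‖y‖ ^ 2 / (2 * h)) := by
      intro i
      rw [norm_add_sq_real, real_inner_comm]
      field_simp
      ring
    simp_rw [this]
    rw [Finset.sum_add_distrib, Finset.sum_add_distrib, inner_sum, ← Finset.sum_div, ← Finset.sum_div]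
    simp only [Finset.sum_const, Finset.card_univ, Fintype.card_fin, nsmul_eq_mul]
    field_simp
  rw [h3, Real.exp_add, mul_assoc] at h2
  exact le_of_mul_le_mul_left h2 (Real.exp_pos _)

/-- After the shift only the seminorm bound is used; `‖y‖ ≤ 1` keeps it polynomial in the original
momenta, with constants independent of `y`. -/
theorem exists_norm_vacuumVector_packet_le (hspec : W.SpectrumCondition) (n : ℕ) :
    ∃ (m M : ℕ) (C : ℝ), 0 < C ∧ ∀ (h : ℝ) (hh : h ∈ Set.Ioc (0 : ℝ) 1) (y : Spacetime d),
      ‖y‖ ≤ 1 → (∀ p ∈ forwardCone d, ⟪y, p⟫_ℝ ≤ 0) → ∀ x ξ : Fin n → Spacetime d,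
      ‖W.vacuumVector n fun i => packet hh (x i) (ξ i)‖ ≤
        C * (h ^ M)⁻¹ * (∏ i, (1 + ‖x i‖) ^ m * (1 + ‖ξ i‖) ^ m) *
          Real.exp ((⟪y, ∑ i, ξ i⟫_ℝ + n * ‖y‖ ^ 2 / 2) / h) := by
  obtain ⟨m, C, hC, hb⟩ := exists_multilinear_bound (W.vacuumVector n)
    (W.continuous_vacuumVector_update n)
  obtain ⟨C', hC', hb'⟩ := exists_supSeminorm_packet_le (E := Spacetime d) m
  refine ⟨m, m * n, C * (C' * 2 ^ m) ^ n, by positivity, fun h hh y hy1 hy x ξ => ?_⟩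
  have h0 := hh.1
  refine (W.norm_vacuumVector_packet_le_shift hspec hh hy x ξ).trans ?_
  rw [mul_comm]
  refine mul_le_mul_of_nonneg_right ((hb _).trans ?_) (Real.exp_pos _).le
  have h1 : ∀ i, supSeminorm (Spacetime d) m (packet hh (x i) (ξ i + y)) ≤
      (C' * 2 ^ m * (h ^ m)⁻¹) * ((1 + ‖x i‖) ^ m * (1 + ‖ξ i‖) ^ m) := by
    intro i
    refine (hb' h hh _ _).trans ?_
    have h2 : 1 + ‖ξ i + y‖ ≤ 2 * (1 + ‖ξ i‖) := by
      linarith [norm_add_le (ξ i) y, norm_nonneg (ξ i)]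
    calc _ ≤ C' * (h ^ m)⁻¹ * (1 + ‖x i‖) ^ m * (2 * (1 + ‖ξ i‖)) ^ m := by gcongr
      _ = _ := by rw [mul_pow]; ring
  calc _ ≤ C * ∏ i, (C' * 2 ^ m * (h ^ m)⁻¹) * ((1 + ‖x i‖) ^ m * (1 + ‖ξ i‖) ^ m) :=
        mul_le_mul_of_nonneg_left (Finset.prod_le_prod (fun i _ => apply_nonneg _ _)
          fun i _ => h1 i) hC.le
    _ = _ := by
      rw [Finset.prod_mul_distrib, Finset.prod_const, Finset.card_univ, Fintype.card_fin,
        mul_pow, inv_pow, ← pow_mul]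
      ring

end WightmanField

/-! ### The light cones -/

section Cone

variable {d : ℕ} [NeZero d]

theorem continuous_minkowskiSq : Continuous (minkowskiSq : Spacetime d → ℝ) := by
  unfold minkowskiSq
  fun_prop

theorem isClosed_backwardCone : IsClosed (backwardCone d) := by
  have h1 : IsClosed {ξ : Spacetime d | 0 ≤ minkowskiSq ξ} :=
    isClosed_le continuous_const continuous_minkowskiSq
  have h2 : IsClosed {ξ : Spacetime d | ξ 0 ≤ 0} := isClosed_le (by fun_prop) continuous_const
  exact h1.inter h2

theorem zero_mem_backwardCone : (0 : Spacetime d) ∈ backwardCone d := by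
  simp [backwardCone, minkowskiSq]

theorem neg_mem_backwardCone {p : Spacetime d} (hp : p ∈ forwardCone d) : -p ∈ backwardCone d := by
  simpa [backwardCone, forwardCone, minkowskiSq] using hp

theorem smul_mem_backwardCone {p : Spacetime d} (hp : p ∈ backwardCone d) {a : ℝ} (ha : 0 ≤ a) :
    a • p ∈ backwardCone d := by
  obtain ⟨h1, h2⟩ := hp
  constructor
  · have : minkowskiSq (a • p) = a ^ 2 * minkowskiSq p := by
      simp only [minkowskiSq, PiLp.smul_apply, smul_eq_mul, mul_pow, mul_sub, Finset.mul_sum]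
    rw [this]
    positivity
  · simpa using mul_nonpos_of_nonneg_of_nonpos ha h2

/-- Cauchy–Schwarz for the spatial parts, with both time components nonpositive, makes the Minkowski
product of two cone vectors nonnegative. -/
theorem add_mem_backwardCone {p q : Spacetime d} (hp : p ∈ backwardCone d)
    (hq : q ∈ backwardCone d) : p + q ∈ backwardCone d := by
  obtain ⟨hp1, hp2⟩ := hp
  obtain ⟨hq1, hq2⟩ := hq
  refine ⟨?_, by simpa using add_nonpos hp2 hq2⟩
  have h1 := Finset.sum_mul_sq_le_sq_mul_sq (Finset.univ.erase (0 : Fin d)) p q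
  simp only [minkowskiSq, sub_nonneg] at hp1 hq1
  have h2 : (∑ i ∈ Finset.univ.erase (0 : Fin d), p i * q i) ^ 2 ≤ (p 0 * q 0) ^ 2 := by
    rw [mul_pow]
    exact h1.trans (mul_le_mul hp1 hq1 (Finset.sum_nonneg fun _ _ => sq_nonneg _) (sq_nonneg _))
  have h3 : ∑ i ∈ Finset.univ.erase (0 : Fin d), p i * q i ≤ p 0 * q 0 :=
    le_of_sq_le_sq h2 (mul_nonneg_of_nonpos_of_nonpos hp2 hq2)
  have h4 : minkowskiSq (p + q) = (p 0 ^ 2 - ∑ i ∈ Finset.univ.erase (0 : Fin d), p i ^ 2) +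
      (q 0 ^ 2 - ∑ i ∈ Finset.univ.erase (0 : Fin d), q i ^ 2) +
      2 * (p 0 * q 0 - ∑ i ∈ Finset.univ.erase (0 : Fin d), p i * q i) := by
    simp only [minkowskiSq, PiLp.add_apply, add_sq, Finset.sum_add_distrib, mul_assoc,
      ← Finset.mul_sum]
    ring
  rw [h4]
  linarith

theorem convex_backwardCone : Convex ℝ (backwardCone d) := fun _ hp _ hq _ _ ha hb _ =>
  add_mem_backwardCone (smul_mem_backwardCone hp ha) (smul_mem_backwardCone hq hb)

/-- A covector at distance at least `ρ` from the backward cone is separated from it. -/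
theorem exists_unit_separating {ξ : Spacetime d} {ρ : ℝ} (hρ : 0 < ρ)
    (hξ : ∀ v ∈ backwardCone d, ρ ≤ ‖ξ - v‖) :
    ∃ y : Spacetime d, ‖y‖ = 1 ∧ (∀ p ∈ forwardCone d, ⟪y, p⟫_ℝ ≤ 0) ∧ ⟪y, ξ⟫_ℝ ≤ -ρ := by
  -- Project `ξ` to its nearest point `v` in the closed convex cone. Testing minimality with `0` and
  -- `2v` shows that `ξ - v` is orthogonal to `v`; the separating vector is the normalised `v - ξ`.
  obtain ⟨v, hv, hmin⟩ := exists_norm_eq_iInf_of_complete_convex ⟨0, zero_mem_backwardCone⟩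
    (isClosed_backwardCone (d := d)).isComplete convex_backwardCone ξ
  have h1 := (norm_eq_iInf_iff_real_inner_le_zero convex_backwardCone hv).1 hmin
  have h2 := h1 0 zero_mem_backwardCone
  have h3 := h1 ((2 : ℝ) • v) (smul_mem_backwardCone hv zero_le_two)
  rw [two_smul, add_sub_cancel_right] at h3
  rw [zero_sub, inner_neg_right] at h2
  have h4 : ⟪ξ - v, v⟫_ℝ = 0 := le_antisymm h3 (by linarith)
  have h5 := hξ v hv
  have h6 : 0 < ‖ξ - v‖ := hρ.trans_le h5
  refine ⟨(-‖ξ - v‖⁻¹) • (ξ - v), ?_, fun p hp => ?_, ?_⟩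
  · rw [norm_smul, norm_neg, norm_inv, norm_norm, inv_mul_cancel₀ h6.ne']
  · have h7 := h1 (-p) (neg_mem_backwardCone hp)
    rw [inner_sub_right, h4, sub_zero, inner_neg_right] at h7
    rw [real_inner_smul_left, neg_mul, neg_nonpos]
    exact mul_nonneg (inv_nonneg.2 h6.le) (by linarith)
  · have h8 : ⟪ξ - v, ξ⟫_ℝ = ‖ξ - v‖ ^ 2 := by
      rw [← real_inner_self_eq_norm_sq, inner_sub_right (ξ - v) ξ v, h4, sub_zero]
    rw [real_inner_smul_left, h8]
    have : -‖ξ - v‖⁻¹ * ‖ξ - v‖ ^ 2 = -‖ξ - v‖ := by field_simp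
    linarith

end Cone

/-! ### Weighted bounds on FBI transforms of families -/

section Families

variable {d : ℕ}

theorem PolynomiallyBounded.exists_supSeminorm_le {f : ℝ → 𝓢(Spacetime d, ℂ)}
    (hf : PolynomiallyBounded f) (m : ℕ) :
    ∃ (M : ℕ) (C : ℝ), 0 < C ∧ ∀ᶠ h : ℝ in 𝓝[>] 0,
      supSeminorm (Spacetime d) m (f h) ≤ C * (h ^ M)⁻¹ := by
  have h1 : ∀ i : Fin (m + 1) × Fin (m + 1), ∃ (M : ℕ) (C : ℝ), ∀ᶠ h : ℝ in 𝓝[>] 0,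
      SchwartzMap.seminorm ℂ i.1 i.2 (f h) ≤ C * (h ^ M)⁻¹ := by
    intro i
    obtain ⟨N, hN⟩ := hf i.1 i.2
    obtain ⟨C, hC⟩ := hN.bound
    refine ⟨N, C, ?_⟩
    filter_upwards [hC, self_mem_nhdsWithin] with h hb h0
    have h0' : (0 : ℝ) < h := h0
    rw [Real.norm_of_nonneg (apply_nonneg _ _), Real.norm_of_nonneg (by positivity)] at hb
    exact hb
  choose M C hC using h1
  obtain ⟨M', hM'⟩ := (eventually_all.2 fun i => eventually_ge_atTop (M i)).exists
  obtain ⟨C', hC'0, hC'⟩ := ((eventually_gt_atTop (0 : ℝ)).and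
    (eventually_all.2 fun i => eventually_ge_atTop (C i))).exists
  refine ⟨M', C', hC'0, ?_⟩
  filter_upwards [eventually_all.2 hC, Ioc_mem_nhdsGT one_pos] with h hb hh
  have h0 := hh.1
  refine supSeminorm_le (by positivity) fun k hk l hl => ?_
  refine (hb (⟨k, by omega⟩, ⟨l, by omega⟩)).trans ?_
  have h3 : (h ^ M (⟨k, by omega⟩, ⟨l, by omega⟩))⁻¹ ≤ (h ^ M')⁻¹ :=
    inv_anti₀ (by positivity) (pow_le_pow_of_le_one h0.le hh.2 (hM' _))
  exact mul_le_mul (hC' _) h3 (by positivity) hC'0.le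

theorem PolynomiallyBounded.exists_weighted_fbi_le {f : ℝ → 𝓢(Spacetime d, ℂ)}
    (hf : PolynomiallyBounded f) (N : ℕ) :
    ∃ (M : ℕ) (C : ℝ), 0 < C ∧ ∀ᶠ h : ℝ in 𝓝[>] 0, ∀ x ξ : Spacetime d,
      (1 + ‖x‖) ^ N * (1 + ‖ξ‖) ^ N * ‖fbi h (f h) (WithLp.toLp 2 (x, ξ))‖ ≤ C * (h ^ M)⁻¹ := by
  obtain ⟨m, M, C, hC, hb⟩ := exists_fbi_bound (d := d) N
  obtain ⟨M', C', hC', hb'⟩ := hf.exists_supSeminorm_le m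
  refine ⟨M + M', C * C', by positivity, ?_⟩
  filter_upwards [hb', Ioc_mem_nhdsGT one_pos] with h h1 hh x ξ
  have h0 := hh.1
  refine (hb h hh (f h) x ξ).trans ?_
  calc _ ≤ C * (h ^ M)⁻¹ * (C' * (h ^ M')⁻¹) := by gcongr
    _ = _ := by rw [pow_add, mul_inv]; ring

theorem MicrolocallyExpSmall.exists_weighted_fbi_le {f : ℝ → 𝓢(Spacetime d, ℂ)}
    {𝒰 : Set (PhaseSpace d)} (hf : MicrolocallyExpSmall f 𝒰) (N : ℕ) :
    ∃ δ C : ℝ, 0 < δ ∧ 0 < C ∧ ∀ᶠ h : ℝ in 𝓝[>] 0, ∀ x ξ : Spacetime d,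
      WithLp.toLp 2 (x, ξ) ∈ 𝒰 →
      (1 + ‖x‖) ^ N * (1 + ‖ξ‖) ^ N * ‖fbi h (f h) (WithLp.toLp 2 (x, ξ))‖ ≤
        C * Real.exp (-δ / h) := by
  obtain ⟨δ, hδ, hb⟩ := hf
  obtain ⟨C, hC, hb⟩ := hb N
  refine ⟨δ, 2 ^ N * C, hδ, by positivity, ?_⟩
  filter_upwards [hb] with h h1 x ξ hp
  have h2 := h1 _ hp
  simp only [WithLp.toLp_fst, WithLp.toLp_snd] at h2
  have h3 : (1 + ‖x‖) * (1 + ‖ξ‖) ≤ 2 * (1 + ‖x‖ ^ 2 + ‖ξ‖ ^ 2) := by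
    nlinarith [sq_nonneg (‖x‖ - 1), sq_nonneg (‖ξ‖ - 1), sq_nonneg (‖x‖ - ‖ξ‖)]
  calc _ = ((1 + ‖x‖) * (1 + ‖ξ‖)) ^ N * ‖fbi h (f h) (WithLp.toLp 2 (x, ξ))‖ := by rw [mul_pow]
    _ ≤ (2 * (1 + ‖x‖ ^ 2 + ‖ξ‖ ^ 2)) ^ N * ‖fbi h (f h) (WithLp.toLp 2 (x, ξ))‖ := by gcongr
    _ = 2 ^ N * ((1 + ‖x‖ ^ 2 + ‖ξ‖ ^ 2) ^ N * ‖fbi h (f h) (WithLp.toLp 2 (x, ξ))‖) := by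
      rw [mul_pow]; ring
    _ ≤ 2 ^ N * (C * Real.exp (-δ / h)) := by gcongr
    _ = _ := by ring

/-- Inverse powers of `h` are absorbed by exponential decay. -/
theorem inv_pow_mul_exp_le {δ : ℝ} (hδ : 0 < δ) (M : ℕ) {h : ℝ} (h0 : 0 < h) :
    (h ^ M)⁻¹ * Real.exp (-δ / h) ≤
      (M.factorial * (2 / δ) ^ M) * Real.exp (-(δ / 2) / h) := by
  have h1 := Real.pow_div_factorial_le_exp (x := δ / 2 / h) (by positivity) M
  have h2 : (h ^ M)⁻¹ ≤ (M.factorial * (2 / δ) ^ M) * Real.exp (δ / 2 / h) := by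
    calc (h ^ M)⁻¹ = (M.factorial * (2 / δ) ^ M) * ((δ / 2 / h) ^ M / M.factorial) := by
          have : (M.factorial : ℝ) ≠ 0 := by positivity
          simp only [div_pow]
          field_simp
      _ ≤ _ := by gcongr
  calc _ ≤ (M.factorial * (2 / δ) ^ M) * Real.exp (δ / 2 / h) * Real.exp (-δ / h) := by gcongr
    _ = _ := by
      rw [mul_assoc, ← Real.exp_add]
      congr 2
      field_simp
      ring

end Families

/-! ### Points near the microsupport. -/

section Separation

variable {d : ℕ}

/-- Doubling `ε` makes room for a distance to `K` that need not be attained. -/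
theorem exists_mem_norm_snd_sub_lt {K : Set (PhaseSpace d)} {p : PhaseSpace d} {ε : ℝ} (hε : 0 < ε)
    (hp : p ∉ {p | ENNReal.ofReal ε < Metric.infEDist p K}) :
    ∃ k ∈ K, ‖p.snd - k.snd‖ < 2 * ε := by
  have h1 : Metric.infEDist p K < ENNReal.ofReal (2 * ε) :=
    (not_lt.1 hp).trans_lt ((ENNReal.ofReal_lt_ofReal_iff (by positivity)).2 (by linarith))
  obtain ⟨k, hk, h2⟩ := Metric.infEDist_lt_iff.1 h1
  refine ⟨k, hk, ?_⟩
  rw [edist_dist, ENNReal.ofReal_lt_ofReal_iff (by positivity), dist_eq_norm] at h2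
  exact (WithLp.norm_snd_le _ (p - k)).trans_lt h2

end Separation

/-! ### Exponential smallness of vacuum vectors. -/

namespace WightmanField

variable {d : ℕ} [NeZero d] {H : Type*} [NormedAddCommGroup H] [InnerProductSpace ℂ H]
  (W : WightmanField d H)

/-- If phase space points outside the regions `B i` of exponential smallness have total momentum
separated from the backward cone, then the vacuum vector is exponentially small. -/
theorem exists_norm_vacuumVector_le_exp (hspec : W.SpectrumCondition) {n : ℕ}
    {F : Fin n → ℝ → 𝓢(Spacetime d, ℂ)} (hF : ∀ i, PolynomiallyBounded (F i))
    {B : Fin n → Set (PhaseSpace d)} (hB : ∀ i, MicrolocallyExpSmall (F i) (B i)) {c : ℝ}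
    (hc : 0 < c) (hsep : ∀ x ξ : Fin n → Spacetime d, (∀ i, WithLp.toLp 2 (x i, ξ i) ∉ B i) →
      ∃ y : Spacetime d, ‖y‖ ≤ 1 ∧ (∀ p ∈ forwardCone d, ⟪y, p⟫_ℝ ≤ 0) ∧
        ⟪y, ∑ i, ξ i⟫_ℝ + n * ‖y‖ ^ 2 / 2 ≤ -c) :
    ∃ C δ : ℝ, 0 < C ∧ 0 < δ ∧ ∀ᶠ h : ℝ in 𝓝[>] 0,
      ‖W.vacuumVector n fun i => F i h‖ ≤ C * Real.exp (-δ / h) := by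
  obtain ⟨m, M, C, hC, hG⟩ := W.exists_norm_vacuumVector_packet_le hspec n
  choose M₁ C₁ hC₁ hpoly using fun i => (hF i).exists_weighted_fbi_le (m + (d + 1))
  choose δ₂ C₂ hδ₂ hC₂ hsmall using fun i => (hB i).exists_weighted_fbi_le (m + (d + 1))
  obtain ⟨M', hM'⟩ := (eventually_all.2 fun i => eventually_ge_atTop (M₁ i)).exists
  obtain ⟨C', hC'0, hC'1, hC'2⟩ := ((eventually_gt_atTop (0 : ℝ)).and
    ((eventually_all.2 fun i => eventually_ge_atTop (C₁ i)).and
      (eventually_all.2 fun i => eventually_ge_atTop (C₂ i)))).exists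
  obtain ⟨δ, hδ0, hδ1, hδ2⟩ := ((eventually_mem_nhdsWithin (a := (0 : ℝ)) (s := Set.Ioi 0)).and
    ((eventually_nhdsWithin_of_eventually_nhds (eventually_le_nhds hc)).and
      (eventually_all.2 fun i =>
        eventually_nhdsWithin_of_eventually_nhds (eventually_le_nhds (hδ₂ i))))).exists
  have hδ : 0 < δ := hδ0
  set J : ℝ := ∫ p, phaseWeight d p with hJ
  have hJ0 : 0 ≤ J := integral_nonneg fun p => (phaseWeight_pos p).le
  -- All losses in `1/h`: `M` from the packet estimate, `M'` for each FBI transform, `d` for each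
  -- inversion constant.
  set T : ℕ := M + M' * n + d * n with hT
  refine ⟨C * C' ^ n * (J + 1) ^ n * (T.factorial * (2 / δ) ^ T), δ / 2, by positivity,
    by positivity, ?_⟩
  filter_upwards [eventually_all.2 hpoly, eventually_all.2 hsmall, Ioc_mem_nhdsGT one_pos]
    with h hp hs hh
  have h0 := hh.1
  set A : ℝ := C * (h ^ M)⁻¹ * (C' * (h ^ M')⁻¹) ^ n * Real.exp (-δ / h) with hA
  have hA0 : 0 ≤ A := by positivity
  have key : ∀ p : Fin n → Spacetime d × Spacetime d,
      (∏ i, ‖fbi h (F i h) (WithLp.toLp 2 (p i))‖) *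
        ‖W.vacuumVector n fun i => packet hh (p i).1 (p i).2‖ ≤ A * ∏ i, phaseWeight d (p i) := by
    intro p
    -- Of the weight exponent `m + (d + 1)`, the part `m` cancels the growth of the packet estimate
    -- and `d + 1` leaves the integrable `phaseWeight`.
    let t : Fin n → ℝ := fun i => (1 + ‖(p i).1‖) ^ (m + (d + 1)) *
      (1 + ‖(p i).2‖) ^ (m + (d + 1)) * ‖fbi h (F i h) (WithLp.toLp 2 (p i))‖
    have ht0 : ∀ i, 0 ≤ t i := fun i => by positivity
    have hw : ∀ i, ‖fbi h (F i h) (WithLp.toLp 2 (p i))‖ *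
        ((1 + ‖(p i).1‖) ^ m * (1 + ‖(p i).2‖) ^ m) = t i * phaseWeight d (p i) := by
      intro i
      simp only [t, phaseWeight, pow_add _ m (d + 1)]
      field_simp
    have htp : ∀ i, t i ≤ C' * (h ^ M')⁻¹ := by
      intro i
      refine (hp i (p i).1 (p i).2).trans ?_
      exact mul_le_mul (hC'1 i) (inv_anti₀ (by positivity)
        (pow_le_pow_of_le_one h0.le hh.2 (hM' i))) (by positivity) hC'0.le
    have hpw : 0 ≤ ∏ i, phaseWeight d (p i) :=
      Finset.prod_nonneg fun i _ => (phaseWeight_pos _).le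
    have reduce : ∀ y : Spacetime d, ‖y‖ ≤ 1 → (∀ p ∈ forwardCone d, ⟪y, p⟫_ℝ ≤ 0) →
        (∏ i, t i) * Real.exp ((⟪y, ∑ i, (p i).2⟫_ℝ + n * ‖y‖ ^ 2 / 2) / h) ≤
          (C' * (h ^ M')⁻¹) ^ n * Real.exp (-δ / h) →
        (∏ i, ‖fbi h (F i h) (WithLp.toLp 2 (p i))‖) *
          ‖W.vacuumVector n fun i => packet hh (p i).1 (p i).2‖ ≤
            A * ∏ i, phaseWeight d (p i) := by
      intro y hy1 hy2 hy3
      set e := Real.exp ((⟪y, ∑ i, (p i).2⟫_ℝ + n * ‖y‖ ^ 2 / 2) / h)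
      calc _ ≤ (∏ i, ‖fbi h (F i h) (WithLp.toLp 2 (p i))‖) * (C * (h ^ M)⁻¹ *
            (∏ i, (1 + ‖(p i).1‖) ^ m * (1 + ‖(p i).2‖) ^ m) * e) :=
          mul_le_mul_of_nonneg_left (hG h hh y hy1 hy2 (fun i => (p i).1) fun i => (p i).2)
            (Finset.prod_nonneg fun i _ => norm_nonneg _)
        _ = C * (h ^ M)⁻¹ * e * ∏ i, ‖fbi h (F i h) (WithLp.toLp 2 (p i))‖ *
            ((1 + ‖(p i).1‖) ^ m * (1 + ‖(p i).2‖) ^ m) := by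
          simp only [Finset.prod_mul_distrib]
          ring
        _ = C * (h ^ M)⁻¹ * ((∏ i, t i) * e) * ∏ i, phaseWeight d (p i) := by
          simp_rw [hw]
          rw [Finset.prod_mul_distrib]
          ring
        _ ≤ C * (h ^ M)⁻¹ * ((C' * (h ^ M')⁻¹) ^ n * Real.exp (-δ / h)) *
            ∏ i, phaseWeight d (p i) := by gcongr
        _ = _ := by rw [hA]; ring
    -- If no point lies in its region of smallness, the momentum shift provides the exponential
    -- factor.
    by_cases hout : ∀ i, WithLp.toLp 2 ((p i).1, (p i).2) ∉ B i
    · obtain ⟨y, hy1, hy2, hy3⟩ := hsep (fun i => (p i).1) (fun i => (p i).2) hout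
      refine reduce y hy1 hy2 (mul_le_mul ?_ ?_ (Real.exp_pos _).le (by positivity))
      · calc _ ≤ ∏ _i : Fin n, C' * (h ^ M')⁻¹ :=
              Finset.prod_le_prod (fun i _ => ht0 i) fun i _ => htp i
          _ = _ := by simp
      · refine Real.exp_le_exp.2 (div_le_div_of_nonneg_right ?_ h0.le)
        exact hy3.trans (neg_le_neg hδ1)
    · push Not at hout
      obtain ⟨j, hj⟩ := hout
      -- Here one FBI transform is already exponentially small, so the unshifted estimate `y = 0` is
      -- enough.
      refine reduce 0 (by simp) (by simp) ?_
      have h1 : ∀ i, t i ≤ C' * (h ^ M')⁻¹ * if i = j then Real.exp (-δ / h) else 1 := by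
        intro i
        split_ifs with hij
        · subst hij
          refine (hs i (p i).1 (p i).2 hj).trans ?_
          have h2 : 1 ≤ (h ^ M')⁻¹ := (one_le_inv₀ (by positivity)).2 (pow_le_one₀ h0.le hh.2)
          have h3 : Real.exp (-δ₂ i / h) ≤ Real.exp (-δ / h) :=
            Real.exp_le_exp.2 (div_le_div_of_nonneg_right (neg_le_neg (hδ2 i)) h0.le)
          refine mul_le_mul ((hC'2 i).trans ?_) h3 (Real.exp_pos _).le (by positivity)
          exact le_mul_of_one_le_right hC'0.le h2
        · rw [mul_one]
          exact htp i
      have h4 := Finset.prod_le_prod (s := Finset.univ) (fun i _ => ht0 i) fun i _ => h1 i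
      have h5 : ∏ i, (C' * (h ^ M')⁻¹ * if i = j then Real.exp (-δ / h) else 1) =
          (C' * (h ^ M')⁻¹) ^ n * Real.exp (-δ / h) := by
        rw [Finset.prod_mul_distrib, Finset.prod_ite_eq' Finset.univ j fun _ => Real.exp (-δ / h)]
        simp
      rw [h5] at h4
      rw [inner_zero_left, norm_zero, zero_pow two_ne_zero, mul_zero, zero_div, add_zero, zero_div,
        Real.exp_zero, mul_one]
      exact h4
  have hfin := norm_multilinear_le_of_packets (W.vacuumVector n)
    (W.continuous_vacuumVector_update n) hh (fun i => F i h) hA0 key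
  refine hfin.trans ?_
  calc _ ≤ A * ((h ^ d)⁻¹ * (J + 1)) ^ n := by
        have h1 := fbiInvConst_inv_le (d := d) hh
        have h2 := fbiInvConst_pos (d := d) h0
        gcongr
        linarith
    _ = C * C' ^ n * (J + 1) ^ n * ((h ^ T)⁻¹ * Real.exp (-δ / h)) := by
      rw [hA, hT, pow_add, pow_add, pow_mul, pow_mul, mul_inv, mul_inv, mul_pow, mul_pow, inv_pow,
        inv_pow]
      ring
    _ ≤ C * C' ^ n * (J + 1) ^ n * ((T.factorial * (2 / δ) ^ T) * Real.exp (-(δ / 2) / h)) := by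
      exact mul_le_mul_of_nonneg_left (inv_pow_mul_exp_le hδ T h0) (by positivity)
    _ = _ := by ring

/-- The zero-energy families cannot change the total momentum appreciably, so it stays away from the
backward cone wherever no factor is exponentially small. -/
theorem expSmallOn_vacuum (hspec : W.SpectrumCondition) {K : Set (PhaseSpace d)} {r : ℝ}
    (hr : 0 < r) (hK : ∀ p ∈ K, ∀ p' ∈ backwardConeBundle d, r ≤ dist p p') :
    W.ExpSmallOn W.Ω K := by
  intro f hf hfK n q hq
  set ε : ℝ := r / (8 * (n + 1)) with hε
  have hε0 : 0 < ε := by positivity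
  -- Below, `u·∑ ξᵢ ≤ -r/2 + r/4` for a unit vector `u`, where `ε` is chosen so that the `n` small
  -- covectors contribute at most `r/4`. For `y = η u` the linear gain is `η r / 4`, and `(n + 1) η
  -- ≤ r / 4` keeps the quadratic loss below half of it, leaving `c = η r / 8`.
  set η : ℝ := min 1 (r / (4 * (n + 1))) with hη
  have hη0 : 0 < η := by positivity
  have hη1 : η ≤ 1 := min_le_left _ _
  have hη2 : (n + 1) * η ≤ r / 4 := by
    have : η ≤ r / (4 * (n + 1)) := min_le_right _ _
    calc (n + 1) * η ≤ (n + 1) * (r / (4 * (n + 1))) := by gcongr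
      _ = _ := by field_simp
  let F : Fin (n + 1) → ℝ → 𝓢(Spacetime d, ℂ) := Fin.cons f q
  let B : Fin (n + 1) → Set (PhaseSpace d) :=
    Fin.cons {p | ENNReal.ofReal (r / 4) < Metric.infEDist p K}
      fun _ => {p | ENNReal.ofReal ε < Metric.infEDist p (zeroSection d)}
  have hmain := W.exists_norm_vacuumVector_le_exp hspec (F := F) (B := B) (c := η * r / 8) ?_ ?_
    (by positivity) ?_
  · obtain ⟨C, δ, hC, hδ, hb⟩ := hmain
    refine ⟨C, δ, hC, hδ, ?_⟩
    filter_upwards [hb] with h h1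
    rw [vacuumVector_apply, List.ofFn_succ, List.prod_cons] at h1
    exact h1
  · exact Fin.cases hf fun j => (hq j).1
  · exact Fin.cases (hfK _ (by positivity)) fun j => (hq j).2 ε hε0
  · intro x ξ hout
    obtain ⟨k, hk, hk1⟩ := exists_mem_norm_snd_sub_lt (by positivity) (hout 0)
    have hz : ∀ j : Fin n, ‖ξ j.succ‖ ≤ 2 * ε := by
      intro j
      obtain ⟨z, hz, hz1⟩ := exists_mem_norm_snd_sub_lt hε0 (hout j.succ)
      have hz0 : z.snd = 0 := hz
      rw [hz0, sub_zero] at hz1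
      exact hz1.le
    have hdist : ∀ v ∈ backwardCone d, r / 2 ≤ ‖ξ 0 - v‖ := by
      intro v hv
      -- Comparing with the point of the cone bundle over the same position turns phase space
      -- distance into distance of covectors.
      have h1 := hK k hk (WithLp.toLp 2 (k.fst, v)) hv
      rw [WithLp.prod_dist_eq_of_L2] at h1
      simp only [WithLp.toLp_fst, WithLp.toLp_snd, dist_self] at h1
      rw [zero_pow two_ne_zero, zero_add, Real.sqrt_sq dist_nonneg] at h1
      have h2 := dist_triangle k.snd (ξ 0) v
      have h3 : dist k.snd (ξ 0) < 2 * (r / 4) := by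
        rw [dist_comm, dist_eq_norm]
        exact hk1
      rw [← dist_eq_norm]
      linarith
    obtain ⟨u, hu1, hu2, hu3⟩ := exists_unit_separating (half_pos hr) hdist
    have hnorm : ‖η • u‖ = η := by rw [norm_smul, hu1, mul_one, Real.norm_of_nonneg hη0.le]
    refine ⟨η • u, hnorm.trans_le hη1, fun p hp => ?_, ?_⟩
    · rw [real_inner_smul_left]
      exact mul_nonpos_of_nonneg_of_nonpos hη0.le (hu2 p hp)
    · have h1 : ∑ j : Fin n, ⟪u, ξ j.succ⟫_ℝ ≤ r / 4 := by
        calc _ ≤ ∑ _j : Fin n, 2 * ε := by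
              refine Finset.sum_le_sum fun j _ => ?_
              have := real_inner_le_norm u (ξ j.succ)
              rw [hu1, one_mul] at this
              exact this.trans (hz j)
          _ = n * (2 * ε) := by simp
          _ ≤ (n + 1) * (2 * ε) := by gcongr; linarith
          _ = r / 4 := by rw [hε]; field_simp; norm_num
      have h2 : ⟪u, ∑ i, ξ i⟫_ℝ ≤ -(r / 4) := by
        rw [Fin.sum_univ_succ, inner_add_right, inner_sum]
        linarith
      rw [hnorm, real_inner_smul_left]
      push_cast
      have h3 : η * ⟪u, ∑ i, ξ i⟫_ℝ ≤ η * -(r / 4) := by gcongr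
      have h4 : η * ((n + 1) * η) ≤ η * (r / 4) := by gcongr
      nlinarith

/-- A compact set disjoint from the closed cone bundle has positive distance from it. -/
theorem isTemperedAnalytic_vacuum (hspec : W.SpectrumCondition) : W.IsTemperedAnalytic W.Ω := by
  intro K hK hdisj
  have hclosed : IsClosed (backwardConeBundle d) :=
    isClosed_backwardCone.preimage (by fun_prop : Continuous fun p : PhaseSpace d => p.snd)
  obtain ⟨r, hr, hb⟩ := hdisj.exists_thickenings hK hclosed
  refine W.expSmallOn_vacuum hspec (r := r) hr fun p hp p' hp' => ?_
  by_contra! hlt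
  refine Set.disjoint_left.1 hb (Metric.self_subset_thickening hr _ hp) ?_
  exact Metric.mem_thickening_iff.2 ⟨p', hp', hlt⟩

end WightmanField

end WightmanAnalytic

end

theorem mainTheorem5 (d : ℕ) [NeZero d] (H : Type*) [NormedAddCommGroup H]
    [InnerProductSpace ℂ H] [CompleteSpace H] (W : WightmanAnalytic.WightmanField d H)
    (hspec : W.SpectrumCondition) :
    W.IsTemperedAnalytic W.Ω ∧
      ∀ K : Set (WightmanAnalytic.PhaseSpace d),
        (∃ r : ℝ, 0 < r ∧
          ∀ p ∈ K, ∀ p' ∈ WightmanAnalytic.backwardConeBundle d, r ≤ dist p p') →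
          W.ExpSmallOn W.Ω K :=
  ⟨W.isTemperedAnalytic_vacuum hspec, fun _ ⟨_, hr, hK⟩ => W.expSmallOn_vacuum hspec hr hK⟩
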